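/- **Theorem 1.** Let $\mathbb{F}_q$ be the finite field with $q$ elements and characteristic $p$, and let $\mathbb{F}_q((1/t))$ be the field of formal Laurent series $\alpha=\sum_{i\le M}\alpha_i t^i$ (with $M\in\mathbb{Z}$ and $\alpha_i\in\mathbb{F}_q$), with the topology given by the absolute value $|\alpha|=q^{\mathrm{ord}(\alpha)}$, where $\mathrm{ord}(\alpha)$ is the largest $i$ with $\alpha_i\neq 0$, and $|0|=0$. Put $e(\alpha)=\exp\big(2\pi i\,\mathrm{tr}(\alpha_{-1})/p\big)$, where $\mathrm{tr}:\mathbb{F}_q\to\mathbb{F}_p$ is the field trace, let $\mathbb{T}=\{\alpha\in\mathbb{F}_q((1/t)):|\alpha|<1\}$, and let $d\alpha$ be the Haar measure on $\mathbb{F}_q((1/t))$ with $\int_{\mathbb{T}}1\,d\alpha=1$. For an integer $r\ge 2$ let $a_r(f)=1$ if $f\in\mathbb{F}_q[t]$ is $r$-free (that is, $\pi^r\nmid f$ for every irreducible $\pi\in\mathbb{F}_q[t]$) and $a_r(f)=0$ otherwise. For real $k\ge 0$ and an integer $N\ge 0$ let $$I_r(k)=\int_{\mathbb{T}}\Big|\sum_{\substack{f\in\mathbb{F}_q[t]\text{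 monic}\\ \deg f\le N}}a_r(f)\,e(f\alpha)\Big|^k\,d\alpha ,$$ with the convention $0^0=1$. Then for every integer $r\ge 2$ and every real $k\ge 0$ there are constants $c,C>0$, depending only on $k$, $q$ and $r$, such that $$c\,B\le I_r(k)\le C\,B,\qquad\text{where}\qquad B=\begin{cases} q^{Nk/(r+1)} & \text{if } k<1+1/r,\\ N q^{N/r} & \text{if } k=1+1/r,\\ q^{N(k-1)} & \text{if } k>1+1/r,\end{cases}$$ for every integer $N\ge 0$ if $k\ne 1+1/r$, and for every integer $N\ge 1$ if $k=1+1/r$. -/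

import Mathlib

open scoped LaurentSeries Polynomial

noncomputable section

namespace RFreeMoments

variable (F : Type*) [Field F]

/-- The element `t` of the field `F((1/t))`. This field is realised as the field `F⸨X⸩` of Laurent
series in the variable `X = 1/t`, with its valuation topology: the coefficient of `t ^ n` in `α`
is `α.coeff (-n)`. -/
def tElt : F⸨X⸩ := HahnSeries.single (-1 : ℤ) (1 : F)

variable {F}

/-- A polynomial in `t`, seen as an element of `F((1/t))`. -/
def ofPoly (f : F[X]) : F⸨X⸩ := f.eval₂ HahnSeries.C (tElt F)

/-- `f` is `r`-free: no irreducible polynomial `π` satisfies `π ^ r ∣ f`. -/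
def IsRFree (r : ℕ) (f : F[X]) : Prop := ∀ π : F[X], Irreducible π → ¬ π ^ r ∣ f

open Classical in
/-- The indicator function `a_r` of the `r`-free polynomials. -/
def rFreeInd (r : ℕ) (f : F[X]) : ℂ := if IsRFree r f then 1 else 0

/-- The additive character `c ↦ exp (2 π i tr(c) / p)` of the finite field `F`, where `p` is the
characteristic of `F` and `tr` is the trace from `F` to its prime field. -/
def eField (c : F) : ℂ :=
  letI : Algebra (ZMod (ringChar F)) F := ZMod.algebra F (ringChar F)
  Complex.exp (2 * Real.pi * Complex.I *
    ((Algebra.trace (ZMod (ringChar F)) F c).val : ℂ) / (ringChar F : ℂ))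

/-- The additive character `e` of `F((1/t))`: `e(α) = eField(α₋₁)`, where `α₋₁` is the
coefficient of `t ^ (-1)` in `α`. -/
def eChar (α : F⸨X⸩) : ℂ := eField (α.coeff 1)

/-- There are finitely many monic polynomials of degree at most `N` over a finite field. -/
theorem finite_monics [Finite F] (N : ℕ) : {f : F[X] | f.Monic ∧ f.natDegree ≤ N}.Finite := by
  refine Set.Finite.of_finite_image (f := fun f : F[X] => fun i : Fin (N + 1) => f.coeff i)
    (Set.toFinite _) ?_
  rintro f ⟨-, hf⟩ g ⟨-, hg⟩ h
  ext n
  by_cases hn : n < N + 1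
  · exact congrFun h ⟨n, hn⟩
  · rw [Polynomial.coeff_eq_zero_of_natDegree_lt (by omega),
      Polynomial.coeff_eq_zero_of_natDegree_lt (by omega)]

/-- The finite set of monic polynomials of degree at most `N`. -/
def monics (F : Type*) [Field F] [Finite F] (N : ℕ) : Finset F[X] := (finite_monics N).toFinset

/-- The exponential sum `G(α) = ∑ a_r(f) e(f α)` over monic `f` with `deg f ≤ N`. -/
def expSum [Finite F] (r N : ℕ) (α : F⸨X⸩) : ℂ :=
  ∑ f ∈ monics F N, rFreeInd r f * eChar (ofPoly f * α)

variable (F)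

/-- The torus: the `α` in `F((1/t))` all of whose coefficients at `t ^ m`, `m ≥ 0`, vanish, that
is `ord α < 0` (with `ord 0 = -∞`). -/
def torus : Set F⸨X⸩ := {α | ∀ n : ℤ, n ≤ 0 → α.coeff n = 0}

/-- The torus is the open unit ball of the valuation of `F((1/t))`. -/
theorem mem_torus_iff (α : F⸨X⸩) :
    α ∈ torus F ↔ Valued.v α < (1 : WithZero (Multiplicative ℤ)) := by
  have h1 : α ∈ torus F ↔ Valued.v α ≤ WithZero.exp (-1 : ℤ) :=
    (forall_congr' fun n => by rw [← Int.lt_add_one_iff, zero_add]).trans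
      (LaurentSeries.valuation_le_iff_coeff_lt_eq_zero F).symm
  rw [h1]
  constructor
  · intro h
    exact h.trans_lt (by rw [← WithZero.exp_zero, WithZero.exp_lt_exp]; norm_num)
  · intro h
    by_cases h0 : Valued.v α = (0 : WithZero (Multiplicative ℤ))
    · rw [h0]; exact zero_le
    · rw [← WithZero.exp_log h0, ← WithZero.exp_zero, WithZero.exp_lt_exp] at h
      rw [← WithZero.exp_log h0, WithZero.exp_le_exp]
      omega

theorem isOpen_torus : IsOpen (torus F) := by
  have h : torus F = {α : F⸨X⸩ | Valued.v.restrict α < 1} := by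
    ext α
    rw [mem_torus_iff]
    exact (Valuation.restrict_lt_one_iff _).symm
  rw [h]
  exact Valued.isOpen_ball F⸨X⸩ 1

/-- The element `c 0 * t ^ (-1) + c 1 * t ^ (-2) + ...` of the torus. -/
def ofCoeffs (c : ℕ → F) : F⸨X⸩ :=
  HahnSeries.ofPowerSeries ℤ F (PowerSeries.X * PowerSeries.mk c)

theorem coeff_ofCoeffs_succ (c : ℕ → F) (n : ℕ) : (ofCoeffs F c).coeff (n + 1) = c n := by
  have h := LaurentSeries.coeff_coe_powerSeries (PowerSeries.X * PowerSeries.mk c) (n + 1)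
  rw [PowerSeries.coeff_succ_X_mul, PowerSeries.coeff_mk] at h
  rw [← h, Nat.cast_succ]
  rfl

theorem coeff_ofCoeffs_nonpos (c : ℕ → F) (n : ℤ) (hn : n ≤ 0) : (ofCoeffs F c).coeff n = 0 := by
  unfold ofCoeffs
  rw [PowerSeries.coeff_coe]
  split_ifs with h
  · rfl
  · have : n.natAbs = 0 := by omega
    rw [this]
    simp

theorem isCompact_torus [Finite F] : IsCompact (torus F) := by
  let _ : TopologicalSpace F := ⊥
  have : DiscreteTopology F := ⟨rfl⟩
  have hr : torus F = Set.range (ofCoeffs F) := by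
    ext α
    constructor
    · intro h
      refine ⟨fun n => α.coeff (n + 1), ?_⟩
      ext n
      by_cases hn : n ≤ 0
      · rw [coeff_ofCoeffs_nonpos F _ n hn, h n hn]
      · obtain ⟨m, rfl⟩ : ∃ m : ℕ, n = m + 1 := ⟨(n - 1).toNat, by omega⟩
        rw [coeff_ofCoeffs_succ]
    · rintro ⟨c, rfl⟩ n hn
      exact coeff_ofCoeffs_nonpos F c n hn
  rw [hr]
  refine isCompact_range (continuous_iff_continuousAt.mpr fun c U hU => ?_)
  obtain ⟨γ, hγ⟩ := Valued.mem_nhds.mp hU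
  set g := MonoidWithZeroHom.ValueGroup₀.embedding γ.1 with hg
  set D : ℤ := -(WithZero.log g - 1) with hD₀
  have hD : WithZero.exp (-D) < g := by
    rw [← WithZero.lt_log_iff_exp_lt (by simp [hg]), hD₀]
    simp
  have hev : ∀ᶠ c' in nhds c, ∀ i ∈ Set.Iio D.toNat, c' i = c i := by
    rw [Filter.eventually_all_finite (Set.finite_Iio _)]
    intro i _
    exact (continuous_apply i).continuousAt.eventually
      ((isOpen_discrete {c i}).mem_nhds rfl)
  rw [Filter.mem_map]
  filter_upwards [hev] with c' hc'
  refine hγ ?_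
  change Valued.v.restrict _ < γ.1
  rw [Valuation.restrict_lt_iff_lt_embedding]
  refine lt_of_le_of_lt ((LaurentSeries.valuation_le_iff_coeff_lt_eq_zero F).mpr ?_) hD
  intro n hn
  rw [HahnSeries.coeff_sub]
  by_cases hn0 : n ≤ 0
  · rw [coeff_ofCoeffs_nonpos F _ n hn0, coeff_ofCoeffs_nonpos F _ n hn0, sub_zero]
  · obtain ⟨m, rfl⟩ : ∃ m : ℕ, n = m + 1 := ⟨(n - 1).toNat, by omega⟩
    rw [coeff_ofCoeffs_succ, coeff_ofCoeffs_succ, hc' m (by simp only [Set.mem_Iio]; omega),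
      sub_self]

/-- The torus, as a compact set with non-empty interior. -/
def torusCompacts [Finite F] : TopologicalSpace.PositiveCompacts F⸨X⸩ where
  carrier := torus F
  isCompact' := isCompact_torus F
  interior_nonempty' := by
    rw [(isOpen_torus F).interior_eq]
    exact ⟨0, fun _ _ => rfl⟩

/-- The Borel `σ`-algebra of `F((1/t))`. -/
instance : MeasurableSpace F⸨X⸩ := borel _

instance : BorelSpace F⸨X⸩ := ⟨rfl⟩

/-- The Haar measure of `F((1/t))` that gives the torus measure `1`. -/
def haar [Finite F] : MeasureTheory.Measure F⸨X⸩ :=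
  MeasureTheory.Measure.addHaarMeasure (torusCompacts F)

/-- The `k`-th moment `I_r(k) = ∫ |G(α)| ^ k dα` over the torus, for monic polynomials of degree
at most `N`. -/
def moment [Finite F] (r N : ℕ) (k : ℝ) : ℝ :=
  ∫ α in torus F, ‖expSum r N α‖ ^ k ∂(haar F)

end RFreeMoments

end

/-!
The exponential sum is first reduced to finite data: only the coefficients of
`t ^ (-1), ..., t ^ (-N - 1)` of `α` matter, so that `moment F r N k` is an average over
`x : Fin (N + 1) → F` of the sum of `chi x f` over `r`-free monic `f` (`moment_eq_expect`). Write
`q` for the cardinality of `F`, and let `S m` be the part of the sum with `deg f = m`.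

Möbius inversion writes `S m` as a sum over monic `d` of `moeb d` times the sum of the characters
over the monic multiples of `d ^ r` of degree `m`. For fixed `d` of degree `j` that inner sum is, up
to a phase, `q ^ (m - r j)` times the indicator of `ann n m (d ^ r)`, the set of `α` within
`q ^ (-m)` of a fraction with denominator `d ^ r`. Restricting to a single degree is what makes this
exact, without a logarithmic loss. Let `nu m r j` count the `d` of degree `j` with `α` in this set.
Two of these sets intersect in the one of the greatest common divisor, apart from rare coincidences
(`ann_inter_eq`, `prob_ann_inter_sdiff_le`); hence the correlations of `nu m r i` and `nu m r j`
are known (`expect_nu_mul_nu_le_three`).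

*Upper bound.* The divisors of degree greater than `m / (r + 1)` are small in mean square
(`expect_norm_highPart_sq_le`), and contribute the term `q ^ (m k / (r + 1))`. For the others,
subadditivity of `u ↦ u ^ (k / 2)` and the integrality of `nu` reduce the `k`-th moment, `k ≤ 2`, to
the correlations of `nu`, which decay geometrically in `|i - j|` after normalisation. By Schur's test
each degree `i` contributes `q ^ (m (k - 1) + i (r + 1 - r k))`: this geometric progression is
increasing, constant or decreasing according as `k` is smaller than, equal to or larger than
`1 + 1 / r`. The bounds for `S m` grow geometrically in `m`, so they can be summed over `m ≤ N`. For
`k ≥ 2` Parseval's identity and the trivial bound are enough.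

*Lower bound.* It suffices to treat `S N` (`expect_expMon_le_mul_expect_expTot`). No `r`-free `f` is
a multiple of `d ^ r`, so the sum over the fractions with denominator `d ^ r` of `S N`, freed of its
phase, vanishes for `d ≠ 1`. By Möbius inversion its sum over the fractions with exact denominator
`d ^ r` is `moeb d` times its value near `0` (`primitiveMean_eq`), and therefore large for
squarefree `d`. Above the critical exponent `d = 1` is enough. At the critical exponent all degrees
`j ≤ N / (2 r)` contribute equally, by Hölder's inequality, and the fractions involved are distinct.
Below it, take `j` slightly smaller than `N / (r + 1)`: near most fractions with exact denominator
`d ^ r`, `deg d = j`, the sum is dominated by the multiples of `d`, hence has size at most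
`4 q ^ (N - r j)`, which is comparable to `q ^ (N / (r + 1))`. Being large on average and bounded
there, it is of that size on a set of positive proportion (`le_mul_expect_expMon`).
-/


noncomputable section

namespace RFreeMoments

/-! ### Counting monic polynomials -/

section Counting
open Polynomial Finset
open scoped Classical

variable {F : Type*} [Field F]

/-- Two monic polynomials are a common monic factor times coprime monic cofactors. -/
theorem exists_coprime_cofactors {d d' : F[X]} (hd : d.Monic) (hd' : d'.Monic) :
    ∃ G u v : F[X], G.Monic ∧ u.Monic ∧ v.Monic ∧ IsCoprime u v ∧ d = G * u ∧ d' = G * v := by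
  obtain ⟨u, hu⟩ := EuclideanDomain.gcd_dvd_left d d'
  obtain ⟨v, hv⟩ := EuclideanDomain.gcd_dvd_right d d'
  set g := EuclideanDomain.gcd d d' with hg
  have hg0 : g ≠ 0 := by
    rintro h
    rw [h, zero_mul] at hu
    exact hd.ne_zero hu
  have hlc : g.leadingCoeff ≠ 0 := leadingCoeff_ne_zero.mpr hg0
  have hC : (C g.leadingCoeff⁻¹ : F[X]) * C g.leadingCoeff = 1 := by
    rw [← C_mul, inv_mul_cancel₀ hlc, C_1]
  have h1 : d = (g * C g.leadingCoeff⁻¹) * (C g.leadingCoeff * u) := by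
    rw [hu]; linear_combination (- g * u) * hC
  have h2 : d' = (g * C g.leadingCoeff⁻¹) * (C g.leadingCoeff * v) := by
    rw [hv]; linear_combination (- g * v) * hC
  have hG : (g * C g.leadingCoeff⁻¹).Monic := monic_mul_leadingCoeff_inv hg0
  refine ⟨_, _, _, hG, hG.of_mul_monic_left (h1 ▸ hd), hG.of_mul_monic_left (h2 ▸ hd'), ?_, h1, h2⟩
  have hcop : IsCoprime u v := by
    have hb := EuclideanDomain.gcd_eq_gcd_ab d d'
    rw [← hg] at hb
    refine ⟨EuclideanDomain.gcdA d d', EuclideanDomain.gcdB d d', ?_⟩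
    apply mul_left_cancel₀ hg0
    linear_combination (-1 : F[X]) * hb - (EuclideanDomain.gcdA d d') * hu -
      (EuclideanDomain.gcdB d d') * hv
  have hun : IsUnit (C g.leadingCoeff) := isUnit_C.mpr hlc.isUnit
  exact (isCoprime_mul_unit_left_left hun _ _).mpr
    ((isCoprime_mul_unit_left_right hun _ _).mpr hcop)

variable (F) [Finite F]

/-- The monic polynomials of degree exactly `m`. -/
def mon (m : ℕ) : Finset F[X] := {f ∈ monics F m | f.natDegree = m}

theorem finite_lowDeg (m : ℕ) : {f : F[X] | f.degree < m}.Finite := by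
  refine Set.Finite.of_finite_image (f := fun f : F[X] => fun i : Fin m => f.coeff i)
    (Set.toFinite _) ?_
  rintro f hf g hg h
  ext n
  by_cases hn : n < m
  · exact congrFun h ⟨n, hn⟩
  · rw [coeff_eq_zero_of_degree_lt (hf.trans_le (by exact_mod_cast not_lt.mp hn)),
      coeff_eq_zero_of_degree_lt (hg.trans_le (by exact_mod_cast not_lt.mp hn))]

/-- The polynomials of degree less than `m`. -/
def lowDeg (m : ℕ) : Finset F[X] := (finite_lowDeg F m).toFinset

variable {F}

theorem mem_monics {N : ℕ} {f : F[X]} : f ∈ monics F N ↔ f.Monic ∧ f.natDegree ≤ N := by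
  simp [monics]

theorem mem_mon {m : ℕ} {f : F[X]} : f ∈ mon F m ↔ f.Monic ∧ f.natDegree = m := by
  simp only [mon, mem_filter, mem_monics]
  constructor
  · rintro ⟨⟨h, -⟩, h'⟩; exact ⟨h, h'⟩
  · rintro ⟨h, h'⟩; exact ⟨⟨h, h'.le⟩, h'⟩

theorem mem_lowDeg {m : ℕ} {f : F[X]} : f ∈ lowDeg F m ↔ f.degree < m := by
  simp [lowDeg]

variable (F)

theorem sum_monics {M : Type*} [AddCommMonoid M] (N : ℕ) (φ : F[X] → M) :
    ∑ f ∈ monics F N, φ f = ∑ m ∈ range (N + 1), ∑ f ∈ mon F m, φ f := by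
  have h : monics F N = (range (N + 1)).biUnion (mon F) := by
    ext f
    simp only [mem_monics, mem_biUnion, mem_range, mem_mon]
    constructor
    · rintro ⟨h, h'⟩; exact ⟨f.natDegree, by omega, h, rfl⟩
    · rintro ⟨a, h, h', h''⟩; exact ⟨h', by omega⟩
  rw [h, sum_biUnion]
  intro a _ b _ hab
  rw [Function.onFun, Finset.disjoint_left]
  intro f hf hf'
  exact hab ((mem_mon.mp hf).2.symm.trans (mem_mon.mp hf').2)

theorem card_lowDeg (m : ℕ) : #(lowDeg F m) = Nat.card F ^ m := by
  have h : Nat.card (degreeLT F m) = Nat.card F ^ m := by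
    rw [Nat.card_congr (degreeLTEquiv F m).toEquiv, Nat.card_fun, Nat.card_fin]
  rw [← h, lowDeg, ← Set.ncard_eq_toFinset_card _ (finite_lowDeg F m), ← Nat.card_coe_set_eq]
  refine Nat.card_congr (Equiv.setCongr ?_)
  ext f
  simp [mem_degreeLT]

theorem mon_eq_image (m : ℕ) : mon F m = (lowDeg F m).image (X ^ m + ·) := by
  ext f
  simp only [mem_mon, mem_image, mem_lowDeg]
  constructor
  · rintro ⟨h, h'⟩
    refine ⟨f - X ^ m, ?_, by ring⟩
    have hd : f.degree = (m : WithBot ℕ) := by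
      rw [degree_eq_natDegree h.ne_zero, h']
    rw [← hd]
    refine degree_sub_lt_left (by rw [hd, degree_X_pow]) h.ne_zero ?_
    rw [h.leadingCoeff, (monic_X_pow m).leadingCoeff]
  · rintro ⟨g, hg, rfl⟩
    have hm : (X ^ m + g).Monic := (monic_X_pow m).add_of_left (by rwa [degree_X_pow])
    refine ⟨hm, ?_⟩
    rw [natDegree_add_eq_left_of_degree_lt (by rwa [degree_X_pow]), natDegree_X_pow]

theorem card_mon (m : ℕ) : #(mon F m) = Nat.card F ^ m := by
  rw [mon_eq_image, card_image_of_injective _ (add_right_injective _), card_lowDeg]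

variable {F}

/-- The monic multiples of degree `m` of a monic polynomial `D` are the `D * g` with `g` monic of
degree `m - deg D`. -/
theorem filter_dvd_mon {D : F[X]} (hD : D.Monic) {m : ℕ} (hm : D.natDegree ≤ m) :
    {f ∈ mon F m | D ∣ f} = (mon F (m - D.natDegree)).image (D * ·) := by
  ext f
  simp only [mem_filter, mem_mon, mem_image]
  constructor
  · rintro ⟨⟨h, h'⟩, g, rfl⟩
    have hg : g.Monic := hD.of_mul_monic_left h
    rw [hD.natDegree_mul hg] at h'
    exact ⟨g, ⟨hg, by omega⟩, rfl⟩
  · rintro ⟨g, ⟨hg, hg'⟩, rfl⟩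
    exact ⟨⟨hD.mul hg, by rw [hD.natDegree_mul hg]; omega⟩, dvd_mul_right _ _⟩

theorem filter_dvd_lowDeg {D : F[X]} (hD : D.Monic) {m : ℕ} (hm : D.natDegree ≤ m) :
    {f ∈ lowDeg F m | D ∣ f} =
      (lowDeg F (m - D.natDegree)).image (D * ·) := by
  have key : ∀ g : F[X], (D * g).degree < m ↔ g.degree < (m - D.natDegree : ℕ) := by
    intro g
    by_cases h0 : g = 0
    · simp [h0]
    have h1 : D * g ≠ 0 := mul_ne_zero hD.ne_zero h0
    rw [degree_eq_natDegree h1, degree_eq_natDegree h0, natDegree_mul hD.ne_zero h0,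
      Nat.cast_lt, Nat.cast_lt]
    omega
  ext f
  simp only [mem_filter, mem_lowDeg, mem_image]
  constructor
  · rintro ⟨h, g, rfl⟩
    exact ⟨g, (key g).mp h, rfl⟩
  · rintro ⟨g, hg, rfl⟩
    exact ⟨(key g).mpr hg, dvd_mul_right _ _⟩

theorem card_filter_dvd_mon {D : F[X]} (hD : D.Monic) {m : ℕ} (hm : D.natDegree ≤ m) :
    #{f ∈ mon F m | D ∣ f} = Nat.card F ^ (m - D.natDegree) := by
  rw [filter_dvd_mon hD hm, card_image_of_injective _ (mul_right_injective₀ hD.ne_zero), card_mon]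

theorem filter_dvd_mon_eq_empty {D : F[X]} {m : ℕ} (hm : m < D.natDegree) :
    {f ∈ mon F m | D ∣ f} = ∅ := by
  refine filter_eq_empty_iff.mpr fun f hf h => ?_
  rw [mem_mon] at hf
  have := natDegree_le_of_dvd h hf.1.ne_zero
  omega

theorem card_filter_dvd_lowDeg {D : F[X]} (hD : D.Monic) {m : ℕ} (hm : D.natDegree ≤ m) :
    #{f ∈ lowDeg F m | D ∣ f} = Nat.card F ^ (m - D.natDegree) := by
  rw [filter_dvd_lowDeg hD hm, card_image_of_injective _ (mul_right_injective₀ hD.ne_zero),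
    card_lowDeg]

/-- Only `0` is a multiple of `D` of degree less than `m ≤ deg D`. -/
theorem filter_dvd_lowDeg_eq_zero {D : F[X]} {m : ℕ} (hm : m ≤ D.natDegree) :
    {f ∈ lowDeg F m | D ∣ f} = {0} := by
  ext f
  simp only [mem_filter, mem_lowDeg, mem_singleton]
  constructor
  · rintro ⟨h, h'⟩
    by_contra h0
    have := natDegree_le_of_dvd h' h0
    rw [degree_eq_natDegree h0, Nat.cast_lt] at h
    omega
  · rintro rfl
    simp

theorem one_lt_card : 1 < Nat.card F := Finite.one_lt_card

theorem sum_geom_le_two_mul (Q s n : ℕ) (hQ : 2 ≤ Q) (hs : 1 ≤ s) :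
    ∑ l ∈ range (n + 1), Q ^ (s * l) ≤ 2 * Q ^ (s * n) := by
  induction n with
  | zero => simp
  | succ n ih =>
    rw [sum_range_succ]
    have : 2 * Q ^ (s * n) ≤ Q ^ (s * (n + 1)) := by
      rw [mul_add, mul_one, pow_add, mul_comm]
      exact Nat.mul_le_mul_left _ (hQ.trans (Nat.le_self_pow (by omega) Q))
    omega

/-- The monic common divisors, weighted by `q ^ (r deg)`: this majorises the sum of
`q ^ (r deg gcd(d, d'))` over pairs of degrees `i` and `j`. -/
theorem sum_common_divisors_le (r : ℕ) (hr : 2 ≤ r) (i j : ℕ) :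
    ∑ d ∈ mon F i, ∑ d' ∈ mon F j, ∑ e ∈ monics F (min i j) with e ∣ d ∧ e ∣ d',
      Nat.card F ^ (r * e.natDegree) ≤ 2 * Nat.card F ^ (i + j + (r - 1) * min i j) := by
  have h1 : ∀ d ∈ mon F i, ∀ d' ∈ mon F j, ∑ e ∈ monics F (min i j) with e ∣ d ∧ e ∣ d',
      Nat.card F ^ (r * e.natDegree) = ∑ e ∈ monics F (min i j),
        (if e ∣ d then 1 else 0) * (if e ∣ d' then 1 else 0) * Nat.card F ^ (r * e.natDegree) := by
    intro d _ d' _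
    rw [sum_filter]
    refine sum_congr rfl fun e _ => ?_
    by_cases h : e ∣ d <;> by_cases h' : e ∣ d' <;> simp [h, h']
  rw [sum_congr rfl fun d hd => sum_congr rfl fun d' hd' => h1 d hd d' hd']
  calc _ = ∑ e ∈ monics F (min i j), (∑ d ∈ mon F i, if e ∣ d then 1 else 0) *
        (∑ d' ∈ mon F j, if e ∣ d' then 1 else 0) * Nat.card F ^ (r * e.natDegree) := by
        rw [sum_congr rfl fun d _ => sum_comm, sum_comm]
        refine sum_congr rfl fun e _ => ?_
        rw [sum_mul_sum, sum_mul]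
        refine sum_congr rfl fun d _ => ?_
        rw [sum_mul]
    _ = ∑ l ∈ range (min i j + 1), Nat.card F ^ (i + j) * Nat.card F ^ ((r - 1) * l) := by
        rw [sum_monics]
        refine sum_congr rfl fun l hl => ?_
        rw [mem_range] at hl
        have : ∀ e ∈ mon F l, (∑ d ∈ mon F i, if e ∣ d then 1 else 0) *
            (∑ d' ∈ mon F j, if e ∣ d' then 1 else 0) * Nat.card F ^ (r * e.natDegree)
            = Nat.card F ^ (i - l) * Nat.card F ^ (j - l) * Nat.card F ^ (r * l) := by
          intro e he
          rw [mem_mon] at he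
          rw [← card_filter, ← card_filter, card_filter_dvd_mon he.1 (by omega),
            card_filter_dvd_mon he.1 (by omega), he.2]
        rw [sum_congr rfl this, sum_const, card_mon, smul_eq_mul, ← pow_add, ← pow_add, ← pow_add,
          ← pow_add]
        congr 1
        obtain ⟨s, rfl⟩ : ∃ s, r = s + 1 := ⟨r - 1, by omega⟩
        rw [Nat.add_sub_cancel, add_mul]
        omega
    _ ≤ _ := by
        rw [← mul_sum, pow_add _ (i + j)]
        have := sum_geom_le_two_mul (Nat.card F) (r - 1) (min i j) one_lt_card (by omega)
        calc _ ≤ Nat.card F ^ (i + j) * (2 * Nat.card F ^ ((r - 1) * min i j)) :=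
              Nat.mul_le_mul_left _ this
          _ = _ := by ring

end Counting

/-! ### The Möbius function and the indicator of the `r`-free polynomials -/

section Moebius
open Polynomial Finset UniqueFactorizationMonoid
open scoped Classical

variable {F : Type*} [Field F]

/-- The Möbius function of `F[X]`. -/
def moeb (d : F[X]) : ℤ := if Squarefree d then (-1) ^ (normalizedFactors d).card else 0

theorem abs_moeb_of_squarefree {d : F[X]} (hd : Squarefree d) : |moeb d| = 1 := by
  simp [moeb, hd, abs_pow]

theorem abs_moeb_le_one (d : F[X]) : |moeb d| ≤ 1 := by
  by_cases hd : Squarefree d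
  · exact (abs_moeb_of_squarefree hd).le
  · simp [moeb, hd]

theorem moeb_one : moeb (1 : F[X]) = 1 := by simp [moeb]

theorem squarefree_irreducible_mul {P e : F[X]} (hP : Irreducible P) (he : Squarefree e)
    (hPe : ¬ P ∣ e) : Squarefree (P * e) :=
  (squarefree_mul_iff).mpr ⟨(hP.coprime_iff_not_dvd.mpr hPe).isRelPrime, hP.squarefree, he⟩

theorem moeb_irreducible_mul {P e : F[X]} (hP : Irreducible P) (he : Squarefree e)
    (hPe : ¬ P ∣ e) : moeb (P * e) = - moeb e := by
  have h := squarefree_irreducible_mul hP he hPe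
  rw [moeb, moeb, if_pos h, if_pos he, normalizedFactors_mul hP.ne_zero he.ne_zero,
    normalizedFactors_irreducible hP]
  simp [pow_add]

/-- For every `f` there is a largest `h` with `h ^ r ∣ f`, in the sense of divisibility. -/
theorem exists_largest_rth_power (r : ℕ) (hr : 1 ≤ r) {f : F[X]} (hf : f.Monic) :
    ∃ h : F[X], h.Monic ∧ ∀ d : F[X], d.Monic → (d ^ r ∣ f ↔ d ∣ h) := by
  have hfin : ∃ n, ∃ h : F[X], h.Monic ∧ h ^ r ∣ f ∧ h.natDegree = n :=
    ⟨0, 1, monic_one, by simp, by simp⟩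
  have hb : ∀ n, (∃ h : F[X], h.Monic ∧ h ^ r ∣ f ∧ h.natDegree = n) → n ≤ f.natDegree := by
    rintro n ⟨h, hm, hd, rfl⟩
    have := natDegree_le_of_dvd hd hf.ne_zero
    rw [natDegree_pow] at this
    exact (Nat.le_mul_of_pos_left _ hr).trans this
  obtain ⟨h, hm, hd, hn⟩ := Nat.findGreatest_spec (P := fun n => ∃ h : F[X], h.Monic ∧ h ^ r ∣ f ∧
    h.natDegree = n) (hb _ hfin.choose_spec) hfin.choose_spec
  refine ⟨h, hm, fun d hdm => ⟨fun hdf => ?_, fun hdh => (pow_dvd_pow_of_dvd hdh r).trans hd⟩⟩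
  obtain ⟨G, u, v, hG, hu, hv, huv, rfl, rfl⟩ := exists_coprime_cofactors hdm hm
  have h1 : (G * u * v) ^ r ∣ f := by
    rw [mul_pow] at hdf hd ⊢
    obtain ⟨k, rfl⟩ : G ^ r ∣ f := (dvd_mul_right _ _).trans hd
    have hG0 : G ^ r ≠ 0 := (hG.pow r).ne_zero
    rw [mul_pow, mul_assoc]
    rw [mul_dvd_mul_iff_left hG0] at hdf hd ⊢
    exact (huv.pow).mul_dvd hdf hd
  have h2 : (G * u * v).natDegree ≤ (G * v).natDegree := by
    by_contra hlt
    exact Nat.findGreatest_is_greatest (hn ▸ not_le.mp hlt)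
      (hb _ ⟨_, (hG.mul hu).mul hv, h1, rfl⟩) ⟨_, (hG.mul hu).mul hv, h1, rfl⟩
  rw [(hG.mul hu).natDegree_mul hv, hG.natDegree_mul hu, hG.natDegree_mul hv] at h2
  have hu1 : u = 1 := hu.natDegree_eq_zero.mp (by omega)
  rw [hu1, mul_one]
  exact dvd_mul_right _ _

theorem isRFree_two_iff {f : F[X]} (hf : f ≠ 0) : IsRFree 2 f ↔ Squarefree f := by
  rw [squarefree_iff_irreducible_sq_not_dvd_of_ne_zero hf]
  simp [IsRFree, sq]

theorem isRFree_iff_eq_one {r : ℕ} {f h : F[X]} (hh : h.Monic)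
    (H : ∀ d : F[X], d.Monic → (d ^ r ∣ f ↔ d ∣ h)) : IsRFree r f ↔ h = 1 := by
  constructor
  · intro hf
    by_contra h1
    obtain ⟨P, hPm, hP, hPh⟩ := exists_monic_irreducible_factor h
      (fun hu => h1 (hh.eq_one_of_isUnit hu))
    exact hf P hP ((H P hPm).mpr hPh)
  · rintro rfl P hP hPf
    have hP0 := hP.ne_zero
    have hm := monic_mul_leadingCoeff_inv hP0
    have hd : (P * C P.leadingCoeff⁻¹) ^ r ∣ f := by
      have hu : IsUnit (C P.leadingCoeff⁻¹) :=
        isUnit_C.mpr (inv_ne_zero (leadingCoeff_ne_zero.mpr hP0)).isUnit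
      rw [mul_pow, (hu.pow r).mul_right_dvd]
      exact hPf
    have h1 := ((H _ hm).mp hd)
    exact hP.not_isUnit (isUnit_of_dvd_one ((dvd_mul_right _ _).trans h1))

variable [Finite F]

/-- The defining property of the Möbius function. -/
theorem sum_moeb_dvd {h : F[X]} (hh : h.Monic) {M : ℕ} (hM : h.natDegree ≤ M) :
    ∑ e ∈ monics F M with e ∣ h, moeb e = if h = 1 then 1 else 0 := by
  split_ifs with h1
  · subst h1
    have : {e ∈ monics F M | e ∣ 1} = {1} := by
      ext e
      simp only [mem_filter, mem_monics, mem_singleton]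
      constructor
      · rintro ⟨⟨he, -⟩, h⟩; exact he.eq_one_of_isUnit (isUnit_of_dvd_one h)
      · rintro rfl; exact ⟨⟨monic_one, by simp⟩, dvd_rfl⟩
    rw [this, sum_singleton, moeb_one]
  · obtain ⟨P, hPm, hP, hPh⟩ := exists_monic_irreducible_factor h
      (fun hu => h1 (hh.eq_one_of_isUnit hu))
    have hsub : ∑ e ∈ monics F M with e ∣ h, moeb e =
        ∑ e ∈ monics F M with e ∣ h ∧ Squarefree e, moeb e := by
      rw [sum_filter, sum_filter]
      refine sum_congr rfl fun e _ => ?_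
      by_cases he : Squarefree e
      · simp [he]
      · simp [he, moeb]
    rw [hsub]
    have key : ∀ e, Squarefree e → P ∣ e → P * (e / P) = e ∧ Squarefree (e / P) ∧ ¬ P ∣ e / P := by
      rintro e he ⟨k, rfl⟩
      rw [mul_div_cancel_left₀ _ hP.ne_zero]
      refine ⟨rfl, he.of_mul_right, ?_⟩
      rintro ⟨l, rfl⟩
      exact hP.not_isUnit (he P ⟨l, by ring⟩)
    refine sum_involution (fun e _ => if P ∣ e then e / P else P * e) ?_ ?_ ?_ ?_
    · intro e he
      have hs := (mem_filter.mp he).2.2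
      split_ifs with hPe
      · obtain ⟨h2, h3, h4⟩ := key e hs hPe
        have := moeb_irreducible_mul hP h3 h4
        rw [h2] at this
        omega
      · rw [moeb_irreducible_mul hP hs hPe]; omega
    · intro e he _
      have hs := (mem_filter.mp he).2.2
      split_ifs with hPe
      · obtain ⟨h2, h3, h4⟩ := key e hs hPe
        intro h5; rw [h5] at h4; exact h4 hPe
      · intro h5; exact hPe (h5 ▸ dvd_mul_right _ _)
    · intro e he
      simp only [mem_filter, mem_monics] at he ⊢
      obtain ⟨⟨hem, -⟩, heh, hs⟩ := he
      have : ∀ e' : F[X], e'.Monic → e' ∣ h → Squarefree e' →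
          (e'.Monic ∧ e'.natDegree ≤ M) ∧ e' ∣ h ∧ Squarefree e' := fun e' h1 h2 h3 =>
        ⟨⟨h1, (natDegree_le_of_dvd h2 hh.ne_zero).trans hM⟩, h2, h3⟩
      split_ifs with hPe
      · obtain ⟨h2, h3, h4⟩ := key e hs hPe
        exact this _ (hPm.of_mul_monic_left (h2.symm ▸ hem)) ((Dvd.intro_left _ h2).trans heh) h3
      · exact this _ (hPm.mul hem) ((hP.coprime_iff_not_dvd.mpr hPe).mul_dvd hPh heh)
          (squarefree_irreducible_mul hP hs hPe)
    · intro e he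
      have hs := (mem_filter.mp he).2.2
      by_cases hPe : P ∣ e
      · obtain ⟨h2, h3, h4⟩ := key e hs hPe
        simp [hPe, h4, h2]
      · simp [hPe, mul_div_cancel_left₀ _ hP.ne_zero]

/-- The indicator of the `r`-free polynomials as a divisor sum of the Möbius function. -/
theorem indicator_isRFree_eq_sum {r m M : ℕ} (hr : 1 ≤ r) (hM : m / r ≤ M) {f : F[X]}
    (hf : f ∈ mon F m) :
    (if IsRFree r f then 1 else 0) = ∑ d ∈ monics F M with d ^ r ∣ f, moeb d := by
  rw [mem_mon] at hf
  obtain ⟨h, hh, H⟩ := exists_largest_rth_power r hr hf.1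
  have hd := natDegree_le_of_dvd ((H h hh).mpr dvd_rfl) hf.1.ne_zero
  rw [natDegree_pow, hf.2, mul_comm] at hd
  rw [sum_congr (filter_congr fun d hd => H d (mem_monics.mp hd).1) fun _ _ => rfl,
    sum_moeb_dvd hh (((Nat.le_div_iff_mul_le hr).mpr hd).trans hM)]
  simp [isRFree_iff_eq_one hh H]

variable (F)

theorem mon_zero : mon F 0 = {1} := by
  ext f
  rw [mem_mon, mem_singleton]
  exact ⟨fun h => h.1.natDegree_eq_zero.mp h.2, by rintro rfl; simp⟩

/-- Summing the divisor sum of the Möbius function over all monic polynomials of degree `n`. -/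
theorem sum_range_sum_moeb (n : ℕ) :
    ∑ l ∈ range (n + 1), (∑ d ∈ mon F l, moeb d) * (Nat.card F : ℤ) ^ (n - l) =
      if n = 0 then 1 else 0 := by
  have h1 : ∑ h ∈ mon F n, ∑ e ∈ monics F n with e ∣ h, moeb e = if n = 0 then 1 else 0 := by
    have h2 : ∀ h ∈ mon F n, ∑ e ∈ monics F n with e ∣ h, moeb e = if n = 0 then 1 else 0 := by
      intro h hh
      rw [mem_mon] at hh
      rw [sum_moeb_dvd hh.1 hh.2.le, ← hh.2]
      simp [hh.1.natDegree_eq_zero]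
    rw [sum_congr rfl h2, sum_const, card_mon]
    by_cases hn : n = 0 <;> simp [hn]
  rw [← h1]
  simp_rw [sum_filter]
  rw [sum_comm, sum_monics]
  refine sum_congr rfl fun l hl => ?_
  rw [sum_mul]
  refine sum_congr rfl fun d hd => ?_
  rw [mem_mon] at hd
  rw [mem_range] at hl
  rw [← sum_filter, sum_const, card_filter_dvd_mon hd.1 (by omega), hd.2, nsmul_eq_mul, mul_comm]
  push_cast
  rfl

theorem sum_moeb_mon (n : ℕ) :
    ∑ d ∈ mon F n, moeb d = if n = 0 then 1 else if n = 1 then -(Nat.card F : ℤ) else 0 := by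
  cases n with
  | zero => simp [mon_zero, moeb_one]
  | succ n =>
    have h := sum_range_sum_moeb F (n + 1)
    have h' := sum_range_sum_moeb F n
    rw [sum_range_succ] at h
    have h3 : ∑ l ∈ range (n + 1), (∑ d ∈ mon F l, moeb d) * (Nat.card F : ℤ) ^ (n + 1 - l) =
        Nat.card F * ∑ l ∈ range (n + 1), (∑ d ∈ mon F l, moeb d) * (Nat.card F : ℤ) ^ (n - l) := by
      rw [mul_sum]
      refine sum_congr rfl fun l hl => ?_
      rw [mem_range] at hl
      rw [Nat.sub_add_comm (by omega), pow_succ]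
      ring
    rw [h3, h'] at h
    simp only [Nat.sub_self, pow_zero, mul_one, Nat.add_eq_zero_iff, one_ne_zero, and_false,
      if_false] at h
    simp only [Nat.add_eq_zero_iff, one_ne_zero, and_false, if_false, Nat.add_eq_right]
    by_cases hn : n = 0
    · rw [if_pos hn] at h ⊢; linarith
    · rw [if_neg hn] at h ⊢; linarith

/-- At least half of the monic polynomials of degree `m` are `r`-free. -/
theorem card_pow_le_two_mul_card_isRFree (r m : ℕ) (hr : 2 ≤ r) :
    Nat.card F ^ m ≤ 2 * #{f ∈ mon F m | IsRFree r f} := by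
  have hq : 2 ≤ Nat.card F := one_lt_card
  have h1 : (#{f ∈ mon F m | IsRFree r f} : ℤ) =
      ∑ j ∈ range (m / r + 1), (∑ d ∈ mon F j, moeb d) * (Nat.card F : ℤ) ^ (m - r * j) := by
    rw [card_filter]
    push_cast
    rw [sum_congr rfl fun f hf => indicator_isRFree_eq_sum (by omega) le_rfl hf]
    simp_rw [sum_filter]
    rw [sum_comm, sum_monics]
    refine sum_congr rfl fun j hj => ?_
    rw [sum_mul]
    refine sum_congr rfl fun d hd => ?_
    rw [mem_mon] at hd
    rw [mem_range] at hj
    have hj' : r * j ≤ m := by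
      rw [mul_comm]; exact (Nat.le_div_iff_mul_le (by omega)).mp (by omega)
    have hdeg : (d ^ r).natDegree = r * j := by rw [natDegree_pow, hd.2]
    rw [← sum_filter, sum_const, card_filter_dvd_mon (hd.1.pow r) (by omega), hdeg, nsmul_eq_mul,
      mul_comm]
    push_cast
    rfl
  simp_rw [sum_moeb_mon] at h1
  by_cases hm : m < r
  · rw [Nat.div_eq_of_lt hm] at h1
    simp only [zero_add, range_one, sum_singleton, if_true, mul_zero, Nat.sub_zero, one_mul] at h1
    have : #{f ∈ mon F m | IsRFree r f} = Nat.card F ^ m := by exact_mod_cast h1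
    omega
  · push Not at hm
    have h2 : 1 ≤ m / r := (Nat.one_le_div_iff (by omega)).mpr hm
    have h3 : (#{f ∈ mon F m | IsRFree r f} : ℤ) = (Nat.card F : ℤ) ^ m -
        Nat.card F * (Nat.card F : ℤ) ^ (m - r) := by
      rw [h1]
      obtain ⟨t, ht⟩ : ∃ t, m / r + 1 = t + 2 := ⟨m / r - 1, by omega⟩
      rw [ht, sum_range_succ', sum_range_succ']
      simp
      ring
    have h4 : Nat.card F * Nat.card F ^ (m - r) * 2 ≤ Nat.card F ^ m := by
      calc Nat.card F * Nat.card F ^ (m - r) * 2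
          ≤ Nat.card F * Nat.card F ^ (m - r) * Nat.card F := Nat.mul_le_mul_left _ hq
        _ = Nat.card F ^ (m - r + 2) := by ring
        _ ≤ Nat.card F ^ m := Nat.pow_le_pow_right (by omega) (by omega)
    zify at h4 ⊢
    linarith

theorem card_pow_le_two_mul_card_squarefree (j : ℕ) :
    Nat.card F ^ j ≤ 2 * #{d ∈ mon F j | Squarefree d} := by
  have h := card_pow_le_two_mul_card_isRFree F 2 j le_rfl
  rwa [filter_congr fun d hd => isRFree_two_iff (mem_mon.mp hd).1.ne_zero] at h

end Moebius

/-! ### Additive characters and the annihilators of multiples -/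

section Characters
open Polynomial Finset
open scoped Classical BigOperators

theorem cast_pow_sub (Q : ℕ) {a b : ℕ} (h : a ≤ b) :
    ((Q ^ (b - a) : ℕ) : ℝ) = (Q : ℝ) ^ ((b : ℝ) - a) := by
  rw [← Nat.cast_sub h, Real.rpow_natCast]
  push_cast
  rfl

/-- The proportion of a subset of a finite type. -/
def prob {ι : Type*} [Fintype ι] (A : Finset (ι)) : ℝ := 𝔼 x, if x ∈ A then 1 else 0

variable {ι : Type*} [Fintype ι]

theorem expect_mem_eq_prob (A : Finset ι) [DecidablePred (· ∈ A)] :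
    𝔼 x, (if x ∈ A then (1 : ℝ) else 0) = prob A := by
  rw [prob]
  refine expect_congr rfl fun x _ => ?_
  congr

theorem prob_mono {A B : Finset (ι)} (h : A ⊆ B) : prob A ≤ prob B := by
  refine expect_le_expect fun x _ => ?_
  by_cases hx : x ∈ A
  · simp [hx, h hx]
  · simp only [hx, if_false]; split_ifs <;> norm_num

theorem prob_sdiff [DecidableEq ι] {A B : Finset ι} (h : B ⊆ A) :
    prob (A \ B) = prob A - prob B := by
  rw [prob, prob, prob, ← expect_sub_distrib]
  refine expect_congr rfl fun x _ => ?_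
  by_cases hx : x ∈ B
  · simp [hx, h hx]
  · simp [hx]

theorem eq_of_subset_of_prob_eq {A B : Finset (ι)} (h : B ⊆ A) (hd : prob A = prob B) :
    A = B := by
  have h1 : prob (A \ B) = 0 := by rw [prob_sdiff h, hd, sub_self]
  rw [prob, expect_eq_zero_iff_of_nonneg (fun x _ => by split_ifs <;> norm_num)] at h1
  refine Subset.antisymm (fun x hx => ?_) h
  by_contra hxB
  have := h1 x (mem_univ x)
  simp [hx, hxB] at this

variable (F : Type*) [Field F] [Fintype F]

/-- `eField` as an additive character of `F`. -/
def eAddChar : AddChar F ℂ :=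
  letI : Algebra (ZMod (ringChar F)) F := ZMod.algebra F (ringChar F)
  haveI : NeZero (ringChar F) := ⟨(CharP.char_is_prime F (ringChar F)).ne_zero⟩
  ZMod.stdAddChar.compAddMonoidHom (Algebra.trace (ZMod (ringChar F)) F).toAddMonoidHom

variable {F}

theorem eAddChar_apply (c : F) : eAddChar F c = eField c := by
  have : NeZero (ringChar F) := ⟨(CharP.char_is_prime F (ringChar F)).ne_zero⟩
  let _ : Algebra (ZMod (ringChar F)) F := ZMod.algebra F (ringChar F)
  change ZMod.stdAddChar (Algebra.trace (ZMod (ringChar F)) F c) = _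
  rw [ZMod.stdAddChar_apply, ZMod.toCircle_apply]
  rfl

theorem exists_eAddChar_ne_one : ∃ c : F, eAddChar F c ≠ 1 := by
  have : Fact (ringChar F).Prime := ⟨CharP.char_is_prime F _⟩
  let _ : Algebra (ZMod (ringChar F)) F := ZMod.algebra F (ringChar F)
  obtain ⟨a, ha⟩ := FiniteField.trace_to_zmod_nondegenerate F one_ne_zero
  rw [one_mul] at ha
  refine ⟨a, fun h => ha ?_⟩
  have h' : ZMod.stdAddChar (Algebra.trace (ZMod (ringChar F)) F a) = 1 := h
  rw [← AddChar.map_zero_eq_one (ZMod.stdAddChar (N := ringChar F))] at h'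
  exact ZMod.injective_stdAddChar h'

/-- The character `f ↦ e(f α)` of `F[X]`, where `x` lists the coefficients of
`t ^ (-1), ..., t ^ (-n)` in `α`; only the coefficients of `f` in degrees below `n` matter. -/
def chi {n : ℕ} (x : Fin n → F) : AddChar F[X] ℂ :=
  (eAddChar F).compAddMonoidHom
    (∑ i : Fin n, (AddMonoidHom.mulRight (x i)).comp (lcoeff F (i : ℕ)).toAddMonoidHom)

variable {n : ℕ}

theorem chi_apply (x : Fin n → F) (f : F[X]) :
    chi x f = eAddChar F (∑ i : Fin n, f.coeff i * x i) := by
  simp [chi]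

theorem norm_chi (x : Fin n → F) (f : F[X]) : ‖chi x f‖ = 1 := by
  rw [chi_apply, AddChar.norm_apply]

/-- Orthogonality of the characters `chi x`. -/
theorem expect_chi {h : F[X]} (hn : h.degree < n) :
    𝔼 x : Fin n → F, chi x h = if h = 0 then 1 else 0 := by
  split_ifs with h0
  · simp [h0]
  · obtain ⟨c, hc⟩ := exists_eAddChar_ne_one (F := F)
    have hlt : h.natDegree < n := by rwa [degree_eq_natDegree h0, Nat.cast_lt] at hn
    let ψ : AddChar (Fin n → F) ℂ := (eAddChar F).compAddMonoidHom
      (∑ i : Fin n, (AddMonoidHom.mulLeft (h.coeff i)).comp (Pi.evalAddMonoidHom _ i))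
    have hψ : ∀ x, ψ x = chi x h := fun x => by simp [ψ, chi_apply]
    have h1 : ψ ≠ 1 := by
      refine AddChar.ne_one_iff.mpr ⟨Pi.single ⟨h.natDegree, hlt⟩ (h.leadingCoeff⁻¹ * c), ?_⟩
      rw [hψ, chi_apply, Finset.sum_eq_single ⟨h.natDegree, hlt⟩]
      · rw [Pi.single_eq_same, coeff_natDegree,
          mul_inv_cancel_left₀ (leadingCoeff_ne_zero.mpr h0)]
        exact hc
      · intro b _ hb
        rw [Pi.single_eq_of_ne hb, mul_zero]
      · simp
    rw [Fintype.expect_eq_sum_div_card, ← sum_congr rfl fun x _ => hψ x,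
      AddChar.sum_eq_zero_of_ne_one h1, zero_div]

/-- The `x` whose character is trivial on the multiples of `D` of degree less than `m`: they
correspond to the `α` at distance less than `q ^ (-m)` from a fraction with denominator `D`. -/
def ann (n m : ℕ) (D : F[X]) : Finset (Fin n → F) :=
  {x | ∀ h : F[X], D ∣ h → h.degree < m → chi x h = 1}

theorem mem_ann {m : ℕ} {D : F[X]} {x : Fin n → F} :
    x ∈ ann n m D ↔ ∀ h : F[X], D ∣ h → h.degree < m → chi x h = 1 := by
  simp [ann]

theorem ann_subset_of_dvd {m : ℕ} {D D' : F[X]} (h : D ∣ D') : ann n m D ⊆ ann n m D' := by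
  intro x hx
  rw [mem_ann] at hx ⊢
  exact fun f hf => hx f (h.trans hf)

theorem sum_chi_lowDeg (m : ℕ) (D : F[X]) (x : Fin n → F) :
    ∑ h ∈ lowDeg F m with D ∣ h, chi x h =
      if x ∈ ann n m D then (#{h ∈ lowDeg F m | D ∣ h} : ℂ) else 0 := by
  split_ifs with hx
  · rw [mem_ann] at hx
    rw [sum_congr rfl fun h hh => hx h (mem_filter.mp hh).2 (mem_lowDeg.mp (mem_filter.mp hh).1)]
    simp
  · rw [mem_ann] at hx
    push Not at hx
    obtain ⟨g, hg, hgm, hg1⟩ := hx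
    have h1 : ∑ h ∈ lowDeg F m with D ∣ h, chi x (g + h) =
        ∑ h ∈ lowDeg F m with D ∣ h, chi x h := by
      refine sum_nbij' (g + ·) (-g + ·) ?_ ?_ ?_ ?_ ?_
      · intro h hh
        simp only [mem_filter, mem_lowDeg] at hh ⊢
        exact ⟨(degree_add_le _ _).trans_lt (max_lt hgm hh.1), dvd_add hg hh.2⟩
      · intro h hh
        simp only [mem_filter, mem_lowDeg] at hh ⊢
        exact ⟨(degree_add_le _ _).trans_lt (max_lt (by rwa [degree_neg]) hh.1),
          dvd_add ((dvd_neg).mpr hg) hh.2⟩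
      · intro h _; simp
      · intro h _; simp
      · intro h _; rfl
    simp_rw [AddChar.map_add_eq_mul] at h1
    rw [← mul_sum] at h1
    by_contra h0
    exact hg1 (mul_right_cancel₀ h0 (h1.trans (one_mul _).symm))

/-- The kernel of the multiples of `D`: a phase times the indicator of `ann n m D`. -/
theorem sum_chi_mon {m : ℕ} {D : F[X]} (hD : D.Monic) (hm : D.natDegree ≤ m) (x : Fin n → F) :
    ∑ f ∈ mon F m with D ∣ f, chi x f = if x ∈ ann n m D then
      (Nat.card F : ℂ) ^ (m - D.natDegree) * chi x (D * X ^ (m - D.natDegree)) else 0 := by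
  have h1 : ∑ f ∈ mon F m with D ∣ f, chi x f =
      chi x (D * X ^ (m - D.natDegree)) * ∑ h ∈ lowDeg F m with D ∣ h, chi x h := by
    rw [filter_dvd_mon hD hm, filter_dvd_lowDeg hD hm, mon_eq_image,
      sum_image (mul_right_injective₀ hD.ne_zero).injOn,
      sum_image (add_right_injective _).injOn,
      sum_image (mul_right_injective₀ hD.ne_zero).injOn, mul_sum]
    refine sum_congr rfl fun g _ => ?_
    rw [mul_add, AddChar.map_add_eq_mul]
  rw [h1, sum_chi_lowDeg, card_filter_dvd_lowDeg hD hm]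
  split_ifs
  · push_cast; ring
  · simp

/-- The proportion of `ann n m D ∩ ann n m D'` is determined by the number of common multiples. -/
theorem prob_ann_inter_mul {m : ℕ} (hmn : m ≤ n) (D D' : F[X]) :
    prob (ann n m D ∩ ann n m D') * #{h ∈ lowDeg F m | D ∣ h} * #{h ∈ lowDeg F m | D' ∣ h} =
      #{h ∈ lowDeg F m | D ∣ h ∧ D' ∣ h} := by
  have h1 : 𝔼 x : Fin n → F, (∑ h ∈ lowDeg F m with D ∣ h, chi x h) *
      (∑ h ∈ lowDeg F m with D' ∣ h, chi x h) = (#{h ∈ lowDeg F m | D ∣ h ∧ D' ∣ h} : ℂ) := by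
    simp_rw [sum_mul_sum, ← AddChar.map_add_eq_mul]
    rw [expect_sum_comm]
    have h2 : ∀ h ∈ {h ∈ lowDeg F m | D ∣ h}, 𝔼 x : Fin n → F,
        ∑ h' ∈ lowDeg F m with D' ∣ h', chi x (h + h') = if D' ∣ h then 1 else 0 := by
      intro h hh
      rw [mem_filter, mem_lowDeg] at hh
      rw [expect_sum_comm]
      have h3 : ∀ h' ∈ {h ∈ lowDeg F m | D' ∣ h}, 𝔼 x : Fin n → F, chi x (h + h') =
          if h' = -h then 1 else 0 := by
        intro h' hh'
        rw [mem_filter, mem_lowDeg] at hh'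
        rw [expect_chi (((degree_add_le _ _).trans_lt (max_lt hh.1 hh'.1)).trans_le
          (by exact_mod_cast hmn))]
        simp only [add_comm h h', add_eq_zero_iff_eq_neg]
      rw [sum_congr rfl h3, sum_ite_eq']
      simp [mem_lowDeg, hh.1]
    rw [sum_congr rfl h2, ← sum_filter, filter_filter]
    simp
  simp_rw [sum_chi_lowDeg] at h1
  have h4 : ∀ x : Fin n → F, ((if x ∈ ann n m D then (#{h ∈ lowDeg F m | D ∣ h} : ℂ) else 0) *
      if x ∈ ann n m D' then (#{h ∈ lowDeg F m | D' ∣ h} : ℂ) else 0) =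
      (((if x ∈ ann n m D ∩ ann n m D' then (1 : ℝ) else 0) * (#{h ∈ lowDeg F m | D ∣ h} *
        #{h ∈ lowDeg F m | D' ∣ h}) : ℝ) : ℂ) := by
    intro x
    by_cases hx : x ∈ ann n m D <;> by_cases hx' : x ∈ ann n m D' <;> simp [hx, hx']
  simp_rw [h4] at h1
  rw [← Complex.ofReal_expect, ← expect_mul, ← Complex.ofReal_natCast] at h1
  rw [mul_assoc]
  convert Complex.ofReal_injective h1 using 2
  rw [prob]
  refine expect_congr rfl fun x _ => ?_
  congr

variable (F) in
theorem card_pos_real : (0 : ℝ) < Nat.card F := by exact_mod_cast Nat.card_pos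

theorem prob_ann {m : ℕ} (hmn : m ≤ n) {D : F[X]} (hD : D.Monic) (hm : D.natDegree ≤ m) :
    prob (ann n m D) = (Nat.card F : ℝ) ^ ((D.natDegree : ℝ) - m) := by
  have h := prob_ann_inter_mul hmn D D
  simp only [inter_self, and_self] at h
  have hq := card_pos_real F
  rw [card_filter_dvd_lowDeg hD hm, cast_pow_sub _ hm] at h
  have h0 : (Nat.card F : ℝ) ^ ((m : ℝ) - D.natDegree) ≠ 0 := (Real.rpow_pos_of_pos hq _).ne'
  have h1 := mul_right_cancel₀ h0 (h.trans (one_mul _).symm)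
  rw [show (D.natDegree : ℝ) - m = -((m : ℝ) - D.natDegree) by ring, Real.rpow_neg hq.le]
  exact eq_inv_of_mul_eq_one_left h1

theorem mul_dvd_and_mul_dvd_iff {R : Type*} [CommRing R] [IsDomain R] {G u v h : R} (hG : G ≠ 0)
    (huv : IsCoprime u v) : G * u ∣ h ∧ G * v ∣ h ↔ G * (u * v) ∣ h := by
  constructor
  · rintro ⟨⟨k, rfl⟩, h2⟩
    rw [mul_assoc] at h2 ⊢
    rw [mul_dvd_mul_iff_left hG] at h2 ⊢
    exact huv.mul_dvd (dvd_mul_right _ _) h2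
  · intro h1
    exact ⟨(mul_dvd_mul_left G (dvd_mul_right _ _)).trans h1,
      (mul_dvd_mul_left G (dvd_mul_left _ _)).trans h1⟩

section Intersection

variable {m : ℕ} (hmn : m ≤ n) {G u v : F[X]} (hG : G.Monic) (hu : u.Monic) (hv : v.Monic)
  (huv : IsCoprime u v) (hmu : (G * u).natDegree ≤ m) (hmv : (G * v).natDegree ≤ m)

include hmn hG hu hv huv hmu hmv

/-- When the least common multiple has degree at most `m`, a tuple that is in two of the sets
`ann n m D` is in the one of the greatest common divisor. -/
theorem ann_inter_eq (hm : G.natDegree + u.natDegree + v.natDegree ≤ m) :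
    ann n m (G * u) ∩ ann n m (G * v) = ann n m G := by
  have hq := card_pos_real F
  refine eq_of_subset_of_prob_eq (subset_inter (ann_subset_of_dvd (dvd_mul_right _ _))
    (ann_subset_of_dvd (dvd_mul_right _ _))) ?_
  have h := prob_ann_inter_mul hmn (G * u) (G * v)
  have hm' : (G * (u * v)).natDegree ≤ m := by
    rw [hG.natDegree_mul (hu.mul hv), hu.natDegree_mul hv]; omega
  simp_rw [mul_dvd_and_mul_dvd_iff hG.ne_zero huv] at h
  rw [card_filter_dvd_lowDeg (hG.mul hu) hmu, card_filter_dvd_lowDeg (hG.mul hv) hmv,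
    card_filter_dvd_lowDeg (hG.mul (hu.mul hv)) hm', cast_pow_sub _ hmu, cast_pow_sub _ hmv,
    cast_pow_sub _ hm', mul_assoc, ← Real.rpow_add hq] at h
  rw [prob_ann hmn hG (by omega)]
  rw [← eq_div_iff (Real.rpow_pos_of_pos hq _).ne', ← Real.rpow_sub hq] at h
  rw [h, hG.natDegree_mul (hu.mul hv), hu.natDegree_mul hv, hG.natDegree_mul hu,
    hG.natDegree_mul hv]
  congr 1
  push_cast
  ring

theorem prob_ann_inter_eq (hm : m ≤ G.natDegree + u.natDegree + v.natDegree) :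
    prob (ann n m (G * u) ∩ ann n m (G * v)) =
      (Nat.card F : ℝ) ^ (((G * u).natDegree : ℝ) + (G * v).natDegree - 2 * m) := by
  have hq := card_pos_real F
  have h := prob_ann_inter_mul hmn (G * u) (G * v)
  have hm' : m ≤ (G * (u * v)).natDegree := by
    rw [hG.natDegree_mul (hu.mul hv), hu.natDegree_mul hv]; omega
  simp_rw [mul_dvd_and_mul_dvd_iff hG.ne_zero huv] at h
  rw [card_filter_dvd_lowDeg (hG.mul hu) hmu, card_filter_dvd_lowDeg (hG.mul hv) hmv,
    filter_dvd_lowDeg_eq_zero hm', cast_pow_sub _ hmu, cast_pow_sub _ hmv,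
    card_singleton, Nat.cast_one, mul_assoc, ← Real.rpow_add hq] at h
  rw [show ((G * u).natDegree : ℝ) + (G * v).natDegree - 2 * m =
    -((m : ℝ) - (G * u).natDegree + (m - (G * v).natDegree)) by ring, Real.rpow_neg hq.le]
  exact eq_inv_of_mul_eq_one_left h

theorem prob_ann_inter_le : prob (ann n m (G * u) ∩ ann n m (G * v)) ≤
    (Nat.card F : ℝ) ^ ((G.natDegree : ℝ) - m) +
      (Nat.card F : ℝ) ^ (((G * u).natDegree : ℝ) + (G * v).natDegree - 2 * m) := by
  have hq := card_pos_real F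
  rcases le_total (G.natDegree + u.natDegree + v.natDegree) m with hm | hm
  · rw [ann_inter_eq hmn hG hu hv huv hmu hmv hm, prob_ann hmn hG (by omega)]
    linarith [Real.rpow_pos_of_pos hq (((G * u).natDegree : ℝ) + (G * v).natDegree - 2 * m)]
  · rw [prob_ann_inter_eq hmn hG hu hv huv hmu hmv hm]
    linarith [Real.rpow_pos_of_pos hq ((G.natDegree : ℝ) - m)]

/-- Tuples that lie in two of the sets `ann n m D` only by coincidence are rare. -/
theorem prob_ann_inter_sdiff_le : prob ((ann n m (G * u) ∩ ann n m (G * v)) \ ann n m G) ≤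
    (Nat.card F : ℝ) ^ (((G * u).natDegree : ℝ) + (G * v).natDegree - 2 * m) := by
  have hq := card_pos_real F
  rcases le_total (G.natDegree + u.natDegree + v.natDegree) m with hm | hm
  · rw [ann_inter_eq hmn hG hu hv huv hmu hmv hm, sdiff_self]
    refine le_trans (le_of_eq ?_) (Real.rpow_pos_of_pos hq _).le
    simp [prob]
  · rw [← prob_ann_inter_eq hmn hG hu hv huv hmu hmv hm]
    exact prob_mono sdiff_subset

end Intersection

end Characters

/-! ### Second moments -/

section SecondMoments
open Polynomial Finset
open scoped Classical BigOperators

variable {F : Type*} [Field F] [Fintype F] {n : ℕ}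

/-- The sum of `q ^ (r deg e)` over the common monic divisors `e` of `d` and `d'`. -/
def commonWeight (r i j : ℕ) (d d' : F[X]) : ℝ :=
  ((∑ e ∈ monics F (min i j) with e ∣ d ∧ e ∣ d', Nat.card F ^ (r * e.natDegree) : ℕ) : ℝ)

theorem sum_commonWeight_le {r : ℕ} (hr : 2 ≤ r) (i j : ℕ) :
    ∑ d ∈ mon F i, ∑ d' ∈ mon F j, commonWeight r i j d d' ≤
      2 * (Nat.card F : ℝ) ^ ((i : ℝ) + j + (r - 1) * (min i j : ℕ)) := by
  have h := sum_common_divisors_le (F := F) r hr i j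
  have h' : ((2 * Nat.card F ^ (i + j + (r - 1) * min i j) : ℕ) : ℝ) =
      2 * (Nat.card F : ℝ) ^ ((i : ℝ) + j + (r - 1) * (min i j : ℕ)) := by
    rw [Nat.cast_mul, Nat.cast_pow, ← Real.rpow_natCast]
    congr 2
    rw [Nat.cast_add, Nat.cast_add, Nat.cast_mul, Nat.cast_sub (by omega), Nat.cast_one]
  rw [← h']
  simp only [commonWeight]
  exact_mod_cast h

theorem rpow_natDegree_le_commonWeight (r : ℕ) {i j : ℕ} {d d' G : F[X]} (hd : d ∈ mon F i)
    (hd' : d' ∈ mon F j) (hG : G.Monic) (h : G ∣ d) (h' : G ∣ d') :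
    (Nat.card F : ℝ) ^ ((r : ℝ) * G.natDegree) ≤ commonWeight r i j d d' := by
  rw [mem_mon] at hd hd'
  have h1 := natDegree_le_of_dvd h hd.1.ne_zero
  have h2 := natDegree_le_of_dvd h' hd'.1.ne_zero
  have hm : G ∈ {e ∈ monics F (min i j) | e ∣ d ∧ e ∣ d'} :=
    mem_filter.mpr ⟨mem_monics.mpr ⟨hG, by omega⟩, h, h'⟩
  have h3 := single_le_sum (f := fun e : F[X] => Nat.card F ^ (r * e.natDegree))
    (fun _ _ => Nat.zero_le _) hm
  rw [← Nat.cast_mul, Real.rpow_natCast, commonWeight]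
  exact_mod_cast h3

/-- The number of monic `d` of degree `j` for which `x` is close to a fraction with denominator
`d ^ r`. -/
def nu (m r j : ℕ) (x : Fin n → F) : ℝ := ∑ d ∈ mon F j, if x ∈ ann n m (d ^ r) then 1 else 0

theorem nu_eq_card (m r j : ℕ) (x : Fin n → F) :
    nu m r j x = #{d ∈ mon F j | x ∈ ann n m (d ^ r)} := by
  simp [nu]

theorem nu_nonneg (m r j : ℕ) (x : Fin n → F) : 0 ≤ nu m r j x := by
  rw [nu_eq_card]; positivity

theorem nu_rpow_le (m r j : ℕ) (x : Fin n → F) {s : ℝ} (hs : 0 < s) (hs' : s ≤ 1) :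
    nu m r j x ^ s ≤ nu m r j x := by
  rw [nu_eq_card]
  rcases Nat.eq_zero_or_pos #{d ∈ mon F j | x ∈ ann n m (d ^ r)} with h | h
  · rw [h, Nat.cast_zero, Real.zero_rpow hs.ne']
  · exact Real.rpow_le_self_of_one_le (by exact_mod_cast h) hs'

theorem prob_ann_pow_inter_le {m r i j : ℕ} (hmn : m ≤ n) (hi : r * i ≤ m) (hj : r * j ≤ m)
    {d d' : F[X]} (hd : d ∈ mon F i) (hd' : d' ∈ mon F j) :
    prob (ann n m (d ^ r) ∩ ann n m (d' ^ r)) ≤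
      commonWeight r i j d d' * (Nat.card F : ℝ) ^ (-(m : ℝ)) +
        (Nat.card F : ℝ) ^ ((r : ℝ) * (i + j) - 2 * m) := by
  have hq := card_pos_real F
  have hdm := mem_mon.mp hd
  have hdm' := mem_mon.mp hd'
  obtain ⟨G, u, v, hG, hu, hv, huv, rfl, rfl⟩ := exists_coprime_cofactors hdm.1 hdm'.1
  have h1 : ((G * u) ^ r).natDegree = r * i := by rw [natDegree_pow, hdm.2]
  have h2 : ((G * v) ^ r).natDegree = r * j := by rw [natDegree_pow, hdm'.2]
  rw [mul_pow] at h1 h2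
  have h3 := prob_ann_inter_le hmn (hG.pow r) (hu.pow r) (hv.pow r) huv.pow (by omega) (by omega)
  rw [h1, h2, natDegree_pow] at h3
  rw [mul_pow, mul_pow]
  refine h3.trans (add_le_add ?_ (le_of_eq ?_))
  · rw [sub_eq_add_neg, Real.rpow_add hq]
    refine mul_le_mul_of_nonneg_right ?_ (Real.rpow_pos_of_pos hq _).le
    have := rpow_natDegree_le_commonWeight r hd hd' hG (dvd_mul_right _ _) (dvd_mul_right _ _)
    exact_mod_cast this
  · congr 1; push_cast; ring

theorem expect_nu_mul_nu (m r i j : ℕ) :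
    𝔼 x : Fin n → F, nu m r i x * nu m r j x =
      ∑ d ∈ mon F i, ∑ d' ∈ mon F j, prob (ann n m (d ^ r) ∩ ann n m (d' ^ r)) := by
  simp_rw [nu, sum_mul_sum]
  rw [expect_sum_comm]
  refine sum_congr rfl fun d _ => ?_
  rw [expect_sum_comm]
  refine sum_congr rfl fun d' _ => ?_
  rw [prob]
  refine expect_congr rfl fun x _ => ?_
  by_cases h : x ∈ ann n m (d ^ r) <;> by_cases h' : x ∈ ann n m (d' ^ r) <;> simp [h, h']

theorem sum_mon_const (j : ℕ) (c : ℝ) :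
    ∑ _d ∈ mon F j, c = (Nat.card F : ℝ) ^ (j : ℝ) * c := by
  rw [sum_const, card_mon, nsmul_eq_mul, Real.rpow_natCast]
  push_cast
  rfl

theorem expect_nu_mul_nu_le {m r i j : ℕ} (hr : 2 ≤ r) (hmn : m ≤ n) (hi : r * i ≤ m)
    (hj : r * j ≤ m) :
    𝔼 x : Fin n → F, nu m r i x * nu m r j x ≤
      2 * (Nat.card F : ℝ) ^ ((i : ℝ) + j + (r - 1) * (min i j : ℕ) - m) +
        (Nat.card F : ℝ) ^ (((r : ℝ) + 1) * (i + j) - 2 * m) := by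
  have hq := card_pos_real F
  rw [expect_nu_mul_nu]
  refine (sum_le_sum fun d hd => sum_le_sum fun d' hd' =>
    prob_ann_pow_inter_le hmn hi hj hd hd').trans ?_
  simp_rw [sum_add_distrib, ← sum_mul, sum_mon_const]
  refine add_le_add ?_ (le_of_eq ?_)
  · refine (mul_le_mul_of_nonneg_right (sum_commonWeight_le hr i j)
      (Real.rpow_pos_of_pos hq _).le).trans (le_of_eq ?_)
    rw [mul_assoc, ← Real.rpow_add hq]
    congr 2
  · rw [← Real.rpow_add hq, ← Real.rpow_add hq]
    congr 1
    ring

/-- In the range `(r + 1) i, (r + 1) j ≤ m` coincidences are dominated by common divisors. -/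
theorem expect_nu_mul_nu_le_three {m r i j : ℕ} (hr : 2 ≤ r) (hmn : m ≤ n)
    (hi : (r + 1) * i ≤ m) (hj : (r + 1) * j ≤ m) :
    𝔼 x : Fin n → F, nu m r i x * nu m r j x ≤
      3 * (Nat.card F : ℝ) ^ ((i : ℝ) + j + (r - 1) * (min i j : ℕ) - m) := by
  have h1 : (1 : ℝ) ≤ Nat.card F := by exact_mod_cast one_lt_card.le
  have h2 : (Nat.card F : ℝ) ^ (((r : ℝ) + 1) * (i + j) - 2 * m) ≤
      (Nat.card F : ℝ) ^ ((i : ℝ) + j + (r - 1) * (min i j : ℕ) - m) := by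
    refine Real.rpow_le_rpow_of_exponent_le h1 ?_
    have hi' : ((r : ℝ) + 1) * i ≤ m := by exact_mod_cast hi
    have hj' : ((r : ℝ) + 1) * j ≤ m := by exact_mod_cast hj
    have hr' : (2 : ℝ) ≤ r := by exact_mod_cast hr
    rcases le_total i j with h | h
    · rw [min_eq_left h]
      nlinarith
    · rw [min_eq_right h]
      nlinarith
  have h3 := expect_nu_mul_nu_le (F := F) (n := n) hr hmn (i := i) (j := j)
    (by nlinarith) (by nlinarith)
  linarith

/-- Parseval's identity for the characters `chi x`. -/
theorem expect_norm_sq {s : Finset F[X]} (hs : ∀ f ∈ s, f.degree < n) (c : F[X] → ℂ) :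
    𝔼 x : Fin n → F, ‖∑ f ∈ s, c f * chi x f‖ ^ 2 = ∑ f ∈ s, ‖c f‖ ^ 2 := by
  have h1 : ∀ x : Fin n → F, ((‖∑ f ∈ s, c f * chi x f‖ ^ 2 : ℝ) : ℂ) =
      ∑ f ∈ s, ∑ g ∈ s, c f * (starRingEnd ℂ) (c g) * chi x (f - g) := by
    intro x
    rw [Complex.ofReal_pow, ← Complex.mul_conj', map_sum, sum_mul_sum]
    refine sum_congr rfl fun f _ => sum_congr rfl fun g _ => ?_
    rw [map_mul, sub_eq_add_neg, AddChar.map_add_eq_mul, AddChar.map_neg_eq_inv,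
      Complex.inv_eq_conj (norm_chi x g)]
    ring
  apply Complex.ofReal_injective
  rw [Complex.ofReal_expect]
  simp_rw [h1]
  rw [expect_sum_comm, Complex.ofReal_sum]
  refine sum_congr rfl fun f hf => ?_
  rw [expect_sum_comm]
  have h2 : ∀ g ∈ s, 𝔼 x : Fin n → F, c f * (starRingEnd ℂ) (c g) * chi x (f - g) =
      if g = f then c f * (starRingEnd ℂ) (c f) else 0 := by
    intro g hg
    rw [← mul_expect, expect_chi ((degree_sub_le _ _).trans_lt (max_lt (hs f hf) (hs g hg)))]
    by_cases h : g = f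
    · simp [h]
    · simp [h, sub_eq_zero, Ne.symm h]
  rw [sum_congr rfl h2, sum_ite_eq', if_pos hf, Complex.mul_conj', Complex.ofReal_pow]

/-- The exponential sum over the `r`-free monic polynomials of degree exactly `m`. -/
def expMon (r m : ℕ) (x : Fin n → F) : ℂ := ∑ f ∈ mon F m, rFreeInd r f * chi x f

/-- The part of `expMon` that comes from the divisors of degree at least `J`. -/
def highPart (r m J : ℕ) (x : Fin n → F) : ℂ :=
  ∑ j ∈ Ico J (m / r + 1), ∑ d ∈ mon F j, (moeb d : ℂ) * ∑ f ∈ mon F m with d ^ r ∣ f, chi x f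

theorem expMon_eq_sum {r : ℕ} (hr : 1 ≤ r) (m : ℕ) (x : Fin n → F) :
    expMon r m x = ∑ j ∈ range (m / r + 1), ∑ d ∈ mon F j,
      (moeb d : ℂ) * ∑ f ∈ mon F m with d ^ r ∣ f, chi x f := by
  have h1 : ∀ f ∈ mon F m, rFreeInd r f * chi x f =
      ∑ d ∈ monics F (m / r), (moeb d : ℂ) * if d ^ r ∣ f then chi x f else 0 := by
    intro f hf
    have h2 : rFreeInd r f = ((if IsRFree r f then 1 else 0 : ℤ) : ℂ) := by
      rw [rFreeInd]; split_ifs <;> simp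
    rw [h2, indicator_isRFree_eq_sum hr le_rfl hf, sum_filter]
    push_cast
    rw [sum_mul]
    refine sum_congr rfl fun d _ => ?_
    split_ifs <;> simp
  rw [expMon, sum_congr rfl h1, sum_comm, sum_monics]
  refine sum_congr rfl fun j _ => sum_congr rfl fun d _ => ?_
  rw [← mul_sum, sum_filter]

theorem norm_expMon_sub_highPart_le {r m J : ℕ} (hr : 1 ≤ r) (hJ : J ≤ m / r + 1)
    (x : Fin n → F) :
    ‖expMon r m x - highPart r m J x‖ ≤
      ∑ j ∈ range J, (Nat.card F : ℝ) ^ ((m : ℝ) - r * j) * nu m r j x := by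
  rw [expMon_eq_sum hr, highPart, ← sum_range_add_sum_Ico _ hJ, add_sub_cancel_right]
  refine (norm_sum_le _ _).trans (sum_le_sum fun j hj => ?_)
  rw [mem_range] at hj
  have hj' : r * j ≤ m := by
    rw [mul_comm]; exact (Nat.le_div_iff_mul_le (by omega)).mp (by omega)
  rw [nu, mul_sum]
  refine (norm_sum_le _ _).trans (sum_le_sum fun d hd => ?_)
  rw [mem_mon] at hd
  have hdeg : (d ^ r).natDegree = r * j := by rw [natDegree_pow, hd.2]
  rw [norm_mul, sum_chi_mon (hd.1.pow r) (by omega)]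
  have h1 : ‖(moeb d : ℂ)‖ ≤ 1 := by
    rw [Complex.norm_intCast]; exact_mod_cast abs_moeb_le_one d
  refine (mul_le_of_le_one_left (norm_nonneg _) h1).trans (le_of_eq ?_)
  split_ifs
  · rw [norm_mul, norm_chi, mul_one, mul_one, norm_pow, Complex.norm_natCast, hdeg, ← Nat.cast_mul,
      ← cast_pow_sub _ hj', Nat.cast_pow]
  · simp

theorem sum_Ico_pow_le {a : ℝ} (ha : 0 ≤ a) (ha' : a ≤ 3 / 4) (J K : ℕ) :
    ∑ i ∈ Ico J K, a ^ i ≤ 4 * a ^ J := by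
  refine (geom_sum_Ico_le_of_lt_one ha (by linarith)).trans ?_
  rw [div_le_iff₀ (by linarith)]
  have := pow_nonneg ha J
  nlinarith

variable (F) in
theorem card_rpow_neg_half_le {s : ℝ} (hs : 1 ≤ s) : (Nat.card F : ℝ) ^ (-s / 2) ≤ 3 / 4 := by
  have h2 : (2 : ℝ) ≤ Nat.card F := by exact_mod_cast one_lt_card (F := F)
  have hq := card_pos_real F
  have h3 : (Nat.card F : ℝ) ^ (-s / 2) ≤ (Nat.card F : ℝ) ^ (-(1 / 2) : ℝ) :=
    Real.rpow_le_rpow_of_exponent_le (by linarith) (by linarith)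
  refine h3.trans ?_
  rw [Real.rpow_neg hq.le, ← Real.sqrt_eq_rpow]
  have h4 : (4 / 3 : ℝ) ≤ √(Nat.card F : ℝ) := Real.le_sqrt_of_sq_le (by linarith)
  calc (√(Nat.card F : ℝ))⁻¹ ≤ (4 / 3 : ℝ)⁻¹ := inv_anti₀ (by norm_num) h4
    _ = _ := by norm_num

theorem card_filter_dvd_and_dvd_le {m r i j : ℕ} {d d' : F[X]} (hd : d ∈ mon F i)
    (hd' : d' ∈ mon F j) :
    (#{f ∈ mon F m | d ^ r ∣ f ∧ d' ^ r ∣ f} : ℝ) ≤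
      commonWeight r i j d d' * (Nat.card F : ℝ) ^ ((m : ℝ) - r * (i + j)) := by
  have hq := card_pos_real F
  have hdm := mem_mon.mp hd
  have hdm' := mem_mon.mp hd'
  obtain ⟨G, u, v, hG, hu, hv, huv, rfl, rfl⟩ := exists_coprime_cofactors hdm.1 hdm'.1
  have hw := rpow_natDegree_le_commonWeight r hd hd' hG (dvd_mul_right _ _) (dvd_mul_right _ _)
  have hw0 : 0 ≤ commonWeight r i j (G * u) (G * v) := (Real.rpow_pos_of_pos hq _).le.trans hw
  simp_rw [mul_pow, mul_dvd_and_mul_dvd_iff (hG.pow r).ne_zero huv.pow]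
  have hdeg : ((G ^ r) * (u ^ r * v ^ r)).natDegree = r * (G.natDegree + u.natDegree +
      v.natDegree) := by
    rw [(hG.pow r).natDegree_mul ((hu.pow r).mul (hv.pow r)), (hu.pow r).natDegree_mul (hv.pow r)]
    simp only [natDegree_pow]
    ring
  rw [hG.natDegree_mul hu] at hdm
  rw [hG.natDegree_mul hv] at hdm'
  rcases le_or_gt ((G ^ r) * (u ^ r * v ^ r)).natDegree m with hm | hm
  · rw [card_filter_dvd_mon ((hG.pow r).mul ((hu.pow r).mul (hv.pow r))) hm, cast_pow_sub _ hm]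
    refine le_trans (le_of_eq ?_) (mul_le_mul_of_nonneg_right hw (Real.rpow_pos_of_pos hq _).le)
    rw [← Real.rpow_add hq, hdeg, ← hdm.2, ← hdm'.2]
    congr 1
    push_cast
    ring
  · rw [filter_dvd_mon_eq_empty hm, card_empty, Nat.cast_zero]
    exact mul_nonneg hw0 (Real.rpow_pos_of_pos hq _).le

/-- Large divisors contribute little in mean square. -/
theorem expect_norm_highPart_sq_le {m r J : ℕ} (hr : 2 ≤ r) (hmn : m < n) :
    𝔼 x : Fin n → F, ‖highPart r m J x‖ ^ 2 ≤
      32 * (Nat.card F : ℝ) ^ ((m : ℝ) - (r - 1) * J) := by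
  have hq := card_pos_real F
  have h1q : (1 : ℝ) ≤ Nat.card F := by exact_mod_cast one_lt_card.le
  have hr' : (2 : ℝ) ≤ r := by exact_mod_cast hr
  set c : F[X] → ℂ := fun f => ∑ j ∈ Ico J (m / r + 1), ∑ d ∈ mon F j,
    (moeb d : ℂ) * if d ^ r ∣ f then 1 else 0 with hc
  have h1 : ∀ x : Fin n → F, highPart r m J x = ∑ f ∈ mon F m, c f * chi x f := by
    intro x
    simp_rw [highPart, hc, sum_mul]
    rw [sum_comm]
    refine sum_congr rfl fun j _ => ?_
    rw [sum_comm]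
    refine sum_congr rfl fun d _ => ?_
    rw [sum_filter, mul_sum]
    refine sum_congr rfl fun f _ => ?_
    split_ifs <;> simp
  simp_rw [h1]
  rw [expect_norm_sq (fun f hf => by
    rw [mem_mon] at hf
    rw [degree_eq_natDegree hf.1.ne_zero, hf.2]
    exact_mod_cast hmn)]
  have h2 : ∀ f, ‖c f‖ ≤ ∑ j ∈ Ico J (m / r + 1), ∑ d ∈ mon F j,
      if d ^ r ∣ f then (1 : ℝ) else 0 := by
    intro f
    refine (norm_sum_le _ _).trans (sum_le_sum fun j _ => ?_)
    refine (norm_sum_le _ _).trans (sum_le_sum fun d _ => ?_)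
    have h3 : ‖(moeb d : ℂ)‖ ≤ 1 := by
      rw [Complex.norm_intCast]; exact_mod_cast abs_moeb_le_one d
    rw [norm_mul]
    split_ifs
    · rwa [norm_one, mul_one]
    · simp
  calc ∑ f ∈ mon F m, ‖c f‖ ^ 2
      ≤ ∑ f ∈ mon F m, (∑ j ∈ Ico J (m / r + 1), ∑ d ∈ mon F j,
          if d ^ r ∣ f then (1 : ℝ) else 0) ^ 2 :=
        sum_le_sum fun f _ => pow_le_pow_left₀ (norm_nonneg _) (h2 f) 2
    _ = ∑ i ∈ Ico J (m / r + 1), ∑ j ∈ Ico J (m / r + 1), ∑ d ∈ mon F i, ∑ d' ∈ mon F j,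
          (#{f ∈ mon F m | d ^ r ∣ f ∧ d' ^ r ∣ f} : ℝ) := by
        simp_rw [sq, sum_mul_sum]
        rw [sum_comm]
        refine sum_congr rfl fun i _ => ?_
        rw [sum_comm]
        refine sum_congr rfl fun j _ => ?_
        rw [sum_comm]
        refine sum_congr rfl fun d _ => ?_
        rw [sum_comm]
        refine sum_congr rfl fun d' _ => ?_
        rw [card_filter, Nat.cast_sum]
        refine sum_congr rfl fun f _ => ?_
        by_cases h : d ^ r ∣ f <;> by_cases h' : d' ^ r ∣ f <;> simp [h, h']
    _ ≤ ∑ i ∈ Ico J (m / r + 1), ∑ j ∈ Ico J (m / r + 1),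
          2 * (Nat.card F : ℝ) ^ (m : ℝ) * (((Nat.card F : ℝ) ^ (-((r : ℝ) - 1) / 2)) ^ i *
            ((Nat.card F : ℝ) ^ (-((r : ℝ) - 1) / 2)) ^ j) := by
        refine sum_le_sum fun i _ => sum_le_sum fun j _ => ?_
        refine (sum_le_sum fun d hd => sum_le_sum fun d' hd' =>
          card_filter_dvd_and_dvd_le hd hd').trans ?_
        simp_rw [← sum_mul]
        refine (mul_le_mul_of_nonneg_right (sum_commonWeight_le hr i j)
          (Real.rpow_pos_of_pos hq _).le).trans ?_
        rw [← Real.rpow_natCast, ← Real.rpow_natCast, ← Real.rpow_mul hq.le,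
          ← Real.rpow_mul hq.le, mul_assoc, mul_assoc, ← Real.rpow_add hq, ← Real.rpow_add hq,
          ← Real.rpow_add hq]
        refine mul_le_mul_of_nonneg_left (Real.rpow_le_rpow_of_exponent_le h1q ?_) (by norm_num)
        rcases le_total i j with h | h
        · rw [min_eq_left h]
          have : (i : ℝ) ≤ j := by exact_mod_cast h
          nlinarith
        · rw [min_eq_right h]
          have : (j : ℝ) ≤ i := by exact_mod_cast h
          nlinarith
    _ = 2 * (Nat.card F : ℝ) ^ (m : ℝ) *
          (∑ i ∈ Ico J (m / r + 1), ((Nat.card F : ℝ) ^ (-((r : ℝ) - 1) / 2)) ^ i) ^ 2 := by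
        rw [sq, sum_mul_sum, mul_sum]
        simp_rw [mul_sum]
    _ ≤ 2 * (Nat.card F : ℝ) ^ (m : ℝ) *
          (4 * ((Nat.card F : ℝ) ^ (-((r : ℝ) - 1) / 2)) ^ J) ^ 2 := by
        refine mul_le_mul_of_nonneg_left (pow_le_pow_left₀ (sum_nonneg fun i _ =>
          pow_nonneg (Real.rpow_pos_of_pos hq _).le _) (sum_Ico_pow_le
          (Real.rpow_pos_of_pos hq _).le (card_rpow_neg_half_le F (by linarith)) _ _) 2) ?_
        exact mul_nonneg (by norm_num) (Real.rpow_pos_of_pos hq _).le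
    _ = _ := by
        rw [← Real.rpow_natCast (_ ^ (_ : ℝ)) J, ← Real.rpow_mul hq.le, mul_pow,
          ← Real.rpow_natCast (_ ^ (_ : ℝ)) 2, ← Real.rpow_mul hq.le]
        rw [show (m : ℝ) - (r - 1) * J = m + -(r - 1) / 2 * J * (2 : ℕ) by push_cast; ring,
          Real.rpow_add hq]
        ring

end SecondMoments

/-! ### The upper bound for a single degree -/

section UpperBound
open Polynomial Finset
open scoped Classical BigOperators

theorem rpow_sum_le_sum_rpow {ι : Type*} (s : Finset ι) (a : ι → ℝ) (ha : ∀ i ∈ s, 0 ≤ a i)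
    {p : ℝ} (hp : 0 < p) (hp' : p ≤ 1) : (∑ i ∈ s, a i) ^ p ≤ ∑ i ∈ s, a i ^ p := by
  induction s using Finset.induction_on with
  | empty => simp [Real.zero_rpow hp.ne']
  | insert i s his ih =>
    rw [sum_insert his, sum_insert his]
    have h1 := ih fun j hj => ha j (mem_insert_of_mem hj)
    have h2 := Real.rpow_add_le_add_rpow (ha i (mem_insert_self _ _))
      (sum_nonneg fun j hj => ha j (mem_insert_of_mem hj)) hp.le hp'
    linarith

theorem rpow_sum_le_sq {ι : Type*} (s : Finset ι) (a : ι → ℝ) (ha : ∀ i ∈ s, 0 ≤ a i)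
    {k : ℝ} (hk : 0 < k) (hk' : k ≤ 2) :
    (∑ i ∈ s, a i) ^ k ≤ (∑ i ∈ s, a i ^ (k / 2)) ^ 2 := by
  have h := rpow_sum_le_sum_rpow s a ha (p := k / 2) (by linarith) (by linarith)
  have h0 := sum_nonneg ha
  calc (∑ i ∈ s, a i) ^ k = ((∑ i ∈ s, a i) ^ (k / 2)) ^ 2 := by
        rw [← Real.rpow_natCast, ← Real.rpow_mul h0]; congr 1; push_cast; ring
    _ ≤ _ := pow_le_pow_left₀ (Real.rpow_nonneg h0 _) h 2

theorem rpow_add_le_four_mul {a b k : ℝ} (ha : 0 ≤ a) (hb : 0 ≤ b) (hk : 0 ≤ k) (hk' : k ≤ 2) :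
    (a + b) ^ k ≤ 4 * (a ^ k + b ^ k) := by
  wlog h : a ≤ b generalizing a b
  · rw [add_comm a, add_comm (a ^ k)]
    exact this hb ha (le_of_not_ge h)
  have h2 : (2 : ℝ) ^ k ≤ 4 := by
    calc (2 : ℝ) ^ k ≤ (2 : ℝ) ^ (2 : ℝ) := Real.rpow_le_rpow_of_exponent_le (by norm_num) hk'
      _ = 4 := by norm_num
  calc (a + b) ^ k ≤ (2 * b) ^ k := Real.rpow_le_rpow (by linarith) (by linarith) hk
    _ = 2 ^ k * b ^ k := Real.mul_rpow (by norm_num) hb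
    _ ≤ 4 * (a ^ k + b ^ k) := by
      have := Real.rpow_nonneg ha k
      have := Real.rpow_nonneg hb k
      nlinarith

/-- A substitute for Jensen's inequality: a small moment is controlled by the second moment, with
a free parameter `t`. -/
theorem rpow_le_add_mul_sq {u t k : ℝ} (hu : 0 ≤ u) (ht : 0 < t) (hk : 0 ≤ k) (hk' : k ≤ 2) :
    u ^ k ≤ t ^ k + t ^ (k - 2) * u ^ 2 := by
  rcases le_total u t with h | h
  · have := Real.rpow_le_rpow hu h hk
    have := Real.rpow_pos_of_pos ht (k - 2)
    nlinarith [sq_nonneg u]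
  · have hu' := ht.trans_le h
    have h1 : u ^ k = u ^ (k - 2) * u ^ 2 := by
      rw [← Real.rpow_natCast, ← Real.rpow_add hu']; congr 1; push_cast; ring
    have h2 : u ^ (k - 2) ≤ t ^ (k - 2) := Real.rpow_le_rpow_of_nonpos ht h (by linarith)
    have := Real.rpow_nonneg ht.le k
    rw [h1]
    nlinarith [sq_nonneg u]

theorem sum_pow_dist_le {a : ℝ} (ha : 0 ≤ a) (ha' : a ≤ 3 / 4) (i K : ℕ) :
    ∑ j ∈ range K, a ^ ((i - j) + (j - i)) ≤ 8 := by
  have h0 : ∀ K, ∑ j ∈ range K, a ^ j ≤ 4 := fun K => by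
    have := sum_Ico_pow_le ha ha' 0 K
    rwa [pow_zero, mul_one, ← range_eq_Ico] at this
  calc ∑ j ∈ range K, a ^ ((i - j) + (j - i))
      ≤ ∑ j ∈ range (i + 1 + K), a ^ ((i - j) + (j - i)) :=
        sum_le_sum_of_subset_of_nonneg (range_subset_range.mpr (by omega))
          fun _ _ _ => pow_nonneg ha _
    _ = ∑ j ∈ range (i + 1), a ^ ((i - j) + (j - i)) +
          ∑ j ∈ range K, a ^ ((i - (i + 1 + j)) + (i + 1 + j - i)) := sum_range_add _ _ _
    _ ≤ ∑ j ∈ range (i + 1), a ^ (i + 1 - 1 - j) + ∑ j ∈ range K, a ^ j := by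
        refine add_le_add (le_of_eq (sum_congr rfl fun j hj => ?_)) (sum_le_sum fun j _ => ?_)
        · rw [mem_range] at hj; congr 1; omega
        · exact pow_le_pow_of_le_one ha (by linarith) (by omega)
    _ ≤ 8 := by
        rw [sum_range_reflect (fun j => a ^ j)]
        linarith [h0 (i + 1), h0 K]

/-- Schur's test for a kernel that decays geometrically off the diagonal. -/
theorem sum_mul_mul_pow_dist_le {a : ℝ} (ha : 0 ≤ a) (ha' : a ≤ 3 / 4) (u : ℕ → ℝ) (K : ℕ) :
    ∑ i ∈ range K, ∑ j ∈ range K, u i * u j * a ^ ((i - j) + (j - i)) ≤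
      8 * ∑ i ∈ range K, u i ^ 2 := by
  have h1 : ∑ i ∈ range K, ∑ j ∈ range K, u i ^ 2 * a ^ ((i - j) + (j - i)) ≤
      8 * ∑ i ∈ range K, u i ^ 2 := by
    rw [mul_sum]
    refine sum_le_sum fun i _ => ?_
    rw [← mul_sum, mul_comm]
    exact mul_le_mul_of_nonneg_right (sum_pow_dist_le ha ha' i K) (sq_nonneg _)
  have h2 : ∑ i ∈ range K, ∑ j ∈ range K, u j ^ 2 * a ^ ((i - j) + (j - i)) =
      ∑ i ∈ range K, ∑ j ∈ range K, u i ^ 2 * a ^ ((i - j) + (j - i)) := by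
    rw [sum_comm]
    simp_rw [add_comm]
  have h3 : ∑ i ∈ range K, ∑ j ∈ range K, u i * u j * a ^ ((i - j) + (j - i)) ≤
      ∑ i ∈ range K, ∑ j ∈ range K, ((u i ^ 2 * a ^ ((i - j) + (j - i))) / 2 +
        (u j ^ 2 * a ^ ((i - j) + (j - i))) / 2) := by
    refine sum_le_sum fun i _ => sum_le_sum fun j _ => ?_
    have := pow_nonneg ha ((i - j) + (j - i))
    nlinarith [sq_nonneg (u i - u j)]
  simp_rw [sum_add_distrib, ← sum_div] at h3
  linarith

variable {F : Type*} [Field F] [Fintype F] {n : ℕ}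

/-- The moments of the part of the exponential sum that comes from the divisors of degree at most
`m / (r + 1)`. -/
theorem expect_lowPart_rpow_le {m r : ℕ} (hr : 2 ≤ r) (hmn : m ≤ n) {k : ℝ} (hk : 0 < k)
    (hk' : k ≤ 2) :
    𝔼 x : Fin n → F, (∑ j ∈ range (m / (r + 1) + 1),
      (Nat.card F : ℝ) ^ ((m : ℝ) - r * j) * nu m r j x) ^ k ≤
    24 * ∑ i ∈ range (m / (r + 1) + 1),
      (Nat.card F : ℝ) ^ (m * (k - 1) + i * (r + 1 - r * k)) := by
  have hq := card_pos_real F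
  have hr' : (2 : ℝ) ≤ r := by exact_mod_cast hr
  set K := m / (r + 1) + 1 with hK
  have hKi : ∀ i ∈ range K, (r + 1) * i ≤ m := by
    intro i hi
    rw [mem_range] at hi
    rw [mul_comm]; exact (Nat.le_div_iff_mul_le (by omega)).mp (by omega)
  set w : ℕ → ℝ := fun i => (Nat.card F : ℝ) ^ (((m : ℝ) - r * i) * (k / 2)) with hw
  have h1 : ∀ x : Fin n → F, (∑ j ∈ range K, (Nat.card F : ℝ) ^ ((m : ℝ) - r * j) *
      nu m r j x) ^ k ≤ ∑ i ∈ range K, ∑ j ∈ range K, w i * w j * (nu m r i x * nu m r j x) := by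
    intro x
    have h2 : ∀ j ∈ range K, 0 ≤ (Nat.card F : ℝ) ^ ((m : ℝ) - r * j) * nu m r j x :=
      fun j _ => mul_nonneg (Real.rpow_pos_of_pos hq _).le (nu_nonneg _ _ _ _)
    refine (rpow_sum_le_sq _ _ h2 hk hk').trans ?_
    have h3 : ∑ i ∈ range K, ((Nat.card F : ℝ) ^ ((m : ℝ) - r * i) * nu m r i x) ^ (k / 2) ≤
        ∑ i ∈ range K, w i * nu m r i x := by
      refine sum_le_sum fun i _ => ?_
      rw [Real.mul_rpow (Real.rpow_pos_of_pos hq _).le (nu_nonneg _ _ _ _), ← Real.rpow_mul hq.le]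
      exact mul_le_mul_of_nonneg_left (nu_rpow_le _ _ _ _ (by linarith) (by linarith))
        (Real.rpow_pos_of_pos hq _).le
    refine (pow_le_pow_left₀ (sum_nonneg fun i hi => Real.rpow_nonneg (h2 i hi) _) h3 2).trans
      (le_of_eq ?_)
    rw [sq, sum_mul_sum]
    exact sum_congr rfl fun i _ => sum_congr rfl fun j _ => by ring
  set a : ℝ := (Nat.card F : ℝ) ^ (-((r : ℝ) - 1) / 2) with ha
  set u : ℕ → ℝ := fun i => (Nat.card F : ℝ) ^ ((i : ℝ) * (r + 1 - r * k) / 2) with hu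
  calc _ ≤ 𝔼 x : Fin n → F, ∑ i ∈ range K, ∑ j ∈ range K, w i * w j *
          (nu m r i x * nu m r j x) := expect_le_expect fun x _ => h1 x
    _ = ∑ i ∈ range K, ∑ j ∈ range K, w i * w j *
          𝔼 x : Fin n → F, nu m r i x * nu m r j x := by
        rw [expect_sum_comm]
        refine sum_congr rfl fun i _ => ?_
        rw [expect_sum_comm]
        refine sum_congr rfl fun j _ => ?_
        rw [mul_expect]
    _ ≤ ∑ i ∈ range K, ∑ j ∈ range K, 3 * (Nat.card F : ℝ) ^ (m * (k - 1)) *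
          (u i * u j * a ^ ((i - j) + (j - i))) := by
        refine sum_le_sum fun i hi => sum_le_sum fun j hj => ?_
        refine (mul_le_mul_of_nonneg_left (expect_nu_mul_nu_le_three hr hmn (hKi i hi) (hKi j hj))
          (mul_pos (Real.rpow_pos_of_pos hq _) (Real.rpow_pos_of_pos hq _)).le).trans
          (le_of_eq ?_)
        simp only [hu, ha]
        rw [← Real.rpow_natCast, ← Real.rpow_mul hq.le, ← Real.rpow_add hq, ← Real.rpow_add hq,
            ← Real.rpow_add hq, mul_assoc,
          ← Real.rpow_add hq, mul_left_comm, ← Real.rpow_add hq]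
        congr 2
        rcases le_total i j with h | h
        · rw [min_eq_left h, Nat.sub_eq_zero_of_le h, zero_add, Nat.cast_sub h]
          ring
        · rw [min_eq_right h, Nat.sub_eq_zero_of_le h, add_zero, Nat.cast_sub h]
          ring
    _ = 3 * (Nat.card F : ℝ) ^ (m * (k - 1)) *
          ∑ i ∈ range K, ∑ j ∈ range K, u i * u j * a ^ ((i - j) + (j - i)) := by
        simp_rw [mul_sum]
    _ ≤ 3 * (Nat.card F : ℝ) ^ (m * (k - 1)) * (8 * ∑ i ∈ range K, u i ^ 2) := by
        refine mul_le_mul_of_nonneg_left (sum_mul_mul_pow_dist_le (Real.rpow_pos_of_pos hq _).le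
          (card_rpow_neg_half_le F (by linarith)) u K) ?_
        exact mul_nonneg (by norm_num) (Real.rpow_pos_of_pos hq _).le
    _ = _ := by
        simp_rw [mul_sum]
        refine sum_congr rfl fun i _ => ?_
        rw [hu, ← Real.rpow_natCast, ← Real.rpow_mul hq.le, Real.rpow_add hq,
          show (i : ℝ) * (r + 1 - r * k) / 2 * (2 : ℕ) = i * (r + 1 - r * k) by push_cast; ring]
        ring

/-- The upper bound for the moments of the exponential sum over a single degree: a
square-root cancellation term, and one term for the fractions with denominator `d ^ r`, for each
degree `i` of `d`. -/
theorem expect_norm_expMon_rpow_le {m r : ℕ} (hr : 2 ≤ r) (hmn : m < n) {k : ℝ} (hk : 0 < k)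
    (hk' : k ≤ 2) :
    𝔼 x : Fin n → F, ‖expMon r m x‖ ^ k ≤ 132 * ((Nat.card F : ℝ) ^ (m * k / (r + 1)) +
      ∑ i ∈ range (m / (r + 1) + 1),
        (Nat.card F : ℝ) ^ (m * (k - 1) + i * (r + 1 - r * k))) := by
  have hq := card_pos_real F
  have h1q : (1 : ℝ) ≤ Nat.card F := by exact_mod_cast one_lt_card.le
  have hr' : (2 : ℝ) ≤ r := by exact_mod_cast hr
  set K := m / (r + 1) + 1 with hK
  set t : ℝ := (Nat.card F : ℝ) ^ ((m : ℝ) / (r + 1)) with ht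
  have ht0 : 0 < t := Real.rpow_pos_of_pos hq _
  have h1 : 𝔼 x : Fin n → F, ‖highPart r m K x‖ ^ 2 ≤ 32 * t ^ 2 := by
    refine (expect_norm_highPart_sq_le hr hmn).trans ?_
    rw [ht, ← Real.rpow_natCast, ← Real.rpow_mul hq.le]
    refine mul_le_mul_of_nonneg_left (Real.rpow_le_rpow_of_exponent_le h1q ?_) (by norm_num)
    have h2 : (m : ℝ) / (r + 1) ≤ K := by
      rw [div_le_iff₀ (by linarith), hK]
      have := Nat.lt_div_mul_add (a := m) (b := r + 1) (by omega)
      have h3 : m ≤ (m / (r + 1) + 1) * (r + 1) := by nlinarith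
      exact_mod_cast h3
    have h4 : ((r : ℝ) - 1) * (m / (r + 1)) ≤ (r - 1) * K :=
      mul_le_mul_of_nonneg_left h2 (by linarith)
    have h5 : (m : ℝ) - (r - 1) * (m / (r + 1)) = m / (r + 1) * 2 := by
      field_simp; ring
    push_cast
    linarith
  have h2 : 𝔼 x : Fin n → F, ‖highPart r m K x‖ ^ k ≤ 33 * (Nat.card F : ℝ) ^ (m * k / (r + 1)) := by
    calc _ ≤ 𝔼 x : Fin n → F, (t ^ k + t ^ (k - 2) * ‖highPart r m K x‖ ^ 2) :=
          expect_le_expect fun x _ => rpow_le_add_mul_sq (norm_nonneg _) ht0 hk.le hk'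
      _ = t ^ k + t ^ (k - 2) * 𝔼 x : Fin n → F, ‖highPart r m K x‖ ^ 2 := by
          rw [expect_add_distrib, ← mul_expect, Fintype.expect_const]
      _ ≤ t ^ k + t ^ (k - 2) * (32 * t ^ 2) := by
          gcongr
      _ = 33 * t ^ k := by
          have : t ^ k = t ^ (k - 2) * t ^ 2 := by
            rw [← Real.rpow_natCast, ← Real.rpow_add ht0]; congr 1; push_cast; ring
          rw [this]; ring
      _ = _ := by
          rw [ht, ← Real.rpow_mul hq.le]; congr 2; ring
  have hKr : K ≤ m / r + 1 := by
    have : m / (r + 1) ≤ m / r := Nat.div_le_div_left (Nat.le_succ r) (by omega)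
    omega
  calc _ ≤ 𝔼 x : Fin n → F, 4 * ((∑ j ∈ range K,
          (Nat.card F : ℝ) ^ ((m : ℝ) - r * j) * nu m r j x) ^ k + ‖highPart r m K x‖ ^ k) := by
        refine expect_le_expect fun x _ => ?_
        have h3 := norm_expMon_sub_highPart_le (by omega) hKr x
        have h4 : ‖expMon r m x‖ ≤ ‖expMon r m x - highPart r m K x‖ + ‖highPart r m K x‖ := by
          simpa using norm_add_le (expMon r m x - highPart r m K x) (highPart r m K x)
        refine (Real.rpow_le_rpow (norm_nonneg _) (h4.trans (add_le_add_left h3 _)) hk.le).trans ?_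
        exact rpow_add_le_four_mul ((norm_nonneg _).trans h3) (norm_nonneg _) hk.le hk'
    _ ≤ 4 * (24 * ∑ i ∈ range K, (Nat.card F : ℝ) ^ (m * (k - 1) + i * (r + 1 - r * k)) +
          33 * (Nat.card F : ℝ) ^ (m * k / (r + 1))) := by
        rw [← mul_expect, expect_add_distrib]
        gcongr
        exact expect_lowPart_rpow_le hr hmn.le hk hk'
    _ ≤ _ := by
        have : 0 ≤ ∑ i ∈ range K, (Nat.card F : ℝ) ^ (m * (k - 1) + i * (r + 1 - r * k)) :=
          sum_nonneg fun i _ => (Real.rpow_pos_of_pos hq _).le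
        linarith

end UpperBound

/-! ### Summation over the degrees -/

section Summation
open Polynomial Finset
open scoped Classical BigOperators

/-- A sum whose terms have geometrically growing `k`-th moments has a `k`-th moment of the size of
the last one. -/
theorem expect_sum_rpow_le {ι : Type*} [Fintype ι] {N : ℕ} {U : ℕ → ι → ℝ}
    (hU : ∀ m x, 0 ≤ U m x) {k A ρ : ℝ} (hk : 0 < k) (hk' : k ≤ 2) (hA : 0 ≤ A) (hρ : 0 < ρ)
    (hρ' : ρ < 1) (h : ∀ m ≤ N, 𝔼 x, U m x ^ k ≤ A * (ρ ^ (N - m)) ^ 2) :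
    𝔼 x, (∑ m ∈ range (N + 1), U m x) ^ k ≤ A * (1 / (1 - ρ)) ^ 2 := by
  have hs : ∑ m ∈ range (N + 1), ρ ^ (N - m) ≤ 1 / (1 - ρ) := by
    have h1 := sum_range_reflect (fun j => ρ ^ j) (N + 1)
    rw [Nat.add_sub_cancel] at h1
    rw [h1, range_eq_Ico]
    simpa using geom_sum_Ico_le_of_lt_one hρ.le hρ' (m := 0) (n := N + 1)
  have hs0 : 0 ≤ ∑ m ∈ range (N + 1), ρ ^ (N - m) := sum_nonneg fun m _ => (pow_pos hρ _).le
  calc 𝔼 x, (∑ m ∈ range (N + 1), U m x) ^ k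
      ≤ 𝔼 x, (∑ m ∈ range (N + 1), ρ ^ (N - m)) *
          ∑ m ∈ range (N + 1), U m x ^ k * (ρ ^ (N - m))⁻¹ := by
        refine expect_le_expect fun x _ => (rpow_sum_le_sq _ _ (fun m _ => hU m x) hk hk').trans ?_
        refine sum_sq_le_sum_mul_sum_of_sq_le_mul _ (fun m _ => (pow_pos hρ _).le)
          (fun m _ => mul_nonneg (Real.rpow_nonneg (hU m x) _) (inv_pos.mpr (pow_pos hρ _)).le)
          fun m _ => le_of_eq ?_
        rw [← Real.rpow_natCast, ← Real.rpow_mul (hU m x),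
          show k / 2 * (2 : ℕ) = k by push_cast; ring]
        field_simp [(pow_pos hρ (N - m)).ne']
    _ = (∑ m ∈ range (N + 1), ρ ^ (N - m)) *
          ∑ m ∈ range (N + 1), (𝔼 x, U m x ^ k) * (ρ ^ (N - m))⁻¹ := by
        rw [← mul_expect, expect_sum_comm]
        simp_rw [expect_mul]
    _ ≤ (∑ m ∈ range (N + 1), ρ ^ (N - m)) *
          ∑ m ∈ range (N + 1), A * (ρ ^ (N - m)) ^ 2 * (ρ ^ (N - m))⁻¹ := by
        refine mul_le_mul_of_nonneg_left (sum_le_sum fun m hm => ?_) hs0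
        exact mul_le_mul_of_nonneg_right (h m (by rw [mem_range] at hm; omega))
          (inv_pos.mpr (pow_pos hρ _)).le
    _ = A * (∑ m ∈ range (N + 1), ρ ^ (N - m)) ^ 2 := by
        have : ∀ m, A * (ρ ^ (N - m)) ^ 2 * (ρ ^ (N - m))⁻¹ = A * ρ ^ (N - m) := fun m => by
          field_simp [(pow_pos hρ (N - m)).ne']
        simp_rw [this]
        rw [← mul_sum]
        ring
    _ ≤ _ := by gcongr

theorem norm_rFreeInd_le_one {F : Type*} [Field F] (r : ℕ) (f : F[X]) : ‖rFreeInd r f‖ ≤ 1 := by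
  rw [rFreeInd]; split_ifs <;> simp

variable {F : Type*} [Field F] [Fintype F] {n : ℕ}

/-- The exponential sum over the `r`-free monic polynomials of degree at most `N`. -/
def expTot (r N : ℕ) (x : Fin n → F) : ℂ := ∑ f ∈ monics F N, rFreeInd r f * chi x f

theorem expTot_eq_sum (r N : ℕ) (x : Fin n → F) :
    expTot r N x = ∑ m ∈ range (N + 1), expMon r m x := by
  rw [expTot, sum_monics]
  rfl

theorem expect_norm_expTot_rpow_le {N r : ℕ} (hr : 2 ≤ r) (hN : N < n) {k γ D : ℝ} (hk : 0 < k)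
    (hk' : k ≤ 2) (hγ : 0 < γ) (hD : 0 ≤ D)
    (h : ∀ m ≤ N, (Nat.card F : ℝ) ^ (m * k / (r + 1)) + ∑ i ∈ range (m / (r + 1) + 1),
        (Nat.card F : ℝ) ^ (m * (k - 1) + i * (r + 1 - r * k)) ≤
          D * (Nat.card F : ℝ) ^ (m * γ)) :
    𝔼 x : Fin n → F, ‖expTot r N x‖ ^ k ≤
      132 * D * (1 / (1 - (Nat.card F : ℝ) ^ (-γ / 2))) ^ 2 * (Nat.card F : ℝ) ^ (N * γ) := by
  have hq := card_pos_real F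
  have h1q : (1 : ℝ) < Nat.card F := by exact_mod_cast one_lt_card (F := F)
  have h1 : ∀ m ≤ N, 𝔼 x : Fin n → F, ‖expMon r m x‖ ^ k ≤
      132 * D * (Nat.card F : ℝ) ^ (N * γ) * (((Nat.card F : ℝ) ^ (-γ / 2)) ^ (N - m)) ^ 2 := by
    intro m hm
    refine (expect_norm_expMon_rpow_le hr (by omega) hk hk').trans ?_
    refine (mul_le_mul_of_nonneg_left (h m hm) (by norm_num)).trans (le_of_eq ?_)
    rw [← pow_mul, ← Real.rpow_natCast, ← Real.rpow_mul hq.le, mul_assoc (132 * D),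
      ← Real.rpow_add hq, ← mul_assoc]
    congr 2
    push_cast [Nat.cast_sub hm]
    ring
  have h2 := expect_sum_rpow_le (fun m x => norm_nonneg (expMon r m x)) hk hk'
    (mul_nonneg (mul_nonneg (by norm_num) hD) (Real.rpow_pos_of_pos hq _).le)
    (Real.rpow_pos_of_pos hq _) (Real.rpow_lt_one_of_one_lt_of_neg h1q (by linarith)) h1
  calc _ ≤ 𝔼 x : Fin n → F, (∑ m ∈ range (N + 1), ‖expMon r m x‖) ^ k := by
        refine expect_le_expect fun x _ => Real.rpow_le_rpow (norm_nonneg _) ?_ hk.le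
        rw [expTot_eq_sum]
        exact norm_sum_le _ _
    _ ≤ _ := h2
    _ = _ := by ring

theorem sum_range_rpow_neg_le {Q δ : ℝ} (hQ : 1 < Q) (hδ : δ < 0) (K : ℕ) :
    ∑ i ∈ range K, Q ^ (i * δ) ≤ 1 / (1 - Q ^ δ) := by
  have hq : 0 < Q := by linarith
  have h1 := geom_sum_Ico_le_of_lt_one (Real.rpow_pos_of_pos hq δ).le
    (Real.rpow_lt_one_of_one_lt_of_neg hQ hδ) (m := 0) (n := K)
  rw [pow_zero, ← range_eq_Ico] at h1
  refine le_trans (le_of_eq (sum_congr rfl fun i _ => ?_)) h1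
  rw [← Real.rpow_natCast, ← Real.rpow_mul hq.le, mul_comm]

theorem sum_range_rpow_pos_le {Q δ : ℝ} (hQ : 1 < Q) (hδ : 0 < δ) (y : ℕ) :
    ∑ i ∈ range (y + 1), Q ^ (i * δ) ≤ 1 / (1 - Q ^ (-δ)) * Q ^ (y * δ) := by
  have hq : 0 < Q := by linarith
  have h1 := sum_range_rpow_neg_le hQ (neg_lt_zero.mpr hδ) (y + 1)
  rw [← sum_range_reflect] at h1
  refine le_trans (le_of_eq ?_) (mul_le_mul_of_nonneg_right h1 (Real.rpow_pos_of_pos hq _).le)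
  rw [sum_mul]
  refine sum_congr rfl fun i hi => ?_
  rw [mem_range] at hi
  rw [← Real.rpow_add hq, Nat.add_sub_cancel, Nat.cast_sub (by omega)]
  congr 1
  ring

variable (F)

theorem expect_norm_expTot_rpow_le_of_lt {N r : ℕ} (hr : 2 ≤ r) (hN : N < n) {k : ℝ} (hk : 0 < k)
    (hk' : k < 1 + 1 / (r : ℝ)) :
    𝔼 x : Fin n → F, ‖expTot r N x‖ ^ k ≤
      132 * (1 + 1 / (1 - (Nat.card F : ℝ) ^ (-(r + 1 - r * k)))) *
        (1 / (1 - (Nat.card F : ℝ) ^ (-(k / (r + 1)) / 2))) ^ 2 *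
        (Nat.card F : ℝ) ^ (N * k / (r + 1)) := by
  have h1q : (1 : ℝ) < Nat.card F := by exact_mod_cast one_lt_card (F := F)
  have hq := card_pos_real F
  have hr' : (2 : ℝ) ≤ r := by exact_mod_cast hr
  have hr0 : (0 : ℝ) < r := by linarith
  have h1r : 1 / (r : ℝ) ≤ 1 / 2 := one_div_le_one_div_of_le (by norm_num) hr'
  have hδ : 0 < r + 1 - r * k := by
    have := mul_lt_mul_of_pos_left hk' hr0
    rw [mul_add, mul_one, mul_one_div_cancel hr0.ne'] at this
    linarith
  have hc : 0 < 1 / (1 - (Nat.card F : ℝ) ^ (-(r + 1 - r * k))) :=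
    one_div_pos.mpr (sub_pos.mpr (Real.rpow_lt_one_of_one_lt_of_neg h1q (by linarith)))
  rw [mul_div_assoc (N : ℝ)]
  refine expect_norm_expTot_rpow_le hr hN hk (by linarith) (by positivity) (by linarith)
    fun m _ => ?_
  rw [add_mul, one_mul, mul_div_assoc]
  refine add_le_add le_rfl ?_
  simp_rw [Real.rpow_add hq]
  rw [← mul_sum]
  refine (mul_le_mul_of_nonneg_left (sum_range_rpow_pos_le h1q hδ _)
    (Real.rpow_pos_of_pos hq _).le).trans ?_
  rw [mul_left_comm, ← Real.rpow_add hq]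
  refine mul_le_mul_of_nonneg_left (Real.rpow_le_rpow_of_exponent_le h1q.le ?_) hc.le
  have h2 : ((m / (r + 1) : ℕ) : ℝ) ≤ m / (r + 1) := by
    have := Nat.cast_div_le (α := ℝ) (m := m) (n := r + 1)
    push_cast at this
    exact this
  have h3 := mul_le_mul_of_nonneg_right h2 hδ.le
  have h4 : (m : ℝ) * (k - 1) + m / (r + 1) * (r + 1 - r * k) = m * (k / (r + 1)) := by
    field_simp; ring
  linarith

theorem expect_norm_expTot_rpow_le_of_eq {N r : ℕ} (hr : 2 ≤ r) (hN : N < n) (hN1 : 1 ≤ N)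
    {k : ℝ} (hk : k = 1 + 1 / (r : ℝ)) :
    𝔼 x : Fin n → F, ‖expTot r N x‖ ^ k ≤
      396 * (1 / (1 - (Nat.card F : ℝ) ^ (-(1 / (r : ℝ)) / 2))) ^ 2 *
        (N * (Nat.card F : ℝ) ^ ((N : ℝ) / r)) := by
  have h1q : (1 : ℝ) < Nat.card F := by exact_mod_cast one_lt_card (F := F)
  have hq := card_pos_real F
  have hr' : (2 : ℝ) ≤ r := by exact_mod_cast hr
  have hr0 : (0 : ℝ) < r := by linarith
  have h1r : 1 / (r : ℝ) ≤ 1 / 2 := one_div_le_one_div_of_le (by norm_num) hr'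
  have h1r0 : 0 < 1 / (r : ℝ) := by positivity
  have hN1' : (1 : ℝ) ≤ N := by exact_mod_cast hN1
  have h := expect_norm_expTot_rpow_le (F := F) hr hN (k := k) (γ := 1 / r) (D := 3 * N)
    (by linarith) (by linarith) h1r0 (by positivity) ?_
  · rw [mul_one_div] at h
    linarith
  · intro m hm
    have h2 : (m : ℝ) * k / (r + 1) = m * (1 / r) := by
      rw [hk]; field_simp
    have h3 : (r : ℝ) + 1 - r * k = 0 := by
      rw [hk]; field_simp; ring
    have h4 : k - 1 = 1 / r := by rw [hk]; ring
    simp_rw [h2, h3, h4, mul_zero, add_zero]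
    rw [sum_const, card_range, nsmul_eq_mul]
    have h5 : m / (r + 1) ≤ N := (Nat.div_le_self _ _).trans hm
    have h6 : ((m / (r + 1) : ℕ) : ℝ) ≤ N := by exact_mod_cast h5
    have h7 := Real.rpow_pos_of_pos hq ((m : ℝ) * (1 / r))
    push_cast at h6 ⊢
    nlinarith

theorem expect_norm_expTot_rpow_le_of_gt {N r : ℕ} (hr : 2 ≤ r) (hN : N < n) {k : ℝ}
    (hk : 1 + 1 / (r : ℝ) < k) (hk' : k ≤ 2) :
    𝔼 x : Fin n → F, ‖expTot r N x‖ ^ k ≤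
      132 * (1 + 1 / (1 - (Nat.card F : ℝ) ^ (r + 1 - r * k))) *
        (1 / (1 - (Nat.card F : ℝ) ^ (-(k - 1) / 2))) ^ 2 *
        (Nat.card F : ℝ) ^ (N * (k - 1)) := by
  have h1q : (1 : ℝ) < Nat.card F := by exact_mod_cast one_lt_card (F := F)
  have hq := card_pos_real F
  have hr' : (2 : ℝ) ≤ r := by exact_mod_cast hr
  have hr0 : (0 : ℝ) < r := by linarith
  have h1r0 : 0 < 1 / (r : ℝ) := by positivity
  have hδ : r + 1 - r * k < 0 := by
    have := mul_lt_mul_of_pos_left hk hr0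
    rw [mul_add, mul_one, mul_one_div_cancel hr0.ne'] at this
    linarith
  have hc : 0 < 1 / (1 - (Nat.card F : ℝ) ^ (r + 1 - r * k)) :=
    one_div_pos.mpr (sub_pos.mpr (Real.rpow_lt_one_of_one_lt_of_neg h1q (by linarith)))
  refine expect_norm_expTot_rpow_le hr hN (by linarith) hk' (by linarith) (by linarith)
    fun m _ => ?_
  rw [add_mul, one_mul]
  refine add_le_add (Real.rpow_le_rpow_of_exponent_le h1q.le ?_) ?_
  · rw [div_le_iff₀ (by linarith)]
    have : (0 : ℝ) ≤ m := Nat.cast_nonneg m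
    nlinarith
  · simp_rw [Real.rpow_add hq]
    rw [← mul_sum, mul_comm]
    exact mul_le_mul_of_nonneg_right (sum_range_rpow_neg_le h1q hδ _)
      (Real.rpow_pos_of_pos hq _).le

theorem card_monics_le (N : ℕ) : #(monics F N) ≤ 2 * Nat.card F ^ N := by
  have h := sum_monics F N (fun _ => 1)
  rw [sum_const, smul_eq_mul, mul_one] at h
  rw [h]
  simp_rw [sum_const, smul_eq_mul, mul_one, card_mon]
  simpa using sum_geom_le_two_mul (Nat.card F) 1 N one_lt_card le_rfl

/-- For `k ≥ 2` the trivial bound and Parseval's identity suffice. -/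
theorem expect_norm_expTot_rpow_le_of_two_le {N r : ℕ} (hN : N < n) {k : ℝ} (hk : 2 ≤ k) :
    𝔼 x : Fin n → F, ‖expTot r N x‖ ^ k ≤ 2 ^ (k - 1) * (Nat.card F : ℝ) ^ (N * (k - 1)) := by
  have hq := card_pos_real F
  have hc : (#(monics F N) : ℝ) ≤ 2 * (Nat.card F : ℝ) ^ N := by exact_mod_cast card_monics_le F N
  have h1 : ∀ x : Fin n → F, ‖expTot r N x‖ ≤ 2 * (Nat.card F : ℝ) ^ N := by
    intro x
    refine le_trans ?_ hc
    rw [expTot]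
    refine (norm_sum_le _ _).trans ?_
    refine (sum_le_card_nsmul _ _ 1 fun f _ => ?_).trans (by simp)
    rw [norm_mul, norm_chi, mul_one]
    exact norm_rFreeInd_le_one r f
  have h2 : 𝔼 x : Fin n → F, ‖expTot r N x‖ ^ 2 ≤ 2 * (Nat.card F : ℝ) ^ N := by
    simp_rw [expTot]
    rw [expect_norm_sq fun f hf => ?_]
    · refine le_trans ?_ hc
      refine (sum_le_card_nsmul _ _ 1 fun f _ => ?_).trans (by simp)
      exact pow_le_one₀ (norm_nonneg _) (norm_rFreeInd_le_one r f)
    · rw [mem_monics] at hf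
      rw [degree_eq_natDegree hf.1.ne_zero]
      exact_mod_cast hf.2.trans_lt hN
  have hB : 0 < 2 * (Nat.card F : ℝ) ^ N := by positivity
  calc _ ≤ 𝔼 x : Fin n → F, (2 * (Nat.card F : ℝ) ^ N) ^ (k - 2) * ‖expTot r N x‖ ^ 2 := by
        refine expect_le_expect fun x _ => ?_
        rcases (norm_nonneg (expTot r N x)).eq_or_lt with h0 | h0
        · rw [← h0, Real.zero_rpow (by linarith)]
          simp
        · have h3 : ‖expTot r N x‖ ^ k = ‖expTot r N x‖ ^ (k - 2) * ‖expTot r N x‖ ^ 2 := by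
            rw [← Real.rpow_natCast, ← Real.rpow_add h0]; congr 1; push_cast; ring
          rw [h3]
          gcongr
          · exact h1 x
    _ ≤ (2 * (Nat.card F : ℝ) ^ N) ^ (k - 2) * (2 * (Nat.card F : ℝ) ^ N) := by
        rw [← mul_expect]
        gcongr
    _ = (2 * (Nat.card F : ℝ) ^ N) ^ (k - 1) := by
        conv_lhs => rw [← Real.rpow_one (2 * (Nat.card F : ℝ) ^ N), ← Real.rpow_mul hB.le]
        rw [← Real.rpow_add hB]; congr 1; ring
    _ = _ := by
        rw [Real.mul_rpow (by norm_num) (by positivity), ← Real.rpow_natCast _ N,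
          ← Real.rpow_mul hq.le]

end Summation

/-! ### Fractions with exact denominator `d ^ r` -/

section Primitive
open Polynomial Finset
open scoped Classical BigOperators

theorem rFreeInd_eq_zero_of_pow_dvd {F : Type*} [Field F] {r : ℕ} {d f : F[X]} (hd : d.Monic)
    (hd1 : d ≠ 1)
    (h : d ^ r ∣ f) : rFreeInd r f = 0 := by
  rw [rFreeInd, if_neg]
  intro hf
  obtain ⟨P, -, hP, hPd⟩ := exists_monic_irreducible_factor d
    (fun hu => hd1 (hd.eq_one_of_isUnit hu))
  exact hf P hP ((pow_dvd_pow_of_dvd hPd r).trans h)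

variable {F : Type*} [Field F] [Fintype F] {n : ℕ}

/-- The `x` that are close to a fraction with denominator `d ^ r`, but not to one with denominator
`e ^ r` for a proper divisor `e` of `d`. -/
def annStar (n m r : ℕ) (d : F[X]) : Finset (Fin n → F) :=
  {x ∈ ann n m (d ^ r) | ∀ e : F[X], e.Monic → e ∣ d → x ∈ ann n m (e ^ r) → e = d}

theorem mem_annStar {m r : ℕ} {d : F[X]} {x : Fin n → F} : x ∈ annStar n m r d ↔
    x ∈ ann n m (d ^ r) ∧ ∀ e : F[X], e.Monic → e ∣ d → x ∈ ann n m (e ^ r) → e = d := by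
  simp [annStar]

theorem annStar_subset {m r : ℕ} {d : F[X]} : annStar n m r d ⊆ ann n m (d ^ r) :=
  filter_subset _ _

theorem mem_ann_cofactor {m r : ℕ} (hmn : m ≤ n) {G u v : F[X]} (hG : G.Monic) (hu : u.Monic)
    (hv : v.Monic) (huv : IsCoprime u v) (hm : r * (G * (u * v)).natDegree ≤ m) {x : Fin n → F}
    (h : x ∈ ann n m ((G * u) ^ r)) (h' : x ∈ ann n m ((G * v) ^ r)) : x ∈ ann n m (G ^ r) := by
  rw [hG.natDegree_mul (hu.mul hv), hu.natDegree_mul hv, mul_add, mul_add] at hm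
  rw [mul_pow] at h h'
  rw [← ann_inter_eq hmn (hG.pow r) (hu.pow r) (hv.pow r) huv.pow
    (by rw [(hG.pow r).natDegree_mul (hu.pow r), natDegree_pow, natDegree_pow]; omega)
    (by rw [(hG.pow r).natDegree_mul (hv.pow r), natDegree_pow, natDegree_pow]; omega)
    (by rw [natDegree_pow, natDegree_pow, natDegree_pow]; omega)]
  exact mem_inter.mpr ⟨h, h'⟩

theorem annStar_cofactor_eq {m r : ℕ} (hmn : m ≤ n) {G u v : F[X]} (hG : G.Monic) (hu : u.Monic)
    (hv : v.Monic) (huv : IsCoprime u v) (hm : r * (G * (u * v)).natDegree ≤ m) {x : Fin n → F}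
    (h : x ∈ annStar n m r (G * u)) (h' : x ∈ annStar n m r (G * v)) : G * u = G * v := by
  rw [mem_annStar] at h h'
  have hx := mem_ann_cofactor hmn hG hu hv huv hm h.1 h'.1
  rw [← h.2 G hG (dvd_mul_right _ _) hx, ← h'.2 G hG (dvd_mul_right _ _) hx]

/-- Denominators of small degree are determined by the tuple. -/
theorem annStar_unique {m r : ℕ} (hmn : m ≤ n) {d d' : F[X]} (hd : d.Monic) (hd' : d'.Monic)
    (hm : r * (d.natDegree + d'.natDegree) ≤ m) {x : Fin n → F}
    (h : x ∈ annStar n m r d) (h' : x ∈ annStar n m r d') : d = d' := by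
  obtain ⟨G, u, v, hG, hu, hv, huv, rfl, rfl⟩ := exists_coprime_cofactors hd hd'
  refine annStar_cofactor_eq hmn hG hu hv huv (le_trans (Nat.mul_le_mul_left r ?_) hm) h h'
  rw [hG.natDegree_mul (hu.mul hv), hu.natDegree_mul hv, hG.natDegree_mul hu, hG.natDegree_mul hv]
  omega

theorem annStar_unique_of_dvd {m r : ℕ} (hmn : m ≤ n) {d e e' : F[X]} (hd : d.Monic)
    (hm : r * d.natDegree ≤ m) (he : e.Monic) (he' : e'.Monic) (hed : e ∣ d) (hed' : e' ∣ d)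
    {x : Fin n → F} (h : x ∈ annStar n m r e) (h' : x ∈ annStar n m r e') : e = e' := by
  obtain ⟨G, u, v, hG, hu, hv, huv, rfl, rfl⟩ := exists_coprime_cofactors he he'
  refine annStar_cofactor_eq hmn hG hu hv huv (le_trans (Nat.mul_le_mul_left r ?_) hm) h h'
  exact natDegree_le_of_dvd ((mul_dvd_and_mul_dvd_iff hG.ne_zero huv).mp ⟨hed, hed'⟩) hd.ne_zero

theorem exists_mem_annStar {m r : ℕ} {d : F[X]} (hd : d.Monic) {x : Fin n → F}
    (hx : x ∈ ann n m (d ^ r)) : ∃ e : F[X], e.Monic ∧ e ∣ d ∧ x ∈ annStar n m r e := by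
  have hex : ∃ N, ∃ e : F[X], e.Monic ∧ e ∣ d ∧ x ∈ ann n m (e ^ r) ∧ e.natDegree = N :=
    ⟨_, d, hd, dvd_rfl, hx, rfl⟩
  obtain ⟨e, he, hed, hxe, hN⟩ := Nat.find_spec hex
  refine ⟨e, he, hed, mem_annStar.mpr ⟨hxe, fun e' he' hee' hx' => ?_⟩⟩
  have h1 := Nat.find_min' hex ⟨e', he', hee'.trans hed, hx', rfl⟩
  rw [← hN] at h1
  exact (eq_of_monic_of_dvd_of_natDegree_le he' he hee' h1).symm

/-- The phase of the exponential sum over the multiples of `d ^ r`. -/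
def phase (m r : ℕ) (d : F[X]) (x : Fin n → F) : ℂ :=
  chi x (d ^ r * X ^ (m - (d ^ r).natDegree))

theorem norm_phase (m r : ℕ) (d : F[X]) (x : Fin n → F) : ‖phase m r d x‖ = 1 := norm_chi _ _

theorem chi_eq_of_mem_ann {m : ℕ} {D : F[X]} {x : Fin n → F} (hx : x ∈ ann n m D) {f g : F[X]}
    (hf : f ∈ mon F m) (hg : g ∈ mon F m) (hDf : D ∣ f) (hDg : D ∣ g) : chi x f = chi x g := by
  rw [mem_mon] at hf hg
  have hd : (f - g).degree < m := by
    have h1 : f.degree = m := by rw [degree_eq_natDegree hf.1.ne_zero, hf.2]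
    have h2 : g.degree = m := by rw [degree_eq_natDegree hg.1.ne_zero, hg.2]
    rw [← h1]
    exact degree_sub_lt_left (h1.trans h2.symm) hf.1.ne_zero
      (hf.1.leadingCoeff.trans hg.1.leadingCoeff.symm)
  have h3 := mem_ann.mp hx (f - g) (dvd_sub hDf hDg) hd
  rw [← sub_add_cancel f g, AddChar.map_add_eq_mul, h3, one_mul]

theorem mul_X_pow_mem_mon {m : ℕ} {D : F[X]} (hD : D.Monic) (hm : D.natDegree ≤ m) :
    D * X ^ (m - D.natDegree) ∈ mon F m := by
  rw [mem_mon]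
  refine ⟨hD.mul (monic_X_pow _), ?_⟩
  rw [hD.natDegree_mul (monic_X_pow _), natDegree_X_pow]
  omega

theorem phase_eq_of_dvd {m r : ℕ} {d e : F[X]} (hd : d.Monic) (he : e.Monic) (hed : e ∣ d)
    (hm : r * d.natDegree ≤ m) {x : Fin n → F} (hx : x ∈ ann n m (e ^ r)) :
    phase m r e x = phase m r d x := by
  have h1 : (d ^ r).natDegree ≤ m := by rwa [natDegree_pow]
  have h2 : (e ^ r).natDegree ≤ m := by
    rw [natDegree_pow]
    exact (Nat.mul_le_mul_left r (natDegree_le_of_dvd hed hd.ne_zero)).trans hm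
  exact chi_eq_of_mem_ann hx (mul_X_pow_mem_mon (he.pow r) h2) (mul_X_pow_mem_mon (hd.pow r) h1)
    (dvd_mul_right _ _) ((pow_dvd_pow_of_dvd hed r).trans (dvd_mul_right _ _))

/-- Averaging the exponential sum over the fractions with denominator `d ^ r` selects the
multiples of `d ^ r`. -/
theorem expect_ann_expMon {m r : ℕ} (hmn : m < n) {d : F[X]} (hd : d.Monic)
    (hm : r * d.natDegree ≤ m) :
    (Nat.card F : ℂ) ^ (m - (d ^ r).natDegree) *
      𝔼 x : Fin n → F, (if x ∈ ann n m (d ^ r) then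
        expMon r m x * (starRingEnd ℂ) (phase m r d x) else 0) =
      ∑ f ∈ mon F m with d ^ r ∣ f, rFreeInd r f := by
  have hd' : (d ^ r).natDegree ≤ m := by rwa [natDegree_pow]
  have h1 : ∀ x : Fin n → F, (Nat.card F : ℂ) ^ (m - (d ^ r).natDegree) *
      (if x ∈ ann n m (d ^ r) then expMon r m x * (starRingEnd ℂ) (phase m r d x) else 0) =
      ∑ f ∈ mon F m, ∑ g ∈ mon F m with d ^ r ∣ g, rFreeInd r f * chi x (f - g) := by
    intro x
    have h2 := congrArg (fun z => expMon r m x * (starRingEnd ℂ) z) (sum_chi_mon (hd.pow r) hd' x)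
    have h3 : ∑ f ∈ mon F m, ∑ g ∈ mon F m with d ^ r ∣ g, rFreeInd r f * chi x (f - g) =
        expMon r m x * (starRingEnd ℂ) (∑ g ∈ mon F m with d ^ r ∣ g, chi x g) := by
      rw [map_sum, expMon, sum_mul_sum]
      refine sum_congr rfl fun f _ => sum_congr rfl fun g _ => ?_
      rw [sub_eq_add_neg, AddChar.map_add_eq_mul, AddChar.map_neg_eq_inv,
        Complex.inv_eq_conj (norm_chi x g)]
      ring
    rw [h3]
    refine Eq.trans ?_ h2.symm
    split_ifs
    · simp only [phase, map_mul, map_pow, Complex.conj_natCast]; ring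
    · simp
  rw [mul_expect]
  simp_rw [h1]
  rw [expect_sum_comm, sum_filter]
  refine sum_congr rfl fun f hf => ?_
  rw [expect_sum_comm]
  have hdeg : ∀ g ∈ mon F m, g.degree < n := by
    intro g hg
    rw [mem_mon] at hg
    rw [degree_eq_natDegree hg.1.ne_zero, hg.2]
    exact_mod_cast hmn
  have h4 : ∀ g ∈ {g ∈ mon F m | d ^ r ∣ g}, 𝔼 x : Fin n → F, rFreeInd r f * chi x (f - g) =
      if g = f then rFreeInd r f else 0 := by
    intro g hg
    rw [← mul_expect, expect_chi ((degree_sub_le _ _).trans_lt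
      (max_lt (hdeg f hf) (hdeg g (mem_filter.mp hg).1)))]
    by_cases h : g = f
    · simp [h]
    · simp [h, sub_eq_zero, Ne.symm h]
  rw [sum_congr rfl h4, sum_ite_eq']
  simp [hf]

/-- The integral of the exponential sum, with its phase removed, over the fractions with exact
denominator `d ^ r`. -/
def primitiveMean (n m r : ℕ) (d : F[X]) : ℂ :=
  𝔼 x : Fin n → F, if x ∈ annStar n m r d then
    expMon r m x * (starRingEnd ℂ) (phase m r d x) else 0

theorem sum_primitiveMean {m r : ℕ} (hmn : m < n) (hr : 1 ≤ r) {d : F[X]} (hd : d.Monic)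
    (hm : r * d.natDegree ≤ m) :
    ∑ e ∈ monics F m with e ∣ d, primitiveMean n m r e =
      𝔼 x : Fin n → F, if x ∈ ann n m (d ^ r) then
        expMon r m x * (starRingEnd ℂ) (phase m r d x) else 0 := by
  simp_rw [primitiveMean]
  rw [← expect_sum_comm]
  refine expect_congr rfl fun x _ => ?_
  split_ifs with hx
  · obtain ⟨e, he, hed, hxe⟩ := exists_mem_annStar hd hx
    have hem : e ∈ {e ∈ monics F m | e ∣ d} := by
      refine mem_filter.mpr ⟨mem_monics.mpr ⟨he, ?_⟩, hed⟩
      have := natDegree_le_of_dvd hed hd.ne_zero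
      nlinarith
    rw [sum_eq_single_of_mem e hem, if_pos hxe, phase_eq_of_dvd hd he hed hm (annStar_subset hxe)]
    intro e' he' hne
    rw [mem_filter, mem_monics] at he'
    exact if_neg fun hxe' => hne (annStar_unique_of_dvd hmn.le hd hm he'.1.1 he he'.2 hed hxe' hxe)
  · refine sum_eq_zero fun e he => if_neg fun hxe => hx ?_
    exact ann_subset_of_dvd (pow_dvd_pow_of_dvd (mem_filter.mp he).2 r) (annStar_subset hxe)

theorem primitiveMean_eq {m r : ℕ} (hmn : m < n) (hr : 1 ≤ r) {d : F[X]} (hd : d.Monic)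
    (hm : r * d.natDegree ≤ m) :
    primitiveMean n m r d = moeb d * primitiveMean n m r (1 : F[X]) := by
  induction hN : d.natDegree using Nat.strong_induction_on generalizing d with
  | _ N ih =>
    subst hN
    by_cases hd1 : d = 1
    · rw [hd1, moeb_one, Int.cast_one, one_mul]
    have hdm : d.natDegree ≤ m := by nlinarith
    have h1 : ∑ e ∈ monics F m with e ∣ d, primitiveMean n m r e = 0 := by
      rw [sum_primitiveMean hmn hr hd hm]
      have h2 := expect_ann_expMon hmn hd hm
      rw [sum_eq_zero fun f hf => rFreeInd_eq_zero_of_pow_dvd hd hd1 (mem_filter.mp hf).2] at h2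
      refine (mul_eq_zero.mp h2).resolve_left (pow_ne_zero _ ?_)
      exact_mod_cast Nat.card_pos.ne'
    have h3 : ∑ e ∈ monics F m with e ∣ d, (moeb e : ℂ) = 0 := by
      have := sum_moeb_dvd hd hdm
      rw [if_neg hd1] at this
      exact_mod_cast this
    have hmem : d ∈ {e ∈ monics F m | e ∣ d} :=
      mem_filter.mpr ⟨mem_monics.mpr ⟨hd, hdm⟩, dvd_rfl⟩
    rw [← add_sum_erase _ _ hmem] at h1 h3
    have h4 : ∑ e ∈ {e ∈ monics F m | e ∣ d}.erase d, primitiveMean n m r e =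
        (∑ e ∈ {e ∈ monics F m | e ∣ d}.erase d, (moeb e : ℂ)) * primitiveMean n m r (1 : F[X]) := by
      rw [sum_mul]
      refine sum_congr rfl fun e he => ?_
      rw [mem_erase, mem_filter, mem_monics] at he
      have h5 : e.natDegree < d.natDegree := by
        by_contra hlt
        exact he.1 (eq_of_monic_of_dvd_of_natDegree_le he.2.1.1 hd he.2.2 (not_lt.mp hlt)).symm
      exact ih _ h5 he.2.1.1 ((Nat.mul_le_mul_left r h5.le).trans hm) rfl
    rw [h4] at h1
    linear_combination h1 - primitiveMean n m r (1 : F[X]) * h3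

theorem annStar_one (n m r : ℕ) : annStar n m r (1 : F[X]) = ann n m 1 := by
  ext x
  rw [mem_annStar, one_pow]
  refine ⟨fun h => h.1, fun h => ⟨h, fun e he hed _ => he.eq_one_of_isUnit (isUnit_of_dvd_one hed)⟩⟩

theorem sum_rFreeInd (r m : ℕ) :
    ∑ f ∈ mon F m, rFreeInd r f = (#{f ∈ mon F m | IsRFree r f} : ℂ) := by
  rw [card_filter]
  push_cast
  rfl

theorem half_le_norm_primitiveMean {m r : ℕ} (hmn : m < n) (hr : 2 ≤ r) {d : F[X]}
    (hd : d.Monic) (hsq : Squarefree d) (hm : r * d.natDegree ≤ m) :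
    1 / 2 ≤ ‖primitiveMean n m r d‖ := by
  have h1 : ‖(moeb d : ℂ)‖ = 1 := by
    rw [Complex.norm_intCast]; exact_mod_cast abs_moeb_of_squarefree hsq
  rw [primitiveMean_eq hmn (by omega) hd hm, norm_mul, h1, one_mul]
  have h2 := expect_ann_expMon (r := r) hmn (monic_one (R := F)) (by simp)
  have h3 : primitiveMean n m r (1 : F[X]) = 𝔼 x : Fin n → F, if x ∈ ann n m ((1 : F[X]) ^ r) then
      expMon r m x * (starRingEnd ℂ) (phase m r 1 x) else 0 := by
    rw [primitiveMean, annStar_one]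
    simp only [one_pow]
  rw [← h3] at h2
  simp only [one_pow, one_dvd, filter_true, natDegree_one, Nat.sub_zero] at h2
  rw [sum_rFreeInd] at h2
  have h4 := congrArg norm h2
  rw [norm_mul, norm_pow, Complex.norm_natCast, Complex.norm_natCast] at h4
  have h5 : (Nat.card F : ℝ) ^ m ≤ 2 * (#{f ∈ mon F m | IsRFree r f} : ℝ) := by
    exact_mod_cast card_pow_le_two_mul_card_isRFree F r m hr
  have hq : (0 : ℝ) < (Nat.card F : ℝ) ^ m := pow_pos (card_pos_real F) m
  rw [← h4] at h5
  by_contra hlt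
  push Not at hlt
  nlinarith

/-- For every squarefree `d`, the exponential sum is large on average over the fractions with
exact denominator `d ^ r`. -/
theorem half_le_expect_annStar {m r : ℕ} (hmn : m < n) (hr : 2 ≤ r) {d : F[X]}
    (hd : d.Monic) (hsq : Squarefree d) (hm : r * d.natDegree ≤ m) :
    1 / 2 ≤ 𝔼 x : Fin n → F, if x ∈ annStar n m r d then ‖expMon r m x‖ else 0 := by
  refine (half_le_norm_primitiveMean hmn hr hd hsq hm).trans ?_
  rw [primitiveMean, Fintype.expect_eq_sum_div_card, Fintype.expect_eq_sum_div_card, norm_div,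
    Complex.norm_natCast]
  refine div_le_div_of_nonneg_right ((norm_sum_le _ _).trans (le_of_eq ?_)) (Nat.cast_nonneg _)
  refine sum_congr rfl fun x _ => ?_
  split_ifs
  · rw [norm_mul, RCLike.norm_conj, norm_phase, mul_one]
  · simp

end Primitive

/-! ### Lower bounds at and above the critical exponent -/

section LowerBound
open Polynomial Finset
open scoped Classical BigOperators

variable {F : Type*} [Field F] [Fintype F] {n : ℕ}

theorem norm_expMon_of_mem_ann_one {m r : ℕ} {x : Fin n → F} (hx : x ∈ ann n m (1 : F[X])) :
    ‖expMon r m x‖ = #{f ∈ mon F m | IsRFree r f} := by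
  have h1 : expMon r m x = (∑ f ∈ mon F m, rFreeInd r f) * chi x (X ^ m) := by
    rw [expMon, sum_mul]
    refine sum_congr rfl fun f hf => ?_
    rw [chi_eq_of_mem_ann hx hf (mem_mon.mpr ⟨monic_X_pow m, natDegree_X_pow m⟩) (one_dvd _)
      (one_dvd _)]
  rw [h1, norm_mul, norm_chi, mul_one, sum_rFreeInd, Complex.norm_natCast]

/-- The contribution of the neighbourhood of `0`. -/
theorem rpow_le_expect_near_zero {m r : ℕ} (hmn : m < n) (hr : 2 ≤ r) {k : ℝ} (hk : 0 ≤ k) :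
    (Nat.card F : ℝ) ^ (-(m : ℝ)) * max 1 ((Nat.card F : ℝ) ^ m / 2) ^ k ≤
      𝔼 x : Fin n → F, ‖expMon r m x‖ ^ k := by
  have hq := card_pos_real F
  have h1 : max 1 ((Nat.card F : ℝ) ^ m / 2) ≤ (#{f ∈ mon F m | IsRFree r f} : ℝ) := by
    have h2 := card_pow_le_two_mul_card_isRFree F r m hr
    have h3 : 0 < Nat.card F ^ m := pow_pos Nat.card_pos m
    refine max_le ?_ ?_
    · have : 1 ≤ #{f ∈ mon F m | IsRFree r f} := by omega
      exact_mod_cast this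
    · rw [div_le_iff₀ (by norm_num), mul_comm]
      exact_mod_cast h2
  have h2 := prob_ann hmn.le (monic_one (R := F)) (by simp)
  rw [natDegree_one, Nat.cast_zero, zero_sub] at h2
  rw [← h2, ← expect_mem_eq_prob, expect_mul]
  refine expect_le_expect fun x _ => ?_
  split_ifs with hx
  · rw [one_mul, norm_expMon_of_mem_ann_one hx]
    exact Real.rpow_le_rpow (le_max_of_le_left zero_le_one) h1 hk
  · rw [zero_mul]
    exact Real.rpow_nonneg (norm_nonneg _) _

/-- Hölder's inequality on an event, in the form needed at the critical exponent. -/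
theorem mul_rpow_le_expect {ι : Type*} [Fintype ι] {U : ι → ℝ} (hU : ∀ x, 0 ≤ U x)
    {E : Finset ι} [DecidablePred (· ∈ E)] {k t a : ℝ} (hk : 1 ≤ k) (ht : 0 < t)
    (ha : 2 * a ≤ 𝔼 x, if x ∈ E then U x else 0) (hE : t * prob E ≤ a) :
    a * t ^ (k - 1) ≤ 𝔼 x, if x ∈ E then U x ^ k else 0 := by
  have h1 : ∀ u : ℝ, 0 ≤ u → t ^ (k - 1) * (u - t) ≤ u ^ k := by
    intro u hu
    rcases le_total u t with h | h
    · exact (mul_nonpos_of_nonneg_of_nonpos (Real.rpow_pos_of_pos ht _).le (by linarith)).trans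
        (Real.rpow_nonneg hu _)
    · have hu' := ht.trans_le h
      have h2 : u ^ k = u ^ (k - 1) * u := by
        conv_rhs => rw [← Real.rpow_one u, ← Real.rpow_mul hu, one_mul]
        rw [← Real.rpow_add hu']; congr 1; ring
      rw [h2]
      have h3 := Real.rpow_le_rpow ht.le h (by linarith : 0 ≤ k - 1)
      have h4 := Real.rpow_pos_of_pos ht (k - 1)
      nlinarith
  have h2 : 𝔼 x, t ^ (k - 1) * ((if x ∈ E then U x else 0) - t * if x ∈ E then 1 else 0) ≤
      𝔼 x, if x ∈ E then U x ^ k else 0 := by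
    refine expect_le_expect fun x _ => ?_
    split_ifs
    · rw [mul_one]; exact h1 _ (hU x)
    · simp
  rw [← mul_expect, expect_sub_distrib, ← mul_expect, expect_mem_eq_prob] at h2
  have h4 := Real.rpow_pos_of_pos ht (k - 1)
  nlinarith

/-- The contribution of the fractions with exact denominator `d ^ r`. -/
theorem rpow_le_expect_annStar {m r j : ℕ} (hmn : m < n) (hr : 2 ≤ r) (hj : r * j ≤ m) {d : F[X]}
    (hd : d ∈ mon F j) (hsq : Squarefree d) {k : ℝ} (hk : 1 ≤ k) :
    1 / 4 * ((Nat.card F : ℝ) ^ ((m : ℝ) - r * j) / 4) ^ (k - 1) ≤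
      𝔼 x : Fin n → F, if x ∈ annStar n m r d then ‖expMon r m x‖ ^ k else 0 := by
  have hq := card_pos_real F
  rw [mem_mon] at hd
  refine mul_rpow_le_expect (fun x => norm_nonneg _) hk (by positivity) ?_ ?_
  · have := half_le_expect_annStar hmn hr hd.1 hsq (by rwa [hd.2])
    linarith
  · have h1 := prob_ann hmn.le (hd.1.pow r) (by rw [natDegree_pow, hd.2]; exact hj)
    rw [natDegree_pow, hd.2] at h1
    calc _ ≤ (Nat.card F : ℝ) ^ ((m : ℝ) - r * j) / 4 *
          (Nat.card F : ℝ) ^ (((r * j : ℕ) : ℝ) - m) := by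
          rw [← h1]
          exact mul_le_mul_of_nonneg_left (prob_mono annStar_subset) (by positivity)
      _ = 1 / 4 := by
          rw [div_mul_eq_mul_div, ← Real.rpow_add hq]
          push_cast
          rw [sub_add_sub_cancel, sub_self, Real.rpow_zero]

/-- The critical exponent: all degrees `j ≤ m / (2 r)` contribute equally, and the fractions
involved are distinct. -/
theorem le_expect_expMon_of_eq {m r : ℕ} (hmn : m < n) (hr : 2 ≤ r) {k : ℝ}
    (hk : k = 1 + 1 / (r : ℝ)) :
    1 / (8 * 4 ^ (k - 1)) * (((m / (2 * r) : ℕ) + 1) * (Nat.card F : ℝ) ^ ((m : ℝ) / r)) ≤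
      𝔼 x : Fin n → F, ‖expMon r m x‖ ^ k := by
  have hq := card_pos_real F
  have hr' : (2 : ℝ) ≤ r := by exact_mod_cast hr
  have hk1 : 0 ≤ 1 / (r : ℝ) := by positivity
  set K := m / (2 * r) with hK
  set s : Finset F[X] := {d ∈ monics F K | Squarefree d} with hs
  have hKm : 2 * (r * K) ≤ m := by
    have := Nat.div_mul_le_self m (2 * r)
    rw [← hK] at this
    linarith
  have h1 : ∀ x : Fin n → F, ∑ d ∈ s, (if x ∈ annStar n m r d then ‖expMon r m x‖ ^ k else 0) ≤
      ‖expMon r m x‖ ^ k := by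
    intro x
    by_cases hx : ∃ d ∈ s, x ∈ annStar n m r d
    · obtain ⟨d, hd, hxd⟩ := hx
      rw [sum_eq_single_of_mem d hd, if_pos hxd]
      intro e he hne
      refine if_neg fun hxe => hne ?_
      rw [hs, mem_filter, mem_monics] at hd he
      exact annStar_unique hmn.le he.1.1 hd.1.1 (by nlinarith) hxe hxd
    · push Not at hx
      rw [sum_eq_zero fun d hd => if_neg (hx d hd)]
      exact Real.rpow_nonneg (norm_nonneg _) _
  calc _ = ∑ j ∈ range (K + 1), (Nat.card F : ℝ) ^ (j : ℝ) / 2 *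
          (1 / 4 * ((Nat.card F : ℝ) ^ ((m : ℝ) - r * j) / 4) ^ (k - 1)) := by
        have h2 : ∀ j : ℕ, (Nat.card F : ℝ) ^ (j : ℝ) / 2 *
            (1 / 4 * ((Nat.card F : ℝ) ^ ((m : ℝ) - r * j) / 4) ^ (k - 1)) =
            1 / (8 * 4 ^ (k - 1)) * (Nat.card F : ℝ) ^ ((m : ℝ) / r) := by
          intro j
          have h3 : (m : ℝ) / r = j + (m - r * j) * (k - 1) := by
            rw [hk]; field_simp; ring
          rw [Real.div_rpow (Real.rpow_pos_of_pos hq _).le (by norm_num), ← Real.rpow_mul hq.le,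
            h3, Real.rpow_add hq]
          have : (0 : ℝ) < 4 ^ (k - 1) := by positivity
          field_simp
          norm_num
        simp_rw [h2]
        rw [sum_const, card_range, nsmul_eq_mul]
        push_cast
        ring
    _ ≤ ∑ j ∈ range (K + 1), ∑ d ∈ mon F j with Squarefree d,
          𝔼 x : Fin n → F, (if x ∈ annStar n m r d then ‖expMon r m x‖ ^ k else 0) := by
        refine sum_le_sum fun j hj => ?_
        rw [mem_range] at hj
        have h4 := card_nsmul_le_sum {d ∈ mon F j | Squarefree d} _ _ fun d hd =>
          rpow_le_expect_annStar hmn hr (j := j) (by nlinarith) (mem_filter.mp hd).1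
            (mem_filter.mp hd).2 (k := k) (by linarith)
        refine le_trans ?_ h4
        rw [nsmul_eq_mul]
        refine mul_le_mul_of_nonneg_right ?_ (by positivity)
        rw [div_le_iff₀ (by norm_num), mul_comm, Real.rpow_natCast]
        exact_mod_cast card_pow_le_two_mul_card_squarefree F j
    _ = 𝔼 x : Fin n → F, ∑ d ∈ s,
          (if x ∈ annStar n m r d then ‖expMon r m x‖ ^ k else 0) := by
        rw [expect_sum_comm, hs, sum_filter, sum_monics]
        simp_rw [sum_filter]
    _ ≤ _ := expect_le_expect fun x _ => h1 x

/-- The number of squarefree monic `d` of degree `j` for which `x` is close to a fraction with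
exact denominator `d ^ r`. -/
def nuStar (m r j : ℕ) (x : Fin n → F) : ℝ :=
  ∑ d ∈ mon F j with Squarefree d, if x ∈ annStar n m r d then 1 else 0

theorem nuStar_nonneg (m r j : ℕ) (x : Fin n → F) : 0 ≤ nuStar m r j x :=
  sum_nonneg fun d _ => by split_ifs <;> norm_num

theorem nuStar_le_nu (m r j : ℕ) (x : Fin n → F) : nuStar m r j x ≤ nu m r j x := by
  rw [nuStar, nu, sum_filter]
  refine sum_le_sum fun d _ => ?_
  by_cases h : x ∈ annStar n m r d
  · rw [if_pos h, if_pos (annStar_subset h)]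
    split_ifs <;> norm_num
  · rw [if_neg h, ite_self]
    split_ifs <;> norm_num

theorem le_expect_nuStar_mul {m r j : ℕ} (hmn : m < n) (hr : 2 ≤ r) (hj : r * j ≤ m) :
    (Nat.card F : ℝ) ^ (j : ℝ) / 4 ≤ 𝔼 x : Fin n → F, nuStar m r j x * ‖expMon r m x‖ := by
  simp_rw [nuStar, sum_mul]
  rw [expect_sum_comm]
  have h1 := card_nsmul_le_sum {d ∈ mon F j | Squarefree d}
    (fun d => 𝔼 x : Fin n → F, (if x ∈ annStar n m r d then 1 else 0) * ‖expMon r m x‖) (1 / 2)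
    fun d hd => by
      rw [mem_filter, mem_mon] at hd
      have := half_le_expect_annStar hmn hr hd.1.1 hd.2 (by rwa [hd.1.2])
      simpa only [ite_mul, one_mul, zero_mul] using this
  refine le_trans ?_ h1
  have h2 : (Nat.card F : ℝ) ^ j ≤ 2 * (#{d ∈ mon F j | Squarefree d} : ℝ) := by
    exact_mod_cast card_pow_le_two_mul_card_squarefree F j
  rw [nsmul_eq_mul, Real.rpow_natCast]
  linarith

/-- The number of pairs `(d, d')` of degrees `j` and `i` with `d ∤ d'`, for which `x` is close both
to a fraction with exact denominator `d ^ r` and to a fraction with denominator `d' ^ r`. -/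
def coincidences (m r i j : ℕ) (x : Fin n → F) : ℝ :=
  ∑ d ∈ mon F j, ∑ d' ∈ mon F i with ¬ d ∣ d',
    if x ∈ annStar n m r d ∩ ann n m (d' ^ r) then 1 else 0

theorem coincidences_nonneg (m r i j : ℕ) (x : Fin n → F) : 0 ≤ coincidences m r i j x :=
  sum_nonneg fun d _ => sum_nonneg fun d' _ => by split_ifs <;> norm_num

theorem expect_coincidences_le {m r i j : ℕ} (hmn : m ≤ n) (hi : r * i ≤ m)
    (hj : r * j ≤ m) :
    𝔼 x : Fin n → F, coincidences m r i j x ≤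
      (Nat.card F : ℝ) ^ (((r : ℝ) + 1) * (i + j) - 2 * m) := by
  have hq := card_pos_real F
  simp_rw [coincidences]
  rw [expect_sum_comm]
  simp_rw [expect_sum_comm]
  have h1 : ∀ d ∈ mon F j, ∀ d' ∈ {d' ∈ mon F i | ¬ d ∣ d'},
      (𝔼 x : Fin n → F, if x ∈ annStar n m r d ∩ ann n m (d' ^ r) then (1 : ℝ) else 0) ≤
        (Nat.card F : ℝ) ^ ((r : ℝ) * (i + j) - 2 * m) := by
    intro d hd d' hd'
    rw [mem_filter] at hd'
    have hdm := mem_mon.mp hd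
    have hdm' := mem_mon.mp hd'.1
    obtain ⟨G, u, v, hG, hu, hv, huv, rfl, rfl⟩ := exists_coprime_cofactors hdm.1 hdm'.1
    have h1 : ((G * u) ^ r).natDegree = r * j := by rw [natDegree_pow, hdm.2]
    have h2 : ((G * v) ^ r).natDegree = r * i := by rw [natDegree_pow, hdm'.2]
    rw [mul_pow] at h1 h2
    have h3 := prob_ann_inter_sdiff_le hmn (hG.pow r) (hu.pow r) (hv.pow r) huv.pow
      (by omega) (by omega)
    rw [h1, h2, ← mul_pow, ← mul_pow] at h3
    rw [expect_mem_eq_prob]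
    refine (prob_mono ?_).trans (h3.trans (le_of_eq ?_))
    · intro x hx
      rw [mem_inter] at hx
      rw [mem_sdiff, mem_inter]
      refine ⟨⟨annStar_subset hx.1, hx.2⟩, fun hxG => hd'.2 ?_⟩
      rw [← (mem_annStar.mp hx.1).2 G hG (dvd_mul_right _ _) hxG]
      exact dvd_mul_right _ _
    · congr 1; push_cast; ring
  calc _ ≤ ∑ d ∈ mon F j, ∑ d' ∈ mon F i with ¬ d ∣ d',
          (Nat.card F : ℝ) ^ ((r : ℝ) * (i + j) - 2 * m) :=
        sum_le_sum fun d hd => sum_le_sum fun d' hd' => h1 d hd d' hd'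
    _ ≤ ∑ d ∈ mon F j, ∑ d' ∈ mon F i, (Nat.card F : ℝ) ^ ((r : ℝ) * (i + j) - 2 * m) :=
        sum_le_sum fun d _ => sum_le_sum_of_subset_of_nonneg (filter_subset _ _)
          fun _ _ _ => (Real.rpow_pos_of_pos hq _).le
    _ = _ := by
        rw [sum_mon_const, sum_mon_const, ← Real.rpow_add hq, ← Real.rpow_add hq]
        congr 1
        ring

/-- Apart from coincidences, the fractions with denominator `d' ^ r` near one with exact
denominator `d ^ r` come from the multiples `d'` of `d`. -/
theorem nuStar_mul_nu_le (m r i j : ℕ) (x : Fin n → F) :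
    nuStar m r j x * nu m r i x ≤
      (if j ≤ i then (Nat.card F : ℝ) ^ ((i : ℝ) - j) else 0) * nuStar m r j x +
        coincidences m r i j x := by
  have hq := card_pos_real F
  have h1 : coincidences m r i j x ≥ ∑ d ∈ mon F j with Squarefree d,
      ∑ d' ∈ mon F i with ¬ d ∣ d',
        if x ∈ annStar n m r d ∩ ann n m (d' ^ r) then (1 : ℝ) else 0 :=
    sum_le_sum_of_subset_of_nonneg (filter_subset _ _) fun d _ _ =>
      sum_nonneg fun d' _ => by split_ifs <;> norm_num
  refine le_trans ?_ (add_le_add_right h1 _)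
  rw [nuStar, sum_mul, mul_sum, ← sum_add_distrib]
  refine sum_le_sum fun d hd => ?_
  rw [mem_filter, mem_mon] at hd
  by_cases hx : x ∈ annStar n m r d
  · rw [if_pos hx, one_mul, mul_one, nu, ← sum_filter_add_sum_filter_not (mon F i) (d ∣ ·)]
    refine add_le_add ?_ (sum_le_sum fun d' _ => ?_)
    · have h2 : ∑ d' ∈ mon F i with d ∣ d', (if x ∈ ann n m (d' ^ r) then (1 : ℝ) else 0) ≤
          #{d' ∈ mon F i | d ∣ d'} := by
        refine (sum_le_card_nsmul _ _ 1 fun d' _ => ?_).trans (by simp)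
        split_ifs <;> norm_num
      refine h2.trans ?_
      split_ifs with hij
      · rw [card_filter_dvd_mon hd.1.1 (by omega), hd.1.2, cast_pow_sub _ hij]
      · rw [filter_dvd_mon_eq_empty (by omega)]; simp
    · simp [mem_inter, hx]
  · rw [if_neg hx, zero_mul, mul_zero, zero_add]
    exact sum_nonneg fun d' _ => by split_ifs <;> norm_num

theorem min_sq_le_mul_rpow {u B k : ℝ} (hu : 0 ≤ u) (hB : 0 < B) (hk : 0 ≤ k) (hk' : k ≤ 2) :
    min u B ^ 2 ≤ B ^ (2 - k) * u ^ k := by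
  rcases hu.eq_or_lt with h0 | h0
  · rw [← h0, min_eq_left hB.le]
    have := Real.rpow_nonneg (le_refl (0 : ℝ)) k
    have := Real.rpow_nonneg hB.le (2 - k)
    nlinarith
  · have hm : 0 < min u B := lt_min h0 hB
    calc min u B ^ 2 = min u B ^ (2 - k) * min u B ^ k := by
          rw [← Real.rpow_natCast, ← Real.rpow_add hm]; congr 1; push_cast; ring
      _ ≤ _ := mul_le_mul (Real.rpow_le_rpow hm.le (min_le_right _ _) (by linarith))
          (Real.rpow_le_rpow hm.le (min_le_left _ _) hk) (Real.rpow_nonneg hm.le _)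
          (Real.rpow_nonneg hB.le _)

variable (F) in
theorem sum_range_rpow_le (J : ℕ) :
    ∑ i ∈ range J, (Nat.card F : ℝ) ^ (i : ℝ) ≤ (Nat.card F : ℝ) ^ (J : ℝ) := by
  have h2 : (2 : ℝ) ≤ Nat.card F := by exact_mod_cast one_lt_card (F := F)
  simp_rw [Real.rpow_natCast]
  induction J with
  | zero => simp
  | succ J ih =>
    rw [sum_range_succ, pow_succ]
    have := pow_pos (card_pos_real F) J
    nlinarith

end LowerBound

/-! ### The lower bound below the critical exponent -/

section Subcritical
open Polynomial Finset
open scoped Classical BigOperators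

variable {F : Type*} [Field F] [Fintype F] {n : ℕ}

variable (F) in
theorem card_rpow_neg_le {s t : ℝ} (hs : 0 ≤ t) (hst : t ≤ s) :
    (Nat.card F : ℝ) ^ (-s) ≤ (2 : ℝ) ^ (-t) := by
  have h2 : (2 : ℝ) ≤ Nat.card F := by exact_mod_cast one_lt_card (F := F)
  calc (Nat.card F : ℝ) ^ (-s) ≤ (Nat.card F : ℝ) ^ (-t) :=
        Real.rpow_le_rpow_of_exponent_le (by linarith) (by linarith)
    _ ≤ _ := Real.rpow_le_rpow_of_nonpos (by norm_num) h2 (by linarith)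

/-- The error made by replacing the exponential sum near a fraction with exact denominator `d ^ r`,
`deg d = j`, by the contribution of the multiples of `d`: coincidences, and large divisors. -/
def nearError (m r j J : ℕ) (x : Fin n → F) : ℝ :=
  ∑ i ∈ range J, (Nat.card F : ℝ) ^ ((m : ℝ) - r * i) * coincidences m r i j x +
    nuStar m r j x * ‖highPart r m J x‖

theorem nuStar_mul_norm_le {m r j J : ℕ} (hr : 2 ≤ r) (hjJ : j ≤ J) (hJ : J ≤ m / r + 1)
    (x : Fin n → F) :
    nuStar m r j x * ‖expMon r m x‖ ≤
      4 * (Nat.card F : ℝ) ^ ((m : ℝ) - r * j) * nuStar m r j x + nearError m r j J x := by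
  have hq := card_pos_real F
  have hr' : (2 : ℝ) ≤ r := by exact_mod_cast hr
  have h3 := norm_expMon_sub_highPart_le (by omega) hJ x
  have h4 : ‖expMon r m x‖ ≤ ‖expMon r m x - highPart r m J x‖ + ‖highPart r m J x‖ := by
    simpa using norm_add_le (expMon r m x - highPart r m J x) (highPart r m J x)
  have h5 : ∑ i ∈ range J, (Nat.card F : ℝ) ^ ((m : ℝ) - r * i) *
      (if j ≤ i then (Nat.card F : ℝ) ^ ((i : ℝ) - j) else 0) ≤
      4 * (Nat.card F : ℝ) ^ ((m : ℝ) - r * j) := by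
    rw [← sum_range_add_sum_Ico _ hjJ, sum_eq_zero fun i hi => by
      rw [mem_range] at hi
      rw [if_neg (by omega), mul_zero], zero_add]
    calc _ = ∑ i ∈ Ico j J, (Nat.card F : ℝ) ^ ((m : ℝ) - j) *
          ((Nat.card F : ℝ) ^ (-(2 * ((r : ℝ) - 1)) / 2)) ^ i := by
          refine sum_congr rfl fun i hi => ?_
          rw [if_pos (mem_Ico.mp hi).1, ← Real.rpow_natCast, ← Real.rpow_mul hq.le,
            ← Real.rpow_add hq, ← Real.rpow_add hq]
          congr 1; ring
      _ ≤ (Nat.card F : ℝ) ^ ((m : ℝ) - j) *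
          (4 * ((Nat.card F : ℝ) ^ (-(2 * ((r : ℝ) - 1)) / 2)) ^ j) := by
          rw [← mul_sum]
          exact mul_le_mul_of_nonneg_left (sum_Ico_pow_le (Real.rpow_pos_of_pos hq _).le
            (card_rpow_neg_half_le F (by linarith)) _ _) (Real.rpow_pos_of_pos hq _).le
      _ = _ := by
          rw [← Real.rpow_natCast, ← Real.rpow_mul hq.le, mul_left_comm, ← Real.rpow_add hq]
          congr 2; ring
  calc nuStar m r j x * ‖expMon r m x‖
      ≤ nuStar m r j x * (∑ i ∈ range J, (Nat.card F : ℝ) ^ ((m : ℝ) - r * i) * nu m r i x +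
          ‖highPart r m J x‖) :=
        mul_le_mul_of_nonneg_left (h4.trans (add_le_add_left h3 _)) (nuStar_nonneg _ _ _ _)
    _ = ∑ i ∈ range J, (Nat.card F : ℝ) ^ ((m : ℝ) - r * i) * (nuStar m r j x * nu m r i x) +
          nuStar m r j x * ‖highPart r m J x‖ := by
        rw [mul_add, mul_sum]
        simp_rw [mul_left_comm]
    _ ≤ ∑ i ∈ range J, (Nat.card F : ℝ) ^ ((m : ℝ) - r * i) *
          ((if j ≤ i then (Nat.card F : ℝ) ^ ((i : ℝ) - j) else 0) * nuStar m r j x +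
          coincidences m r i j x) + nuStar m r j x * ‖highPart r m J x‖ := by
        gcongr with i _
        exact nuStar_mul_nu_le m r i j x
    _ = (∑ i ∈ range J, (Nat.card F : ℝ) ^ ((m : ℝ) - r * i) *
          (if j ≤ i then (Nat.card F : ℝ) ^ ((i : ℝ) - j) else 0)) * nuStar m r j x +
          nearError m r j J x := by
        rw [nearError]
        simp_rw [mul_add, sum_add_distrib, sum_mul, mul_assoc]
        ring
    _ ≤ _ := by
        gcongr
        exact nuStar_nonneg _ _ _ _

theorem expect_nuStar_sq_le {m r j : ℕ} (hr : 2 ≤ r) (hmn : m ≤ n) (hj : (r + 1) * j ≤ m) :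
    𝔼 x : Fin n → F, nuStar m r j x ^ 2 ≤ 3 * (Nat.card F : ℝ) ^ (((r : ℝ) + 1) * j - m) := by
  have h1 := expect_nu_mul_nu_le_three (F := F) hr hmn hj hj
  rw [min_self, show (j : ℝ) + j + (r - 1) * j - m = (r + 1) * j - m by ring] at h1
  refine le_trans (expect_le_expect fun x _ => ?_) h1
  rw [← sq]
  exact pow_le_pow_left₀ (nuStar_nonneg _ _ _ _) (nuStar_le_nu _ _ _ _) 2

/-- With `17` further degrees of divisors, and a margin of `22` in the size of `m`, the error is
at most a quarter of the main term of `le_expect_nuStar_mul`. -/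
theorem expect_nearError_le {m r j : ℕ} (hr : 2 ≤ r) (hmn : m < n) (hj : (r + 1) * j + 22 ≤ m)
    (hj' : 17 * r ≤ j) :
    𝔼 x : Fin n → F, nearError m r j (j + 17) x ≤ (Nat.card F : ℝ) ^ (j : ℝ) / 16 := by
  have hq := card_pos_real F
  have hr' : (2 : ℝ) ≤ r := by exact_mod_cast hr
  have hjm : ((r : ℝ) + 1) * j + 22 ≤ m := by exact_mod_cast hj
  have hqj : 0 < (Nat.card F : ℝ) ^ (j : ℝ) := Real.rpow_pos_of_pos hq _
  have h1 : 𝔼 x : Fin n → F, ∑ i ∈ range (j + 17),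
      (Nat.card F : ℝ) ^ ((m : ℝ) - r * i) * coincidences m r i j x ≤
      (Nat.card F : ℝ) ^ (j : ℝ) / 32 := by
    rw [expect_sum_comm]
    calc _ ≤ ∑ i ∈ range (j + 17), (Nat.card F : ℝ) ^ (((r : ℝ) + 1) * j - m) *
          (Nat.card F : ℝ) ^ (i : ℝ) := by
          refine sum_le_sum fun i hi => ?_
          rw [mem_range] at hi
          rw [← mul_expect]
          refine (mul_le_mul_of_nonneg_left (expect_coincidences_le hmn.le (by nlinarith)
            (by nlinarith)) (Real.rpow_pos_of_pos hq _).le).trans (le_of_eq ?_)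
          rw [← Real.rpow_add hq, ← Real.rpow_add hq]
          congr 1; ring
      _ ≤ (Nat.card F : ℝ) ^ (((r : ℝ) + 1) * j - m) *
          (Nat.card F : ℝ) ^ ((j + 17 : ℕ) : ℝ) := by
          rw [← mul_sum]
          exact mul_le_mul_of_nonneg_left (sum_range_rpow_le F _) (Real.rpow_pos_of_pos hq _).le
      _ = (Nat.card F : ℝ) ^ (j : ℝ) * (Nat.card F : ℝ) ^ (-((m : ℝ) - (r + 1) * j - 17)) := by
          rw [← Real.rpow_add hq, ← Real.rpow_add hq]
          congr 1; push_cast; ring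
      _ ≤ (Nat.card F : ℝ) ^ (j : ℝ) * (2 : ℝ) ^ (-(5 : ℝ)) :=
          mul_le_mul_of_nonneg_left (card_rpow_neg_le F (by norm_num) (by linarith)) hqj.le
      _ = _ := by
          rw [Real.rpow_neg (by norm_num)]; norm_num; ring
  have h2 : 𝔼 x : Fin n → F, nuStar m r j x * ‖highPart r m (j + 17) x‖ ≤
      (Nat.card F : ℝ) ^ (j : ℝ) / 32 := by
    refine (pow_le_pow_iff_left₀ (expect_nonneg fun x _ => mul_nonneg (nuStar_nonneg _ _ _ _)
      (norm_nonneg _)) (by positivity) two_ne_zero).mp ?_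
    refine (expect_mul_sq_le_sq_mul_sq _ _ _).trans ?_
    calc _ ≤ 3 * (Nat.card F : ℝ) ^ (((r : ℝ) + 1) * j - m) *
          (32 * (Nat.card F : ℝ) ^ ((m : ℝ) - (r - 1) * (j + 17 : ℕ))) :=
          mul_le_mul (expect_nuStar_sq_le hr hmn.le (by omega)) (expect_norm_highPart_sq_le hr hmn)
            (expect_nonneg fun x _ => sq_nonneg _) (by positivity)
      _ = 96 * ((Nat.card F : ℝ) ^ (j : ℝ)) ^ 2 * (Nat.card F : ℝ) ^ (-(17 * ((r : ℝ) - 1))) := by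
          rw [← Real.rpow_natCast _ 2, ← Real.rpow_mul hq.le, mul_mul_mul_comm, mul_assoc (96 : ℝ),
            ← Real.rpow_add hq, ← Real.rpow_add hq]
          congr 1
          · norm_num
          · congr 1; push_cast; ring
      _ ≤ 96 * ((Nat.card F : ℝ) ^ (j : ℝ)) ^ 2 * (2 : ℝ) ^ (-(17 : ℝ)) :=
          mul_le_mul_of_nonneg_left (card_rpow_neg_le F (by norm_num) (by linarith))
            (by positivity)
      _ ≤ _ := by
          have : (2 : ℝ) ^ (-(17 : ℝ)) = 1 / 131072 := by
            rw [Real.rpow_neg (by norm_num)]; norm_num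
          rw [this]
          nlinarith [sq_nonneg ((Nat.card F : ℝ) ^ (j : ℝ))]
  simp_rw [nearError]
  rw [expect_add_distrib]
  linarith

/-- The lower bound below the critical exponent, in terms of a degree `j` slightly smaller than
`m / (r + 1)`. -/
theorem le_mul_expect_expMon {m r j : ℕ} (hr : 2 ≤ r) (hmn : m < n) (hj : (r + 1) * j + 22 ≤ m)
    (hj' : 17 * r ≤ j) {k : ℝ} (hk : 0 ≤ k) (hk' : k ≤ 2) :
    (Nat.card F : ℝ) ^ (2 * (j : ℝ)) ≤ 192 * ((8 * (Nat.card F : ℝ) ^ ((m : ℝ) - r * j)) ^ (2 - k) *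
      𝔼 x : Fin n → F, ‖expMon r m x‖ ^ k) := by
  have hq := card_pos_real F
  have h1q : (1 : ℝ) ≤ Nat.card F := by exact_mod_cast one_lt_card.le
  have hqj : 0 < (Nat.card F : ℝ) ^ (j : ℝ) := Real.rpow_pos_of_pos hq _
  have hjm : ((r : ℝ) + 1) * j + 22 ≤ m := by exact_mod_cast hj
  set B : ℝ := 8 * (Nat.card F : ℝ) ^ ((m : ℝ) - r * j) with hB
  have hB0 : 0 < B := by positivity
  have hJ : j + 17 ≤ m / r + 1 := by
    have : j + 17 ≤ m / r := (Nat.le_div_iff_mul_le (by omega)).mpr (by nlinarith)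
    omega
  have h1 : ∀ x : Fin n → F, nuStar m r j x * ‖expMon r m x‖ ≤
      nuStar m r j x * min ‖expMon r m x‖ B + 2 * nearError m r j (j + 17) x := by
    intro x
    have h2 := nuStar_mul_norm_le hr (Nat.le_add_right j 17) hJ x
    have h3 := nuStar_nonneg m r j x
    have h4 : 0 ≤ nearError m r j (j + 17) x :=
      add_nonneg (sum_nonneg fun i _ => mul_nonneg (by positivity) (coincidences_nonneg _ _ _ _ _))
        (mul_nonneg h3 (norm_nonneg _))
    rcases le_total ‖expMon r m x‖ B with h | h
    · rw [min_eq_left h]; linarith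
    · rw [min_eq_right h]
      have h5 := mul_le_mul_of_nonneg_left h h3
      nlinarith
  have h2 : (Nat.card F : ℝ) ^ (j : ℝ) / 8 ≤
      𝔼 x : Fin n → F, nuStar m r j x * min ‖expMon r m x‖ B := by
    have h3 := le_expect_nuStar_mul (F := F) hmn hr (j := j) (by nlinarith)
    have h4 : 𝔼 x : Fin n → F, nuStar m r j x * ‖expMon r m x‖ ≤
        𝔼 x : Fin n → F, (nuStar m r j x * min ‖expMon r m x‖ B +
          2 * nearError m r j (j + 17) x) := expect_le_expect fun x _ => h1 x
    rw [expect_add_distrib, ← mul_expect] at h4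
    have h5 := expect_nearError_le (F := F) hr hmn hj hj'
    linarith
  have h3 : ((Nat.card F : ℝ) ^ (j : ℝ) / 8) ^ 2 ≤
      3 * (B ^ (2 - k) * 𝔼 x : Fin n → F, ‖expMon r m x‖ ^ k) := by
    refine (pow_le_pow_left₀ (by positivity) h2 2).trans ?_
    refine (expect_mul_sq_le_sq_mul_sq _ _ _).trans ?_
    refine mul_le_mul ?_ ?_ (expect_nonneg fun x _ => sq_nonneg _) (by norm_num)
    · refine (expect_nuStar_sq_le hr hmn.le (by omega)).trans ?_
      have : (Nat.card F : ℝ) ^ (((r : ℝ) + 1) * j - m) ≤ 1 :=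
        Real.rpow_le_one_of_one_le_of_nonpos h1q (by linarith)
      linarith
    · rw [mul_expect]
      exact expect_le_expect fun x _ => min_sq_le_mul_rpow (norm_nonneg _) hB0 hk hk'
  have h4 : (Nat.card F : ℝ) ^ (2 * (j : ℝ)) = 64 * ((Nat.card F : ℝ) ^ (j : ℝ) / 8) ^ 2 := by
    rw [mul_comm, Real.rpow_mul hq.le]
    norm_num
    ring
  rw [h4]
  linarith

/-- The lower bound below the critical exponent. -/
theorem le_expect_expMon_of_lt {m r : ℕ} (hr : 2 ≤ r) (hmn : m < n) {k : ℝ} (hk : 0 ≤ k)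
    (hk' : k ≤ 2) :
    1 / 12288 * (Nat.card F : ℝ) ^ (-(3 * (17 * r + 23) * ((r : ℝ) + 1))) *
      (Nat.card F : ℝ) ^ (m * k / (r + 1)) ≤ 𝔼 x : Fin n → F, ‖expMon r m x‖ ^ k := by
  have hq := card_pos_real F
  have h1q : (1 : ℝ) ≤ Nat.card F := by exact_mod_cast one_lt_card.le
  have hr' : (2 : ℝ) ≤ r := by exact_mod_cast hr
  have hm0 : (0 : ℝ) ≤ m := Nat.cast_nonneg m
  have hkr : (m : ℝ) * k / (r + 1) = k * (m / (r + 1)) := by ring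
  have hy0 : 0 ≤ (m : ℝ) / (r + 1) := by positivity
  set y : ℝ := (m : ℝ) / (r + 1) with hy
  have hym : m = y * (r + 1) := by rw [hy]; field_simp
  rcases lt_or_ge m ((17 * r + 23) * (r + 1)) with hm | hm
  · -- For small `m` the neighbourhood of `0` suffices.
    have h1 := rpow_le_expect_near_zero (F := F) hmn hr hk
    have h2 : (1 : ℝ) ≤ max 1 ((Nat.card F : ℝ) ^ m / 2) ^ k :=
      Real.one_le_rpow (le_max_left _ _) hk
    have h3 : (Nat.card F : ℝ) ^ (-(3 * (17 * r + 23) * ((r : ℝ) + 1))) *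
        (Nat.card F : ℝ) ^ (m * k / (r + 1)) ≤ (Nat.card F : ℝ) ^ (-(m : ℝ)) := by
      rw [← Real.rpow_add hq]
      refine Real.rpow_le_rpow_of_exponent_le h1q ?_
      have h4 : (m : ℝ) < (17 * r + 23) * (r + 1) := by exact_mod_cast hm
      have h5 : k * y ≤ 2 * y := mul_le_mul_of_nonneg_right hk' hy0
      rw [hkr]
      nlinarith
    have h4 := Real.rpow_pos_of_pos hq (-(m : ℝ))
    have h5 : 0 < (Nat.card F : ℝ) ^ (-(3 * (17 * r + 23) * ((r : ℝ) + 1))) *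
        (Nat.card F : ℝ) ^ (m * k / (r + 1)) := by positivity
    nlinarith
  · set j := m / (r + 1) - 22 with hj
    have hdiv : 17 * r + 23 ≤ m / (r + 1) := (Nat.le_div_iff_mul_le (by omega)).mpr hm
    have hdm := Nat.div_mul_le_self m (r + 1)
    have hlt := Nat.lt_div_mul_add (a := m) (b := r + 1) (by omega)
    have hj1 : m / (r + 1) = j + 22 := by omega
    rw [hj1] at hdm hlt
    have hjm : (j : ℝ) ≤ y := by
      rw [hy, le_div_iff₀ (by linarith)]
      have : j * (r + 1) ≤ m := by nlinarith
      exact_mod_cast this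
    have hjm' : y - 23 ≤ j := by
      rw [hy, sub_le_iff_le_add, div_le_iff₀ (by linarith)]
      have : m ≤ (j + 23) * (r + 1) := by nlinarith
      exact_mod_cast this
    have h1 := le_mul_expect_expMon (F := F) hr hmn (j := j) (by nlinarith) (by omega) hk hk'
    set E := 𝔼 x : Fin n → F, ‖expMon r m x‖ ^ k with hE
    have hE0 : 0 ≤ E := expect_nonneg fun x _ => Real.rpow_nonneg (norm_nonneg _) _
    have h2 : (8 * (Nat.card F : ℝ) ^ ((m : ℝ) - r * j)) ^ (2 - k) ≤
        64 * (Nat.card F : ℝ) ^ ((2 - k) * y + 46 * r) := by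
      rw [Real.mul_rpow (by norm_num) (Real.rpow_pos_of_pos hq _).le, ← Real.rpow_mul hq.le]
      refine mul_le_mul ?_ (Real.rpow_le_rpow_of_exponent_le h1q ?_)
        (Real.rpow_pos_of_pos hq _).le (by norm_num)
      · calc (8 : ℝ) ^ (2 - k) ≤ 8 ^ (2 : ℝ) :=
              Real.rpow_le_rpow_of_exponent_le (by norm_num) (by linarith)
          _ = 64 := by norm_num
      · have h3 : (m : ℝ) - r * j ≤ y + 23 * r := by nlinarith
        have h4 := mul_le_mul_of_nonneg_right h3 (by linarith : 0 ≤ 2 - k)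
        nlinarith
    have h3 : (Nat.card F : ℝ) ^ (2 * (j : ℝ)) ≤
        12288 * ((Nat.card F : ℝ) ^ ((2 - k) * y + 46 * r) * E) := by
      refine h1.trans ?_
      have := mul_le_mul_of_nonneg_right h2 hE0
      linarith
    have h4 : (Nat.card F : ℝ) ^ (-(3 * (17 * r + 23) * ((r : ℝ) + 1))) *
        (Nat.card F : ℝ) ^ (m * k / (r + 1)) * (Nat.card F : ℝ) ^ ((2 - k) * y + 46 * r) ≤
        (Nat.card F : ℝ) ^ (2 * (j : ℝ)) := by
      rw [← Real.rpow_add hq, ← Real.rpow_add hq]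
      refine Real.rpow_le_rpow_of_exponent_le h1q ?_
      rw [hkr]
      nlinarith
    have h5 := Real.rpow_pos_of_pos hq ((2 - k) * y + 46 * r)
    have h6 := h4.trans h3
    rw [mul_left_comm, mul_comm _ ((Nat.card F : ℝ) ^ ((2 - k) * y + 46 * r))] at h6
    have h7 := le_of_mul_le_mul_left h6 h5
    linarith

/-- The part of top degree is an average of translates of the whole exponential sum. -/
theorem sum_expTot_add_single (r N : ℕ) (x : Fin (N + 1) → F) :
    ∑ c : F, eAddChar F (-c) * expTot r N (x + Pi.single (Fin.last N) c) =
      Nat.card F * expMon r N x := by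
  have hprim : (eAddChar F).IsPrimitive := by
    refine AddChar.IsPrimitive.of_ne_one ?_
    obtain ⟨c, hc⟩ := exists_eAddChar_ne_one (F := F)
    exact AddChar.ne_one_iff.mpr ⟨c, hc⟩
  have h1 : ∀ (c : F) (f : F[X]), chi (x + Pi.single (Fin.last N) c) f =
      chi x f * eAddChar F (c * f.coeff N) := by
    intro c f
    rw [chi_apply, chi_apply, ← AddChar.map_add_eq_mul]
    congr 1
    simp only [Pi.add_apply, mul_add, sum_add_distrib]
    congr 1
    rw [Finset.sum_eq_single (Fin.last N)]
    · simp [mul_comm]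
    · intro b _ hb; simp [hb]
    · simp
  simp_rw [expTot, mul_sum]
  rw [sum_comm, expMon, mul_sum]
  rw [mon, sum_filter]
  refine sum_congr rfl fun f hf => ?_
  have h2 : ∀ c : F, eAddChar F (-c) * (rFreeInd r f * chi (x + Pi.single (Fin.last N) c) f) =
      rFreeInd r f * chi x f * eAddChar F (c * (f.coeff N - 1)) := by
    intro c
    rw [h1, mul_sub, mul_one, sub_eq_add_neg, AddChar.map_add_eq_mul]
    ring
  simp_rw [h2]
  rw [← mul_sum, AddChar.sum_mulShift _ hprim]
  have h3 : f.coeff N - 1 = 0 ↔ f.natDegree = N := by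
    rw [mem_monics] at hf
    rw [sub_eq_zero]
    constructor
    · intro h
      refine le_antisymm hf.2 (le_natDegree_of_ne_zero (by rw [h]; exact one_ne_zero))
    · rintro rfl
      exact hf.1.coeff_natDegree
  by_cases h : f.natDegree = N
  · rw [if_pos (h3.mpr h), if_pos h, Nat.card_eq_fintype_card]; ring
  · rw [if_neg (fun h' => h (h3.mp h')), if_neg h]; simp

theorem expect_add_right {G : Type*} [AddGroup G] [Fintype G] (a : G) (f : G → ℝ) :
    𝔼 x, f (x + a) = 𝔼 x, f x :=
  Fintype.expect_equiv (Equiv.addRight a) _ _ fun _ => rfl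

theorem expect_expMon_le_mul_expect_expTot (r N : ℕ) {k : ℝ} (hk : 0 ≤ k) :
    𝔼 x : Fin (N + 1) → F, ‖expMon r N x‖ ^ k ≤
      Nat.card F * 𝔼 x : Fin (N + 1) → F, ‖expTot r N x‖ ^ k := by
  have hq := card_pos_real F
  have h1 : ∀ x : Fin (N + 1) → F, ‖expMon r N x‖ ^ k ≤
      ∑ c : F, ‖expTot r N (x + Pi.single (Fin.last N) c)‖ ^ k := by
    intro x
    have h2 : ∑ _c : F, ‖expMon r N x‖ ≤ ∑ c : F, ‖expTot r N (x + Pi.single (Fin.last N) c)‖ := by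
      have h3 := congrArg norm (sum_expTot_add_single r N x)
      rw [norm_mul, Complex.norm_natCast] at h3
      rw [sum_const, card_univ, nsmul_eq_mul, ← Nat.card_eq_fintype_card, ← h3]
      refine (norm_sum_le _ _).trans (le_of_eq (sum_congr rfl fun c _ => ?_))
      rw [norm_mul, AddChar.norm_apply, one_mul]
    obtain ⟨c, -, hc⟩ := exists_le_of_sum_le univ_nonempty h2
    refine (Real.rpow_le_rpow (norm_nonneg _) hc hk).trans ?_
    exact single_le_sum (f := fun c => ‖expTot r N (x + Pi.single (Fin.last N) c)‖ ^ k)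
      (fun c _ => Real.rpow_nonneg (norm_nonneg _) _) (mem_univ c)
  refine (expect_le_expect fun x _ => h1 x).trans (le_of_eq ?_)
  rw [expect_sum_comm]
  have h2 : ∀ c : F, 𝔼 x : Fin (N + 1) → F, ‖expTot r N (x + Pi.single (Fin.last N) c)‖ ^ k =
      𝔼 x : Fin (N + 1) → F, ‖expTot r N x‖ ^ k := fun c =>
    expect_add_right _ fun x => ‖expTot r N x‖ ^ k
  rw [sum_congr rfl fun c _ => h2 c, sum_const, card_univ, nsmul_eq_mul,
    Nat.card_eq_fintype_card]

end Subcritical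

/-! ### From the Haar integral to finite averages -/

section Haar
open Polynomial Finset MeasureTheory
open scoped Classical BigOperators

theorem coeff_ofPoly_mul {F : Type*} [Field F] (f : F[X]) (α : F⸨X⸩) :
    (ofPoly f * α).coeff 1 = ∑ i ∈ range (f.natDegree + 1), f.coeff i * α.coeff (i + 1) := by
  have h1 : ∀ i : ℕ, (tElt F) ^ i = HahnSeries.single (-(i : ℤ)) (1 : F) := by
    intro i
    rw [tElt, HahnSeries.single_pow, one_pow]
    simp
  rw [ofPoly, eval₂_eq_sum_range, sum_mul, HahnSeries.coeff_sum]
  refine sum_congr rfl fun i _ => ?_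
  have h2 := HahnSeries.coeff_single_mul_add (r := f.coeff i) (x := α) (a := i + 1)
    (b := -(i : ℤ))
  rw [add_neg_cancel_comm] at h2
  rw [h1, HahnSeries.C_apply, HahnSeries.single_mul_single, zero_add, mul_one, h2]

/-- The first `n` coefficients of an element of the torus. -/
def trunc {F : Type*} [Field F] (n : ℕ) (α : F⸨X⸩) (i : Fin n) : F := α.coeff (i + 1)

variable {F : Type*} [Field F]

theorem eChar_ofPoly_mul [Fintype F] {N : ℕ} {f : F[X]} (hf : f.natDegree ≤ N) (α : F⸨X⸩) :
    eChar (ofPoly f * α) = chi (trunc (N + 1) α) f := by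
  rw [eChar, coeff_ofPoly_mul, chi_apply, ← eAddChar_apply]
  congr 1
  rw [sum_subset (range_subset_range.mpr (Nat.succ_le_succ hf))]
  · exact sum_range fun i => f.coeff i * α.coeff (i + 1)
  · intro i _ hi
    rw [mem_range] at hi
    rw [coeff_eq_zero_of_natDegree_lt (by omega), zero_mul]

theorem expSum_eq_expTot [Fintype F] (r N : ℕ) (α : F⸨X⸩) :
    expSum r N α = expTot r N (trunc (N + 1) α) := by
  rw [expSum, expTot]
  exact sum_congr rfl fun f hf => by rw [eChar_ofPoly_mul (mem_monics.mp hf).2]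

/-- The elements of the torus whose first `n` coefficients are given. -/
def cylinder (n : ℕ) (x : Fin n → F) : Set F⸨X⸩ := {α ∈ torus F | trunc n α = x}

theorem isOpen_cylinder_zero (n : ℕ) : IsOpen (cylinder n (0 : Fin n → F)) := by
  have h : cylinder n (0 : Fin n → F) =
      (fun α : F⸨X⸩ => HahnSeries.single (-(n : ℤ)) (1 : F) * α) ⁻¹' torus F := by
    ext α
    have h1 : ∀ j : ℤ, (HahnSeries.single (-(n : ℤ)) (1 : F) * α).coeff j = α.coeff (j + n) := by
      intro j
      have := HahnSeries.coeff_single_mul_add (r := (1 : F)) (x := α) (a := j + n) (b := -(n : ℤ))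
      rwa [one_mul, add_neg_cancel_right] at this
    simp only [cylinder, torus, Set.mem_ofPred_eq, Set.mem_preimage, h1, funext_iff, trunc,
      Pi.zero_apply]
    constructor
    · rintro ⟨h2, h3⟩ j hj
      by_cases hj' : j + n ≤ 0
      · exact h2 _ hj'
      · have := h3 ⟨(j + n - 1).toNat, by omega⟩
        rwa [show (((j + n - 1).toNat : ℕ) : ℤ) + 1 = j + n by omega] at this
    · intro h2
      refine ⟨fun j hj => ?_, fun i => ?_⟩
      · have := h2 (j - n) (by omega)
        rwa [sub_add_cancel] at this
      · have := h2 (i + 1 - n) (by omega)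
        rwa [sub_add_cancel] at this
  rw [h]
  exact (isOpen_torus F).preimage (continuous_const_mul _)

theorem exists_trunc_eq (n : ℕ) (x : Fin n → F) : ∃ β ∈ torus F, trunc n β = x := by
  refine ⟨ofCoeffs F fun i => if h : i < n then x ⟨i, h⟩ else 0,
    coeff_ofCoeffs_nonpos F _, funext fun i => ?_⟩
  rw [trunc, coeff_ofCoeffs_succ]
  simp

theorem cylinder_eq_preimage (n : ℕ) (x : Fin n → F) :
    ∃ β : F⸨X⸩, cylinder n x = (fun α => β + α) ⁻¹' cylinder n 0 := by
  obtain ⟨β, hβ, hβx⟩ := exists_trunc_eq n x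
  refine ⟨-β, ?_⟩
  ext α
  simp only [cylinder, torus, Set.mem_ofPred_eq, Set.mem_preimage, ← hβx, funext_iff, trunc,
    HahnSeries.coeff_add, HahnSeries.coeff_neg, Pi.zero_apply]
  refine and_congr (forall₂_congr fun j hj => ?_) (forall_congr' fun i => ?_)
  · rw [hβ j hj, neg_zero, zero_add]
  · rw [neg_add_eq_zero, eq_comm]

theorem measurableSet_cylinder (n : ℕ) (x : Fin n → F) : MeasurableSet (cylinder n x) := by
  obtain ⟨β, hβ⟩ := cylinder_eq_preimage n x
  rw [hβ]
  exact ((isOpen_cylinder_zero n).preimage (continuous_const_add β)).measurableSet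

theorem torus_eq_iUnion (n : ℕ) : torus F = ⋃ x : Fin n → F, cylinder n x := by
  ext α
  simp [cylinder]

theorem pairwise_disjoint_cylinder (n : ℕ) :
    Pairwise (Function.onFun Disjoint (cylinder (F := F) n)) := by
  intro x y hxy
  rw [Function.onFun, Set.disjoint_left]
  intro α hα hα'
  exact hxy (hα.2.symm.trans hα'.2)

variable [Fintype F]

theorem haar_torus : haar F (torus F) = 1 :=
  Measure.addHaarMeasure_self (K₀ := torusCompacts F)

instance : (haar F).IsAddHaarMeasure :=
  Measure.isAddHaarMeasure_addHaarMeasure (torusCompacts F)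

theorem haar_real_cylinder (n : ℕ) (x : Fin n → F) :
    (haar F).real (cylinder n x) = (Fintype.card (Fin n → F) : ℝ)⁻¹ := by
  have h1 : ∀ y : Fin n → F, haar F (cylinder n y) = haar F (cylinder n 0) := by
    intro y
    obtain ⟨β, hβ⟩ := cylinder_eq_preimage n y
    rw [hβ, measure_preimage_add]
  have h2 : ∑ y : Fin n → F, haar F (cylinder n y) = 1 := by
    rw [← haar_torus (F := F), torus_eq_iUnion n, measure_iUnion (pairwise_disjoint_cylinder n)
      (measurableSet_cylinder n), tsum_fintype]
  rw [sum_congr rfl fun y _ => h1 y, sum_const, card_univ, nsmul_eq_mul] at h2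
  rw [measureReal_def, h1]
  have h3 := congrArg ENNReal.toReal h2
  rw [ENNReal.toReal_mul, ENNReal.toReal_natCast, ENNReal.toReal_one] at h3
  exact eq_inv_of_mul_eq_one_right h3

/-- The Haar integral of a function of the first `n` coefficients is a finite average. -/
theorem setIntegral_torus_trunc (n : ℕ) (φ : (Fin n → F) → ℝ) :
    ∫ α in torus F, φ (trunc n α) ∂(haar F) = 𝔼 x : Fin n → F, φ x := by
  have h1 : ∀ x : Fin n → F, Set.EqOn (fun α => φ (trunc n α)) (fun _ => φ x) (cylinder n x) :=
    fun x α hα => by simp only [hα.2]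
  have hfin : ∀ x : Fin n → F, haar F (cylinder n x) ≠ ⊤ := fun x => by
    have h2 : haar F (cylinder n x) ≤ haar F (torus F) := measure_mono fun α hα => hα.1
    rw [haar_torus] at h2
    exact (h2.trans_lt ENNReal.one_lt_top).ne
  rw [torus_eq_iUnion n, integral_iUnion_fintype (measurableSet_cylinder n)
    (pairwise_disjoint_cylinder n) fun x =>
      (integrableOn_const (hfin x)).congr_fun (h1 x).symm (measurableSet_cylinder n x),
    Fintype.expect_eq_sum_div_card, div_eq_inv_mul, mul_sum]
  refine sum_congr rfl fun x _ => ?_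
  rw [setIntegral_congr_fun (measurableSet_cylinder n x) (h1 x), setIntegral_const,
    haar_real_cylinder, smul_eq_mul]

theorem moment_eq_expect (r N : ℕ) (k : ℝ) :
    moment F r N k = 𝔼 x : Fin (N + 1) → F, ‖expTot r N x‖ ^ k := by
  rw [← setIntegral_torus_trunc (N + 1) fun x => ‖expTot r N x‖ ^ k, moment]
  simp_rw [expSum_eq_expTot]

end Haar

/-! ### The bounds for the moments -/

section Bounds
open Polynomial Finset
open scoped Classical BigOperators

variable (F : Type*) [Field F] [Fintype F]

theorem inv_card_mul_le_moment {r N : ℕ} {k b : ℝ} (hk : 0 ≤ k)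
    (h : b ≤ 𝔼 x : Fin (N + 1) → F, ‖expMon r N x‖ ^ k) :
    (Nat.card F : ℝ)⁻¹ * b ≤ moment F r N k := by
  have hq := card_pos_real F
  rw [moment_eq_expect, inv_mul_le_iff₀ hq]
  exact h.trans (expect_expMon_le_mul_expect_expTot r N hk)

theorem le_moment_of_lt {r N : ℕ} (hr : 2 ≤ r) {k : ℝ} (hk : 0 ≤ k) (hk' : k ≤ 2) :
    (Nat.card F : ℝ)⁻¹ * (1 / 12288 * (Nat.card F : ℝ) ^ (-(3 * (17 * r + 23) * ((r : ℝ) + 1)))) *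
      (Nat.card F : ℝ) ^ (N * k / (r + 1)) ≤ moment F r N k := by
  have h := inv_card_mul_le_moment F hk (le_expect_expMon_of_lt hr (Nat.lt_succ_self N) hk hk')
  rwa [← mul_assoc] at h

theorem le_moment_of_eq {r N : ℕ} (hr : 2 ≤ r) {k : ℝ} (hk : k = 1 + 1 / (r : ℝ)) :
    (Nat.card F : ℝ)⁻¹ * (1 / (8 * 4 ^ (k - 1))) / (2 * r) *
      (N * (Nat.card F : ℝ) ^ ((N : ℝ) / r)) ≤ moment F r N k := by
  have hr' : (2 : ℝ) ≤ r := by exact_mod_cast hr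
  have hk0 : 0 ≤ k := by rw [hk]; positivity
  have hq := card_pos_real F
  have h := inv_card_mul_le_moment F hk0 (le_expect_expMon_of_eq (Nat.lt_succ_self N) hr hk)
  refine le_trans ?_ h
  have h1 : (N : ℝ) / (2 * r) ≤ ((N / (2 * r) : ℕ) : ℝ) + 1 := by
    have := Nat.lt_floor_add_one ((N : ℝ) / (2 * r))
    rw [← Nat.floor_div_eq_div (K := ℝ)]
    push_cast
    exact this.le
  calc _ = (Nat.card F : ℝ)⁻¹ * (1 / (8 * 4 ^ (k - 1)) *
        ((N / (2 * r)) * (Nat.card F : ℝ) ^ ((N : ℝ) / r))) := by ring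
    _ ≤ _ := by gcongr

theorem le_moment_of_gt {r N : ℕ} (hr : 2 ≤ r) {k : ℝ} (hk : 0 ≤ k) :
    (Nat.card F : ℝ)⁻¹ * (1 / 2 ^ k) * (Nat.card F : ℝ) ^ (N * (k - 1)) ≤ moment F r N k := by
  have hq := card_pos_real F
  have h := inv_card_mul_le_moment F hk (rpow_le_expect_near_zero (Nat.lt_succ_self N) hr hk)
  refine le_trans ?_ h
  rw [mul_assoc]
  refine mul_le_mul_of_nonneg_left ?_ (by positivity)
  have h1 : ((Nat.card F : ℝ) ^ N / 2) ^ k ≤ max 1 ((Nat.card F : ℝ) ^ N / 2) ^ k :=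
    Real.rpow_le_rpow (by positivity) (le_max_right _ _) hk
  refine le_trans (le_of_eq ?_) (mul_le_mul_of_nonneg_left h1 (by positivity))
  rw [Real.div_rpow (by positivity) (by norm_num), ← Real.rpow_natCast, ← Real.rpow_mul hq.le,
    mul_div_assoc', ← Real.rpow_add hq, show -(N : ℝ) + N * k = N * (k - 1) by ring]
  ring

theorem one_div_one_sub_rpow_pos {Q s : ℝ} (hQ : 1 < Q) (hs : s < 0) : 0 < 1 / (1 - Q ^ s) :=
  one_div_pos.mpr (sub_pos.mpr (Real.rpow_lt_one_of_one_lt_of_neg hQ hs))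

end Bounds

end RFreeMoments

end

theorem theorem1 (q r : ℕ) (hr : 2 ≤ r) (k : ℝ) (hk : 0 ≤ k) :
    ∃ c C : ℝ, 0 < c ∧ 0 < C ∧
      ∀ (F : Type*) [Field F] [Finite F], Nat.card F = q → ∀ N : ℕ,
        (k < 1 + 1 / (r : ℝ) →
          c * (q : ℝ) ^ ((N : ℝ) * k / ((r : ℝ) + 1)) ≤ RFreeMoments.moment F r N k ∧
          RFreeMoments.moment F r N k ≤ C * (q : ℝ) ^ ((N : ℝ) * k / ((r : ℝ) + 1))) ∧
        (k = 1 + 1 / (r : ℝ) → 1 ≤ N →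
          c * ((N : ℝ) * (q : ℝ) ^ ((N : ℝ) / (r : ℝ))) ≤ RFreeMoments.moment F r N k ∧
          RFreeMoments.moment F r N k ≤ C * ((N : ℝ) * (q : ℝ) ^ ((N : ℝ) / (r : ℝ)))) ∧
        (1 + 1 / (r : ℝ) < k →
          c * (q : ℝ) ^ ((N : ℝ) * (k - 1)) ≤ RFreeMoments.moment F r N k ∧
          RFreeMoments.moment F r N k ≤ C * (q : ℝ) ^ ((N : ℝ) * (k - 1))) := by
  have hr' : (2 : ℝ) ≤ r := by exact_mod_cast hr
  have hr0 : (0 : ℝ) < r := by linarith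
  have h1r : 1 / (r : ℝ) ≤ 1 / 2 := one_div_le_one_div_of_le (by norm_num) hr'
  have h1r0 : 0 < 1 / (r : ℝ) := by positivity
  have hrr : (r : ℝ) * (1 / r) = 1 := mul_one_div_cancel hr0.ne'
  by_cases hq : 1 < q
  swap
  · -- There is no field with at most one element.
    refine ⟨1, 1, one_pos, one_pos, fun F _ _ hF => absurd ?_ hq⟩
    rw [← hF]
    exact RFreeMoments.one_lt_card
  have hq1 : (1 : ℝ) < q := by exact_mod_cast hq
  have hq0 : (0 : ℝ) < q := by linarith
  rcases lt_trichotomy k (1 + 1 / (r : ℝ)) with hlt | heq | hgt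
  · have hδ : 0 < r + 1 - r * k := by nlinarith
    have hc := RFreeMoments.one_div_one_sub_rpow_pos hq1 (neg_lt_zero.mpr hδ)
    rcases hk.eq_or_lt with rfl | hk0
    · refine ⟨(q : ℝ)⁻¹ * (1 / 12288 * (q : ℝ) ^ (-(3 * (17 * r + 23) * ((r : ℝ) + 1)))), 1,
        by positivity, one_pos, fun F _ _ hF N => ?_⟩
      subst hF
      have := Fintype.ofFinite F
      refine ⟨fun _ => ⟨RFreeMoments.le_moment_of_lt F hr hk (by linarith), ?_⟩,
          fun h => by linarith,
        fun h => by linarith⟩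
      rw [RFreeMoments.moment_eq_expect]
      simp
    · refine ⟨(q : ℝ)⁻¹ * (1 / 12288 * (q : ℝ) ^ (-(3 * (17 * r + 23) * ((r : ℝ) + 1)))),
        132 * (1 + 1 / (1 - (q : ℝ) ^ (-(r + 1 - r * k)))) *
          (1 / (1 - (q : ℝ) ^ (-(k / (r + 1)) / 2))) ^ 2,
        by positivity, ?_, fun F _ _ hF N => ?_⟩
      · have hk1 : 0 < k / (r + 1) := by positivity
        have := RFreeMoments.one_div_one_sub_rpow_pos hq1 (by linarith : -(k / (r + 1)) / 2 < 0)
        positivity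
      · subst hF
        have := Fintype.ofFinite F
        refine ⟨fun _ => ⟨RFreeMoments.le_moment_of_lt F hr hk (by linarith), ?_⟩,
          fun h => by linarith,
          fun h => by linarith⟩
        rw [RFreeMoments.moment_eq_expect]
        exact RFreeMoments.expect_norm_expTot_rpow_le_of_lt F hr (Nat.lt_succ_self N) hk0 hlt
  · refine ⟨(q : ℝ)⁻¹ * (1 / (8 * 4 ^ (k - 1))) / (2 * r),
      396 * (1 / (1 - (q : ℝ) ^ (-(1 / (r : ℝ)) / 2))) ^ 2, by positivity, ?_,
      fun F _ _ hF N => ?_⟩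
    · have := RFreeMoments.one_div_one_sub_rpow_pos hq1 (by linarith : -(1 / (r : ℝ)) / 2 < 0)
      positivity
    · subst hF
      have := Fintype.ofFinite F
      refine ⟨fun h => by linarith, fun _ hN => ⟨RFreeMoments.le_moment_of_eq F hr heq, ?_⟩,
        fun h => by linarith⟩
      rw [RFreeMoments.moment_eq_expect]
      exact RFreeMoments.expect_norm_expTot_rpow_le_of_eq F hr (Nat.lt_succ_self N) hN heq
  · have hδ : r + 1 - r * k < 0 := by nlinarith
    have hc := RFreeMoments.one_div_one_sub_rpow_pos hq1 hδ
    rcases le_total k 2 with hk2 | hk2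
    · refine ⟨(q : ℝ)⁻¹ * (1 / 2 ^ k), 132 * (1 + 1 / (1 - (q : ℝ) ^ (r + 1 - r * k))) *
        (1 / (1 - (q : ℝ) ^ (-(k - 1) / 2))) ^ 2, by positivity, ?_, fun F _ _ hF N => ?_⟩
      · have := RFreeMoments.one_div_one_sub_rpow_pos hq1 (by linarith : -(k - 1) / 2 < 0)
        positivity
      · subst hF
        have := Fintype.ofFinite F
        refine ⟨fun h => by linarith, fun h => by linarith,
          fun _ => ⟨RFreeMoments.le_moment_of_gt F hr hk, ?_⟩⟩
        rw [RFreeMoments.moment_eq_expect]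
        exact RFreeMoments.expect_norm_expTot_rpow_le_of_gt F hr (Nat.lt_succ_self N) hgt hk2
    · refine ⟨(q : ℝ)⁻¹ * (1 / 2 ^ k), 2 ^ (k - 1), by positivity, by positivity,
        fun F _ _ hF N => ?_⟩
      subst hF
      have := Fintype.ofFinite F
      refine ⟨fun h => by linarith, fun h => by linarith,
        fun _ => ⟨RFreeMoments.le_moment_of_gt F hr hk, ?_⟩⟩
      rw [RFreeMoments.moment_eq_expect]
      exact RFreeMoments.expect_norm_expTot_rpow_le_of_two_le F (Nat.lt_succ_self N) hk2
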